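/- Let $V=\{x_1,\dots,x_n\}$ be a set of propositional variables and $\pi\in S_n$ an order on it. Write $x^1=x$, $x^0=\bar x$. A clause is a set of literals in which no variable occurs together with its negation, $0$ is the empty clause, and a CNF is a set of clauses. Resolution has clauses as lines and the single rule: from $C\vee x_i^a$ and $D\vee x_i^{1-a}$ infer $C\vee D$ (where $C,D$ do not mention $x_i$ and $C\vee D$ must be a clause). A trail is an ordered list of annotated assignments $x_i\stackrel{*}{=}a$ ($a\in\{0,1\}$, $*\in\{d,u\}$) to pairwise distinct variables; for a clause $C$ and a trail $t$, $C|_t$ is $1$ if $t$ satisfies a literal of $C$, and otherwise is $C$ with all literals falsified by $t$ removed. The lines of the proof system $\pi$-$P_0$ are clauses and trails. The empty trail is always available, and the rules are: - (Decision) from $t$ infer $[t,x_i\stackrel{d}{=}a]$, where $x_i$ is the $\pi$-smallest variable of $V$ not appearing in $t$ and $a\in\{0,1\}$; - (Unit propagation) from $t$ and $C$ with $C|_t=x_i^a$ infer $[t,x_i\stackrel{u}{=}a]$; - (Learning) from $C\vee x_i^a$, $D\vee x_i^{1-a}$ and $t$ infer $C\vee D$ (where $C,D$ do not mention $x_i$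 and $C\vee D$ must be a clause), provided that $(C\vee D)|_t=0$, $t$ contains $x_i\stackrel{*}{=}a$ for some annotation $*$, and all variables of $C$ appear before $x_i$ in $t$. In either system, a refutation of a CNF $\tau$ is a sequence of lines that contains $0$ and in which every line is a clause of $\tau$, or (in $\pi$-$P_0$) the empty trail, or follows from earlier lines by a rule; its size is its number of lines. **Theorem.** For every order $\pi$, $\pi$-$P_0$ and general resolution are polynomially equivalent as refutation systems, uniformly in $n$ and $\pi$. That is, there is a polynomial-time algorithm that, given $n$, an order $\pi\in S_n$ and a resolution refutation, outputs a $\pi$-$P_0$ refutation of every CNF $\tau$ that the given refutation refutes (so both are from the same axioms); and there is a polynomial-time algorithm that in the same sense converts $\pi$-$P_0$ refutations to resolution refutations. In both directions the size of the output is also bounded by a fixed polynomial in $n$ and the size of the input refutation. -/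

import Mathlib

namespace OrderedCDCL

/-! ### Literals, clauses, CNFs -/

/-- The literal `x_i ^ a` over the variables `x_i`, `i : Fin n`, is the pair `(i, a)`:
`(i, true)` is the variable and `(i, false)` its negation. -/
abbrev Lit (n : ℕ) : Type := Fin n × Bool

/-- A clause: a set of literals in which no variable appears together with its negation. -/
@[ext] structure Clause (n : ℕ) : Type where
  lits : Finset (Lit n)
  consistent : ∀ i : Fin n, ¬ ((i, true) ∈ lits ∧ (i, false) ∈ lits)

/-- The empty clause `0`. -/
def Clause.zero (n : ℕ) : Clause n := ⟨∅, by simp⟩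

/-- A CNF is a set of clauses (automatically finite). -/
abbrev CNF (n : ℕ) : Type := Set (Clause n)

/-- `E` is obtained by the resolution rule from `A = C ∨ x_i ^ a` and `B = D ∨ x_i ^ (1 - a)`,
that is, `E = C ∨ D`. (`C`, `D` do not mention `x_i`; `E` has to be a clause.) -/
def IsResolvent {n : ℕ} (i : Fin n) (a : Bool) (A B E : Clause n) : Prop :=
  (i, a) ∈ A.lits ∧ (i, !a) ∈ B.lits ∧
    E.lits = A.lits.erase (i, a) ∪ B.lits.erase (i, !a)

/-! ### Trails -/

/-- Annotations: `d` for a decision, `u` for a unit propagation. -/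
inductive Ann : Type
  | d
  | u

/-- An annotated assignment `x_var =^ann val`. -/
structure Assignment (n : ℕ) : Type where
  var : Fin n
  val : Bool
  ann : Ann

/-- A trail: an ordered list of annotated assignments with pairwise distinct variables. -/
@[ext] structure Trail (n : ℕ) : Type where
  list : List (Assignment n)
  nodup : (list.map Assignment.var).Nodup

/-- The empty trail `Λ`. -/
def Trail.empty (n : ℕ) : Trail n := ⟨[], by simp⟩

/-- The variable `x_i` appears in the trail. -/
def Trail.Mentions {n : ℕ} (t : Trail n) (i : Fin n) : Prop := ∃ x ∈ t.list, x.var = i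

/-- The trail contains the assignment `x_i = a`, with either annotation. -/
def Trail.Sets {n : ℕ} (t : Trail n) (i : Fin n) (a : Bool) : Prop :=
  ∃ x ∈ t.list, x.var = i ∧ x.val = a

open Classical in
/-- The action `C|_t` of a trail on a clause: `none` stands for the constant `1` (some literal of
`C` is satisfied by `t`); otherwise the literals falsified by `t` are removed from `C`. -/
noncomputable def Clause.restrict {n : ℕ} (C : Clause n) (t : Trail n) :
    Option (Finset (Lit n)) :=
  if ∃ l ∈ C.lits, t.Sets l.1 l.2 then none
  else some (C.lits.filter fun l => ¬ t.Sets l.1 (!l.2))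

/-! ### The two proof systems -/

/-- A sequence of lines in which every line follows, according to `step`, from the set of lines
that occur before it. -/
def IsProof {α : Type} (step : Set α → α → Prop) (P : List α) : Prop :=
  ∀ (k : ℕ) (h : k < P.length), step {l | l ∈ P.take k} P[k]

/-- Resolution: a line is a clause of `τ` or a resolvent of two earlier lines. -/
inductive ResStep {n : ℕ} (τ : CNF n) (E : Set (Clause n)) : Clause n → Prop
  | hyp (C : Clause n) : C ∈ τ → ResStep τ E C
  | resolve (i : Fin n) (a : Bool) (A B C : Clause n) :
      A ∈ E → B ∈ E → IsResolvent i a A B C → ResStep τ E C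

/-- The lines of `π-P₀` are of two types, clauses and trails. -/
inductive Line (n : ℕ) : Type
  | clause (C : Clause n)
  | trail (t : Trail n)

/-- The inferences of `π-P₀` from the CNF `τ` and the set `E` of earlier lines. The order `π` puts
`x_i` before `x_j` when `π i < π j`. -/
inductive PZeroStep {n : ℕ} (π : Equiv.Perm (Fin n)) (τ : CNF n) (E : Set (Line n)) :
    Line n → Prop
  | hyp (C : Clause n) : C ∈ τ → PZeroStep π τ E (.clause C)
  | emptyTrail : PZeroStep π τ E (.trail (Trail.empty n))
  /-- `t ⊢ [t, x_i =^d a]` where `x_i` is the `π`-smallest variable that is not in `t`. -/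
  | decision (t t' : Trail n) (i : Fin n) (a : Bool) :
      Line.trail t ∈ E →
      ¬ t.Mentions i →
      (∀ j : Fin n, ¬ t.Mentions j → π i ≤ π j) →
      t'.list = t.list ++ [⟨i, a, .d⟩] →
      PZeroStep π τ E (.trail t')
  /-- `t, C ⊢ [t, x_i =^u a]` where `C|_t = x_i ^ a`. -/
  | unitPropagation (t t' : Trail n) (C : Clause n) (i : Fin n) (a : Bool) :
      Line.trail t ∈ E →
      Line.clause C ∈ E →
      C.restrict t = some {(i, a)} →
      t'.list = t.list ++ [⟨i, a, .u⟩] →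
      PZeroStep π τ E (.trail t')
  /-- `C ∨ x_i ^ a, D ∨ x_i ^ (1 - a), t ⊢ C ∨ D` where `(C ∨ D)|_t = 0`, the assignment
  `x_i = a` (with some annotation) is in `t`, and all variables of `C` appear before `x_i`
  in `t`. Here `A = C ∨ x_i ^ a`, `B = D ∨ x_i ^ (1 - a)`, `R = C ∨ D`. -/
  | learning (A B R : Clause n) (t : Trail n) (i : Fin n) (a : Bool) :
      Line.clause A ∈ E →
      Line.clause B ∈ E →
      Line.trail t ∈ E →
      IsResolvent i a A B R →
      R.restrict t = some ∅ →
      (∃ (t₁ t₂ : List (Assignment n)) (s : Ann), t.list = t₁ ++ ⟨i, a, s⟩ :: t₂ ∧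
        ∀ l ∈ A.lits.erase (i, a), ∃ x ∈ t₁, x.var = l.1) →
      PZeroStep π τ E (.clause R)

/-! ### Polynomial time: programs over binary trees, with a step count -/

/-- The data of the computation model: binary trees (S-expressions with the one atom `nil`). -/
inductive SExp : Type
  | nil
  | cons (l r : SExp)

namespace SExp

/-- The size of a tree: its number of nodes, leaves included. -/
def size : SExp → ℕ
  | nil => 1
  | cons l r => l.size + r.size + 1

def head : SExp → SExp
  | nil => nil
  | cons l _ => l

def tail : SExp → SExp
  | nil => nil
  | cons _ r => r

/-- Truth values: `nil` is false; `cons nil nil` (and any other non-`nil` tree) is true. -/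
def ofBool : Bool → SExp
  | false => nil
  | true => cons nil nil

/-- Natural numbers in unary. -/
def ofNat : ℕ → SExp
  | 0 => nil
  | k + 1 => cons nil (ofNat k)

/-- Lists, given an encoding of the entries. -/
def ofList {α : Type} (e : α → SExp) : List α → SExp
  | [] => nil
  | x :: xs => cons (e x) (ofList e xs)

open Classical in
/-- Equality test of the two components. -/
noncomputable def eqTest (x : SExp) : SExp := ofBool (decide (x.head = x.tail))

end SExp

/-- Programs, each mapping a tree to a tree: the identity, the constant `nil`, the two
projections, the equality test, pairing, composition (`comp p q` runs `q` first), a conditional,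
and the unbounded loop "while `b`, do `p`". This is a Turing-complete language. -/
inductive Prog : Type
  | id
  | nil
  | head
  | tail
  | eq
  | cons (p q : Prog)
  | comp (p q : Prog)
  | cond (b p q : Prog)
  | loop (b p : Prog)

/-- `Run p x y T`: the program `p`, started on `x`, halts with output `y` after time `T`. Each
elementary operation costs as much as the size of the tree it works on, so that the size of
every tree that occurs in a computation is at most `T`. -/
inductive Run : Prog → SExp → SExp → ℕ → Prop
  | id (x : SExp) : Run .id x x x.size
  | nil (x : SExp) : Run .nil x .nil x.size
  | head (x : SExp) : Run .head x x.head x.size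
  | tail (x : SExp) : Run .tail x x.tail x.size
  | eq (x : SExp) : Run .eq x x.eqTest (x.size + 2)
  | cons {p q : Prog} {x y z : SExp} {S T : ℕ} :
      Run p x y S → Run q x z T → Run (.cons p q) x (y.cons z) (S + T + 1)
  | comp {p q : Prog} {x y z : SExp} {S T : ℕ} :
      Run q x y S → Run p y z T → Run (.comp p q) x z (S + T + 1)
  | cond_true {b p q : Prog} {x c y : SExp} {S T : ℕ} :
      Run b x c S → c ≠ .nil → Run p x y T → Run (.cond b p q) x y (S + T + 1)
  | cond_false {b p q : Prog} {x y : SExp} {S T : ℕ} :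
      Run b x .nil S → Run q x y T → Run (.cond b p q) x y (S + T + 1)
  | loop_stop {b p : Prog} {x : SExp} {S : ℕ} :
      Run b x .nil S → Run (.loop b p) x x (S + 1)
  | loop_step {b p : Prog} {x c y z : SExp} {R S T : ℕ} :
      Run b x c R → c ≠ .nil → Run p x y S → Run (.loop b p) y z T →
      Run (.loop b p) x z (R + S + T + 1)

/-! ### Encodings -/

/-- A clause as its characteristic vector: for each variable, in the order `x_0, x_1, …`, the pair
of truth values "the variable occurs", "its negation occurs". -/
def Clause.encode {n : ℕ} (C : Clause n) : SExp :=
  SExp.ofList (fun i : Fin n =>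
    .cons (.ofBool (decide ((i, true) ∈ C.lits))) (.ofBool (decide ((i, false) ∈ C.lits))))
    (List.finRange n)

def Ann.encode : Ann → SExp
  | .d => .ofBool false
  | .u => .ofBool true

def Assignment.encode {n : ℕ} (x : Assignment n) : SExp :=
  .cons (.ofNat x.var) (.cons (.ofBool x.val) x.ann.encode)

def Trail.encode {n : ℕ} (t : Trail n) : SExp := SExp.ofList Assignment.encode t.list

def Line.encode {n : ℕ} : Line n → SExp
  | .clause C => .cons (.ofBool false) C.encode
  | .trail t => .cons (.ofBool true) t.encode

/-- An order on `n` variables as the list of the (unary) ranks of `x_0, x_1, …`. -/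
def encodeOrder {n : ℕ} (π : Equiv.Perm (Fin n)) : SExp :=
  SExp.ofList (fun i : Fin n => .ofNat (π i)) (List.finRange n)

/-! ### Polynomial simulation -/

/-- A refutation system for CNFs, given for every number `n` of variables and every order `π` on
them: a refutation is a list of lines, and its size is the length of this list. -/
structure RefutationSystem : Type 1 where
  Line : ℕ → Type
  encode : ∀ {n : ℕ}, Line n → SExp
  /-- `Refutes π τ P`: the list `P` is a refutation of the CNF `τ`. -/
  Refutes : ∀ {n : ℕ}, Equiv.Perm (Fin n) → CNF n → List (Line n) → Prop

/-- General resolution (which takes no notice of the order). -/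
abbrev resolution : RefutationSystem where
  Line := Clause
  encode := Clause.encode
  Refutes {n} _ τ P := IsProof (ResStep τ) P ∧ Clause.zero n ∈ P

/-- The system `π-P₀`. -/
abbrev pZero : RefutationSystem where
  Line := Line
  encode := Line.encode
  Refutes {n} π τ P := IsProof (PZeroStep π τ) P ∧ Line.clause (Clause.zero n) ∈ P

/-- `P` p-simulates `Q`, uniformly in the number of variables and in the order: one
polynomial-time program takes every order `π` and every `Q`-refutation, with respect to `π`, to a
`P`-refutation with respect to `π` of the same CNF. The CNF is no part of the input, so
the new refutation only uses hypotheses that the given one uses. The number of lines of the new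
refutation is polynomial in the number of lines of the given one and the number of variables. -/
def PSimulates (P Q : RefutationSystem) : Prop :=
  ∃ (c : Prog) (p : Polynomial ℕ),
    ∀ (n : ℕ) (π : Equiv.Perm (Fin n)) (τ : CNF n) (R : List (Q.Line n)), Q.Refutes π τ R →
      ∃ (R' : List (P.Line n)) (T : ℕ),
        Run c (.cons (encodeOrder π) (SExp.ofList Q.encode R)) (SExp.ofList P.encode R') T ∧
        T ≤ p.eval (SExp.cons (encodeOrder π) (SExp.ofList Q.encode R)).size ∧
        P.Refutes π τ R' ∧
        R'.length ≤ p.eval (n + R.length)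

/-- Polynomial equivalence: the two systems p-simulate each other. -/
def PolynomiallyEquivalent (P Q : RefutationSystem) : Prop :=
  PSimulates P Q ∧ PSimulates Q P

end OrderedCDCL

/-! One direction only discards the trails, because a learned clause is a resolvent of earlier
clauses (`isProof_filterMap_asClause`).

For the other direction, list the variables in the order `π` and let `low` be a prefix of this list.
A lift of `G` at `low` is `G` together with positive literals of variables in `low`. The order
permits the decisions that set `low` to zero, and under them a lift acts like `G`. Two manoeuvres
are available. (1) Let a clause have only positive literals on `low`, and let `¬g` have a lift at
`low`, where the variable of `g` is outside `low`. Then `g` can be removed from the clause by one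
learning step under a trail of decisions alone: the extra variables of the lift precede the variable
of `g` (`Good.removalLines`). (2) Call a literal decided if it and its negation both have lifts as
unit clauses. After `low` is zeroed, unit propagation sets decided variables at will, so resolutions
among lifts of clauses made of decided literals can be learned (`Good.resolutionLines`).

A pass starts from the given refutation at the empty prefix and carries along a refutation over the
undecided variables outside `low` whose axioms are nonempty and have lifts (`Reduced`). To add the
next variable `y` to `low`, set `y` to 1 if the unit clause `y` has a lift (then `¬y` is removable
by (1)), and to 0 otherwise (then `y` may stay in lifts). Let `X` be the set of literals now
decided, and delete `X` from the restricted refutation. If two complementary unit clauses result,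
they end a new refutation, whose axioms have lifts by (1). If not, the clauses inside `X` already
form a refutation (`Deriv.filter_subset`). It can be carried out by (2) and produces a lift of a
unit clause that had none before. This dichotomy is `newLift_or_reduced`.

When all variables are used up, no such refutation can exist, so every pass gains a new pair of a
prefix and a unit clause with a lift (`newLift_pass`). There are at most `2n(n+1)` such pairs. Hence
within polynomially many passes two complementary unit clauses have lifts at the empty prefix. These
lifts are the unit clauses themselves, and they resolve to the empty clause (`zero_mem_translate`).

The running time is handled by a calculus of polynomial-time functions in a context (`PT`). Its
central rule is iteration along a list with polynomially bounded intermediate results (`PT.foldl`);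
each part of the algorithm is an instance of such rules. -/

namespace OrderedCDCL

/-! ### Polynomially bounded functions -/

/-- `f` is bounded by a polynomial in `g`. -/
def PolyB {Γ : Type} (g f : Γ → ℕ) : Prop := ∃ c, ∀ γ, f γ ≤ (g γ + 2) ^ c

namespace PolyB
variable {Γ : Type} {g f f₁ f₂ h : Γ → ℕ}

theorem mono (hf : PolyB g f₂) (h : ∀ γ, f₁ γ ≤ f₂ γ) : PolyB g f₁ := by
  obtain ⟨c, hc⟩ := hf
  exact ⟨c, fun γ => (h γ).trans (hc γ)⟩

/-- The base `g γ + 2` is at least 2 even where `g` vanishes. So a large exponent absorbs constants,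
and one extra factor absorbs the sum of two bounds. -/
theorem const (k : ℕ) : PolyB g (fun _ => k) :=
  ⟨k, fun γ => (Nat.lt_two_pow_self (n := k)).le.trans (Nat.pow_le_pow_left (by omega) k)⟩

theorem self : PolyB g g := ⟨1, fun γ => by simp⟩

theorem add (h₁ : PolyB g f₁) (h₂ : PolyB g f₂) : PolyB g (fun γ => f₁ γ + f₂ γ) := by
  obtain ⟨c, hc⟩ := h₁
  obtain ⟨d, hd⟩ := h₂
  refine ⟨max c d + 1, fun γ => ?_⟩
  have p : 0 < g γ + 2 := by omega
  have h1 := (hc γ).trans (Nat.pow_le_pow_right p (le_max_left c d))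
  have h2 := (hd γ).trans (Nat.pow_le_pow_right p (le_max_right c d))
  rw [pow_succ]
  nlinarith [Nat.zero_le ((g γ + 2) ^ max c d * g γ)]

theorem mul (h₁ : PolyB g f₁) (h₂ : PolyB g f₂) : PolyB g (fun γ => f₁ γ * f₂ γ) := by
  obtain ⟨c, hc⟩ := h₁
  obtain ⟨d, hd⟩ := h₂
  exact ⟨c + d, fun γ => by rw [pow_add]; exact Nat.mul_le_mul (hc γ) (hd γ)⟩

theorem pow (h₁ : PolyB g f) (k : ℕ) : PolyB g (fun γ => f γ ^ k) := by
  obtain ⟨c, hc⟩ := h₁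
  exact ⟨c * k, fun γ => by rw [pow_mul]; exact Nat.pow_le_pow_left (hc γ) k⟩

theorem trans (h₁ : PolyB g f) (h₂ : PolyB f h) : PolyB g h := by
  obtain ⟨d, hd⟩ := h₂
  exact ((h₁.add (const 2)).pow d).mono hd

end PolyB

/-! ### Sizes of encoded data -/

namespace SExp

theorem one_le_size (x : SExp) : 1 ≤ x.size := by cases x <;> simp [size]

theorem size_head_le (x : SExp) : x.head.size ≤ x.size := by
  cases x <;> simp [size, head]; omega

theorem size_tail_le (x : SExp) : x.tail.size ≤ x.size := by
  cases x <;> simp [size, tail]; omega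

theorem size_ofBool_le (b : Bool) : (ofBool b).size ≤ 3 := by cases b <;> simp [ofBool, size]

theorem ofBool_injective : Function.Injective ofBool := by
  intro a b h; cases a <;> cases b <;> simp_all [ofBool]

theorem ofNat_injective : Function.Injective ofNat := by
  intro a
  induction a with
  | zero => intro b h; cases b <;> simp_all [ofNat]
  | succ a ih =>
    intro b h
    cases b with
    | zero => simp [ofNat] at h
    | succ b => simp only [ofNat, cons.injEq, true_and] at h; rw [ih h]

theorem size_ofNat (k : ℕ) : (ofNat k).size = 2 * k + 1 := by
  induction k with
  | zero => rfl
  | succ k ih => simp only [ofNat, size, ih]; omega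

section
variable {α : Type} (ea : α → SExp)

theorem size_ofList_append (l m : List α) :
    (ofList ea (l ++ m)).size + 1 = (ofList ea l).size + (ofList ea m).size := by
  induction l with
  | nil => simp [ofList, size]; omega
  | cons x l ih => simp only [List.cons_append, ofList, size]; omega

theorem length_le_size_ofList (l : List α) : l.length + 1 ≤ (ofList ea l).size := by
  induction l with
  | nil => simp [ofList, size]
  | cons x l ih => simp only [ofList, size, List.length_cons]; omega

theorem size_le_size_ofList {l : List α} {x : α} (h : x ∈ l) :
    (ea x).size ≤ (ofList ea l).size := by
  induction l with
  | nil => simp at h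
  | cons y l ih =>
    simp only [ofList, size]
    rcases List.mem_cons.1 h with rfl | h
    · omega
    · have := ih h; omega

theorem size_ofList_le {l : List α} {B : ℕ} (h : ∀ x ∈ l, (ea x).size ≤ B) :
    (ofList ea l).size ≤ l.length * (B + 1) + 1 := by
  induction l with
  | nil => simp [ofList, size]
  | cons x l ih =>
    have h1 := ih fun y hy => h y (List.mem_cons_of_mem _ hy)
    have h2 := h x List.mem_cons_self
    simp only [ofList, size, List.length_cons, Nat.add_mul]
    omega

end

/-- The encoding of options. -/
def ofOption {α : Type} (e : α → SExp) (o : Option α) : SExp := ofList e o.toList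

/-- The encoding of pairs. -/
def ofProd {α β : Type} (ea : α → SExp) (eb : β → SExp) (x : α × β) : SExp :=
  cons (ea x.1) (eb x.2)

end SExp

open SExp

/-- Every elementary operation is charged the size of its input. Time bounds thereby become bounds
on output sizes, which compositions and loops rely on. -/
theorem Run.size_le {p : Prog} {x y : SExp} {T : ℕ} (h : Run p x y T) :
    x.size ≤ T ∧ y.size ≤ T := by
  induction h with
  | id x => simp
  | nil x => exact ⟨le_rfl, x.one_le_size⟩
  | head x => exact ⟨le_rfl, x.size_head_le⟩
  | tail x => exact ⟨le_rfl, x.size_tail_le⟩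
  | eq x =>
    refine ⟨by omega, (size_ofBool_le _).trans ?_⟩
    have := x.one_le_size
    omega
  | cons _ _ h₁ h₂ => simp only [size]; omega
  | comp _ _ h₁ h₂ => omega
  | cond_true _ _ _ h₁ h₂ => omega
  | cond_false _ _ h₁ h₂ => omega
  | loop_stop _ h => omega
  | loop_step _ _ _ _ h₁ h₂ h₃ => omega

/-! ### Polynomial-time computability in a context -/

/-- `f γ` can be computed in polynomial time from `e γ`. -/
def PT {Γ : Type} (e f : Γ → SExp) : Prop :=
  ∃ (p : Prog) (T : Γ → ℕ), (∀ γ, Run p (e γ) (f γ) (T γ)) ∧ PolyB (fun γ => (e γ).size) T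

/-- The context `e` extended by one more variable. -/
def ctx {Γ : Type} {α : Γ → Type} (e : Γ → SExp) (ea : ∀ γ, α γ → SExp) :
    (Σ γ, α γ) → SExp :=
  fun δ => .cons (e δ.1) (ea δ.1 δ.2)

namespace PT
set_option linter.unusedVariables false
variable {Γ : Type} {e f g : Γ → SExp}

theorem polyB (h : PT e f) : PolyB (fun γ => (e γ).size) (fun γ => (f γ).size) := by
  obtain ⟨p, T, h, hT⟩ := h
  exact hT.mono fun γ => (h γ).size_le.2

theorem id : PT e e := ⟨.id, _, fun γ => .id _, .self⟩

theorem nil : PT e (fun _ => .nil) := ⟨.nil, _, fun γ => .nil _, .self⟩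

theorem cons (hf : PT e f) (hg : PT e g) : PT e (fun γ => .cons (f γ) (g γ)) := by
  obtain ⟨p, T, h, hT⟩ := hf
  obtain ⟨q, S, k, hS⟩ := hg
  exact ⟨.cons p q, _, fun γ => .cons (h γ) (k γ), (hT.add hS).add (.const 1)⟩

/-- Substitution: change of context. -/
theorem subst {Δ : Type} {e' : Δ → SExp} (k : Δ → Γ) (h : PT e f)
    (hk : PT e' (fun δ => e (k δ))) : PT e' (fun δ => f (k δ)) := by
  have hb := hk.polyB
  obtain ⟨p, T, h, c, hT⟩ := h
  obtain ⟨q, S, k, hS⟩ := hk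
  refine ⟨.comp p q, _, fun δ => .comp (k δ) (h _), (hS.add ?_).add (.const 1)⟩
  -- The second program works on `e (k δ)`. As the output of a polynomial-time program this is
  -- polynomially small, so its time bound composes.
  exact ((hb.add (.const 2)).pow c).mono fun δ => hT _

theorem comp {f : Γ → SExp} {h : SExp → SExp} (hh : PT (fun x : SExp => x) h) (hf : PT e f) :
    PT e (fun γ => h (f γ)) := subst f hh hf

theorem head (hf : PT e f) : PT e (fun γ => (f γ).head) :=
  comp (h := SExp.head) ⟨.head, _, fun γ => .head _, .self⟩ hf

theorem tail (hf : PT e f) : PT e (fun γ => (f γ).tail) :=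
  comp (h := SExp.tail) ⟨.tail, _, fun γ => .tail _, .self⟩ hf

theorem const (c : SExp) : PT e (fun _ => c) := by
  induction c with
  | nil => exact nil
  | cons l r hl hr => exact cons hl hr

open Classical in
theorem eq (hf : PT e f) (hg : PT e g) : PT e (fun γ => ofBool (decide (f γ = g γ))) :=
  comp (h := eqTest) ⟨.eq, _, fun γ => .eq _, PolyB.self.add (.const 2)⟩ (cons hf hg)

section
variable {α β σ : Γ → Type} {ea : ∀ γ, α γ → SExp} {eb : ∀ γ, β γ → SExp} {es : ∀ γ, σ γ → SExp}

theorem ite {b : Γ → Bool} {x y : ∀ γ, α γ} (hb : PT e (fun γ => ofBool (b γ)))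
    (hx : PT e (fun γ => ea γ (x γ))) (hy : PT e (fun γ => ea γ (y γ))) :
    PT e (fun γ => ea γ (if b γ then x γ else y γ)) := by
  obtain ⟨p, T, h, hT⟩ := hx
  obtain ⟨q, S, k, hS⟩ := hy
  obtain ⟨r, R, m, hR⟩ := hb
  refine ⟨.cond r p q, fun γ => R γ + (if b γ then T γ else S γ) + 1, fun γ => ?_,
    (hR.add ((hT.add hS).mono fun γ => by split <;> omega)).add (.const 1)⟩
  have m := m γ
  have h := h γ
  have k := k γ
  dsimp only at m h k ⊢
  cases hb : b γ with
  | true => exact .cond_true m (by simp [hb, ofBool]) (by simpa using h)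
  | false => rw [hb] at m; exact .cond_false m (by simpa using k)

theorem var : PT (ctx e ea) (fun δ => ea δ.1 δ.2) := tail (f := ctx e ea) id

theorem base : PT (ctx e ea) (fun δ => e δ.1) := head (f := ctx e ea) id

theorem wk (h : PT e f) : PT (ctx e ea) (fun δ => f δ.1) := subst Sigma.fst h base

/-- An entry is no larger than the encoded list that contains it, so one polynomial bounds the
values of `f` at all entries. -/
theorem bound_mem {l : ∀ γ, List (α γ)} {f : (Σ γ, α γ) → SExp}
    (hl : PT e (fun γ => ofList (ea γ) (l γ))) (hf : PT (ctx e ea) f) :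
    ∃ B, PolyB (fun γ => (e γ).size) B ∧ ∀ γ, ∀ x ∈ l γ, (f ⟨γ, x⟩).size ≤ B γ := by
  obtain ⟨c, hc⟩ := hf.polyB
  refine ⟨_, ((((PolyB.self.add hl.polyB).add (.const 1)).add (.const 2)).pow c), ?_⟩
  intro γ x hx
  refine (hc ⟨γ, x⟩).trans (Nat.pow_le_pow_left ?_ c)
  have := size_le_size_ofList (ea γ) hx
  simp only [ctx, size]
  omega

/-- The state of the loop consists of the context, the remaining list and the accumulator. `K`
bounds both a test and a round while the list has size at most `L` and the accumulator at most `B`;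
the hypothesis on prefixes keeps the accumulator in this range. A round then costs at most `2 * K +
1`, including the loop overhead. -/
theorem loop_run {α σ : Type} {ea : α → SExp} {es : σ → SExp} {x : SExp} {step : σ → α → σ}
    {t b : Prog} {B K L : ℕ}
    (ht : ∀ y z, y.size ≤ L → z.size ≤ B → ∃ T ≤ K, Run t (.cons x (.cons y z)) y T)
    (hb : ∀ a l s, (ofList ea (a :: l)).size ≤ L → (es s).size ≤ B → ∃ T ≤ K,
      Run b (.cons x (.cons (ofList ea (a :: l)) (es s)))
        (.cons x (.cons (ofList ea l) (es (step s a)))) T) (l : List α) (s : σ)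
    (hl : (ofList ea l).size ≤ L)
    (hs : ∀ l₁ l₂, l = l₁ ++ l₂ → (es (l₁.foldl step s)).size ≤ B) :
    ∃ T ≤ (l.length + 1) * (2 * K + 1),
      Run (.loop t b) (.cons x (.cons (ofList ea l) (es s)))
        (.cons x (.cons .nil (es (l.foldl step s)))) T := by
  induction l generalizing s with
  | nil =>
    obtain ⟨T, hT, h⟩ := ht (ofList ea []) (es s) hl (hs [] [] rfl)
    exact ⟨T + 1, by simp; omega, by constructor; exact h⟩
  | cons a l ih =>
    obtain ⟨T, hT, h⟩ := ht (ofList ea (a :: l)) (es s) hl (hs [] _ rfl)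
    obtain ⟨S, hS, h'⟩ := hb a l s hl (hs [] _ rfl)
    obtain ⟨R, hR, h''⟩ := ih (step s a) (by simp only [ofList, size] at hl; omega)
      (fun l₁ l₂ hh => hs (a :: l₁) l₂ (by rw [hh]; rfl))
    refine ⟨T + S + R + 1, ?_, .loop_step h (by simp [ofList]) h' h''⟩
    rw [List.length_cons, Nat.add_mul (l.length + 1)]
    omega

/-- Iteration along a list, the intermediate results being polynomially bounded. -/
theorem foldl {l : ∀ γ, List (α γ)} {s : ∀ γ, σ γ} {step : ∀ γ, σ γ → α γ → σ γ} {B : Γ → ℕ}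
    (hl : PT e (fun γ => ofList (ea γ) (l γ))) (hs : PT e (fun γ => es γ (s γ)))
    (hstep : PT (ctx (ctx e es) (fun δ => ea δ.1))
      (fun δ => es δ.1.1 (step δ.1.1 δ.1.2 δ.2)))
    (hB : PolyB (fun γ => (e γ).size) B)
    (hb : ∀ γ l₁ l₂, l γ = l₁ ++ l₂ → (es γ (l₁.foldl (step γ) (s γ))).size ≤ B γ) :
    PT e (fun γ => es γ ((l γ).foldl (step γ) (s γ))) := by
  -- One round pops the first entry and updates the accumulator.
  have hbody : PT (Γ := Σ γ, α γ × List (α γ) × σ γ)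
      (fun δ => .cons (e δ.1) (.cons (ofList (ea δ.1) (δ.2.1 :: δ.2.2.1)) (es δ.1 δ.2.2.2)))
      (fun δ => .cons (e δ.1) (.cons (ofList (ea δ.1) δ.2.2.1)
        (es δ.1 (step δ.1 δ.2.2.2 δ.2.1)))) := by
    refine cons (head id) (cons (tail (head (tail id))) ?_)
    exact subst (fun δ : (Σ γ, α γ × List (α γ) × σ γ) =>
      (⟨⟨δ.1, δ.2.2.2⟩, δ.2.1⟩ : Σ δ : (Σ γ, σ γ), α δ.1)) hstep
      (cons (cons (head id) (tail (tail id))) (head (head (tail id))))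
  -- The remaining list itself is the loop condition: its encoding is `nil` exactly when it is
  -- empty.
  have htest : PT (Γ := SExp × SExp × SExp) (fun δ => .cons δ.1 (.cons δ.2.1 δ.2.2))
      (fun δ => δ.2.1) := head (tail id)
  have hinit : PT e (fun γ => .cons (e γ) (.cons (ofList (ea γ) (l γ)) (es γ (s γ)))) :=
    cons id (cons hl hs)
  obtain ⟨t, Tt, ht, ct, hct⟩ := htest
  obtain ⟨b, Tb, hbd, cb, hcb⟩ := hbody
  have hL := hl.polyB
  have hE : PolyB (fun γ => (e γ).size)
      (fun γ => (e γ).size + (ofList (ea γ) (l γ)).size + B γ + 10) :=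
    ((PolyB.self.add hL).add hB).add (.const 10)
  obtain ⟨K, hKdef⟩ : ∃ K : Γ → ℕ, K = fun γ => 
    ((e γ).size + (ofList (ea γ) (l γ)).size + B γ + 10) ^ ct +
    ((e γ).size + (ofList (ea γ) (l γ)).size + B γ + 10) ^ cb := ⟨_, rfl⟩
  have hK : PolyB (fun γ => (e γ).size) K := by rw [hKdef]; exact (hE.pow ct).add (hE.pow cb)
  have key : ∀ γ, ∃ T ≤ ((l γ).length + 1) * (2 * K γ + 1),
      Run (.loop t b) (.cons (e γ) (.cons (ofList (ea γ) (l γ)) (es γ (s γ))))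
        (.cons (e γ) (.cons .nil (es γ ((l γ).foldl (step γ) (s γ))))) T := by
    intro γ
    refine loop_run (L := (ofList (ea γ) (l γ)).size) (B := B γ) ?_ ?_ (l γ) (s γ) le_rfl (hb γ)
    · intro y z hy hz
      refine ⟨_, ?_, ht (e γ, y, z)⟩
      refine (hct _).trans ?_
      rw [hKdef]
      refine le_trans (Nat.pow_le_pow_left ?_ ct) (Nat.le_add_right _ _)
      simp only [size]; omega
    · intro a l' s' hy hz
      refine ⟨_, ?_, hbd ⟨γ, a, l', s'⟩⟩
      refine (hcb _).trans ?_
      rw [hKdef]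
      refine le_trans (Nat.pow_le_pow_left ?_ cb) (Nat.le_add_left _ _)
      simp only [size]; omega
  choose T hT hrun using key
  have hloop : PT (fun γ => .cons (e γ) (.cons (ofList (ea γ) (l γ)) (es γ (s γ))))
      (fun γ => .cons (e γ) (.cons .nil (es γ ((l γ).foldl (step γ) (s γ))))) := by
    refine ⟨_, T, hrun, ?_⟩
    have h1 : PolyB (fun γ => (e γ).size) T :=
      ((hL.add (.const 0)).mul ((PolyB.mul (.const 2) hK).add (.const 1))).mono fun γ =>
        (hT γ).trans (Nat.mul_le_mul_right _ (length_le_size_ofList _ _))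
    refine PolyB.trans (f := fun γ => (e γ).size) (PolyB.self.mono fun γ => ?_) h1
    simp only [size]; omega
  exact subst (fun γ => γ) (tail (tail hloop)) hinit

/-- Growth by a bounded amount per step gives a polynomial bound along the whole list. A polynomial
time bound for a single step would not suffice, since polynomial growth could compound. -/
theorem foldl_add {l : ∀ γ, List (α γ)} {s : ∀ γ, σ γ} {step : ∀ γ, σ γ → α γ → σ γ} {B : Γ → ℕ}
    (hl : PT e (fun γ => ofList (ea γ) (l γ))) (hs : PT e (fun γ => es γ (s γ)))
    (hstep : PT (ctx (ctx e es) (fun δ => ea δ.1))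
      (fun δ => es δ.1.1 (step δ.1.1 δ.1.2 δ.2)))
    (hB : PolyB (fun γ => (e γ).size) B)
    (hb : ∀ γ s, ∀ x ∈ l γ, (es γ (step γ s x)).size ≤ (es γ s).size + B γ) :
    PT e (fun γ => es γ ((l γ).foldl (step γ) (s γ))) := by
  refine foldl hl hs hstep (hs.polyB.add (hl.polyB.mul hB)) ?_
  intro γ l₁ l₂ h
  have key : ∀ l₁ : List (α γ), l₁ ⊆ l γ → ∀ s,
      (es γ (l₁.foldl (step γ) s)).size ≤ (es γ s).size + l₁.length * B γ := by
    intro l₁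
    induction l₁ with
    | nil => intro _ s; simp
    | cons x l₁ ih =>
      intro hsub s
      have h1 := ih (fun y hy => hsub (List.mem_cons_of_mem _ hy)) (step γ s x)
      have h2 := hb γ s x (hsub List.mem_cons_self)
      simp only [List.foldl_cons, List.length_cons, Nat.add_mul]
      omega
  refine (key l₁ (by rw [h]; exact List.subset_append_left _ _) _).trans ?_
  refine Nat.add_le_add_left (Nat.mul_le_mul_right _ ?_) _
  have := length_le_size_ofList (ea γ) (l γ)
  rw [h, List.length_append] at this
  rw [h]; omega

theorem option_elim {o : ∀ γ, Option (α γ)} {a : ∀ γ, β γ} {f : ∀ γ, α γ → β γ}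
    (ho : PT e (fun γ => ofOption (ea γ) (o γ))) (ha : PT e (fun γ => eb γ (a γ)))
    (hf : PT (ctx e ea) (fun δ => eb δ.1 (f δ.1 δ.2))) :
    PT e (fun γ => eb γ ((o γ).elim (a γ) (f γ))) := by
  obtain ⟨B, hB, hb⟩ := bound_mem (l := fun γ => (o γ).toList) ho hf
  have : ∀ γ, (o γ).elim (a γ) (f γ) = (o γ).toList.foldl (fun _ x => f γ x) (a γ) := by
    intro γ; cases o γ <;> rfl
  simp only [this]
  refine foldl (es := eb) ho ha ?_ (ha.polyB.add hB) ?_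
  · exact subst (fun δ : (Σ δ : (Σ γ, β γ), α δ.1) => (⟨δ.1.1, δ.2⟩ : Σ γ, α γ)) hf
      (cons base.wk var)
  · intro γ l₁ l₂ h
    rcases l₁.eq_nil_or_concat with rfl | ⟨l, x, rfl⟩
    · simp
    · rw [List.concat_eq_append, List.foldl_concat]
      exact (hb γ x (by rw [h]; simp)).trans (Nat.le_add_left _ _)

theorem some {x : ∀ γ, α γ} (hx : PT e (fun γ => ea γ (x γ))) :
    PT e (fun γ => ofOption (ea γ) (some (x γ))) := cons hx nil

theorem none : PT e (fun γ => ofOption (ea γ) none) := nil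

theorem true : PT e (fun _ => ofBool true) := const _

theorem false : PT e (fun _ => ofBool false) := const _

theorem not {b : Γ → Bool} (hb : PT e (fun γ => ofBool (b γ))) :
    PT e (fun γ => ofBool (!b γ)) := by
  have := ite (ea := fun _ => ofBool) hb false true
  convert this using 3 with γ
  cases b γ <;> rfl

theorem and {b c : Γ → Bool} (hb : PT e (fun γ => ofBool (b γ)))
    (hc : PT e (fun γ => ofBool (c γ))) : PT e (fun γ => ofBool (b γ && c γ)) := by
  have := ite (ea := fun _ => ofBool) hb hc false
  convert this using 3 with γ
  cases b γ <;> simp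

theorem or {b c : Γ → Bool} (hb : PT e (fun γ => ofBool (b γ)))
    (hc : PT e (fun γ => ofBool (c γ))) : PT e (fun γ => ofBool (b γ || c γ)) := by
  have := ite (ea := fun _ => ofBool) hb true hc
  convert this using 3 with γ
  cases b γ <;> simp

theorem isSome {o : ∀ γ, Option (α γ)} (ho : PT e (fun γ => ofOption (ea γ) (o γ))) :
    PT e (fun γ => ofBool (o γ).isSome) := by
  have := option_elim (eb := fun _ => ofBool) (f := fun _ _ => Bool.true) ho false true
  convert this using 3 with γ
  cases o γ <;> rfl

open Classical in
theorem decide_eq {x y : ∀ γ, α γ} [∀ γ, DecidableEq (α γ)]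
    (inj : ∀ γ, Function.Injective (ea γ)) (hx : PT e (fun γ => ea γ (x γ)))
    (hy : PT e (fun γ => ea γ (y γ))) : PT e (fun γ => ofBool (decide (x γ = y γ))) := by
  have := eq hx hy
  convert this using 3 with γ
  simp [(inj γ).eq_iff]

theorem list_nil : PT e (fun γ => ofList (ea γ) []) := nil

theorem list_cons {x : ∀ γ, α γ} {l : ∀ γ, List (α γ)} (hx : PT e (fun γ => ea γ (x γ)))
    (hl : PT e (fun γ => ofList (ea γ) (l γ))) : PT e (fun γ => ofList (ea γ) (x γ :: l γ)) :=
  cons hx hl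

theorem any {l : ∀ γ, List (α γ)} {p : ∀ γ, α γ → Bool}
    (hl : PT e (fun γ => ofList (ea γ) (l γ)))
    (hp : PT (ctx e ea) (fun δ => ofBool (p δ.1 δ.2))) :
    PT e (fun γ => ofBool ((l γ).any (p γ))) := by
  have : ∀ γ, (l γ).any (p γ) = (l γ).foldl (fun b x => b || p γ x) Bool.false := by
    intro γ
    have : ∀ (m : List (α γ)) b, m.foldl (fun b x => b || p γ x) b = (b || m.any (p γ)) := by
      intro m
      induction m with
      | nil => simp
      | cons x m ih => intro b; simp [ih, Bool.or_assoc]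
    rw [this, Bool.false_or]
  simp only [this]
  refine foldl (es := fun _ => ofBool) hl false (or ?_ ?_) (.const 3)
    fun _ _ _ _ => size_ofBool_le _
  · exact var.wk
  · exact subst (fun δ : (Σ δ : (Σ _ : Γ, Bool), α δ.1) => (⟨δ.1.1, δ.2⟩ : Σ γ, α γ)) hp
      (cons base.wk var)

theorem all {l : ∀ γ, List (α γ)} {p : ∀ γ, α γ → Bool}
    (hl : PT e (fun γ => ofList (ea γ) (l γ)))
    (hp : PT (ctx e ea) (fun δ => ofBool (p δ.1 δ.2))) :
    PT e (fun γ => ofBool ((l γ).all (p γ))) := by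
  have := not (any (p := fun γ x => !p γ x) hl (not hp))
  convert this using 3 with γ
  simp [List.all_eq_not_any_not]

theorem findSome {l : ∀ γ, List (α γ)} {f : ∀ γ, α γ → Option (β γ)}
    (hl : PT e (fun γ => ofList (ea γ) (l γ)))
    (hf : PT (ctx e ea) (fun δ => ofOption (eb δ.1) (f δ.1 δ.2))) :
    PT e (fun γ => ofOption (eb γ) ((l γ).findSome? (f γ))) := by
  obtain ⟨B, hB, hb⟩ := bound_mem hl hf
  have : ∀ γ, (l γ).findSome? (f γ) =
      (l γ).foldl (fun b x => if b.isSome then b else f γ x) Option.none := by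
    intro γ
    have : ∀ (m : List (α γ)) b, m.foldl (fun b x => if b.isSome then b else f γ x) b =
        b.or (m.findSome? (f γ)) := by
      intro m
      induction m with
      | nil => intro b; cases b <;> rfl
      | cons x m ih =>
        intro b
        rw [List.foldl_cons, ih, List.findSome?_cons]
        cases b <;> simp
        cases f γ x <;> simp
    rw [this, Option.none_or]
  simp only [this]
  refine foldl (es := fun γ => ofOption (eb γ)) hl none
    (ite (isSome var.wk) var.wk ?_) (hB.add (.const 1)) ?_
  · exact subst (fun δ : (Σ δ : (Σ γ : Γ, Option (β γ)), α δ.1) => (⟨δ.1.1, δ.2⟩ : Σ γ, α γ)) hf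
      (cons base.wk var)
  · intro γ l₁
    induction l₁ using List.reverseRecOn with
    | nil => intro l₂ h; simp [ofOption, ofList, size]
    | append_singleton l x ih =>
      intro l₂ h
      rw [List.foldl_concat]
      split
      · exact ih (x :: l₂) (by rw [h]; simp)
      · exact (hb γ x (by rw [h]; simp)).trans (Nat.le_add_right _ _)

theorem reverse {l : ∀ γ, List (α γ)} (hl : PT e (fun γ => ofList (ea γ) (l γ))) :
    PT e (fun γ => ofList (ea γ) (l γ).reverse) := by
  have : ∀ γ, (l γ).reverse = (l γ).foldl (fun m x => x :: m) [] := by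
    intro γ; simp
  simp only [this]
  refine foldl_add (es := fun γ => ofList (ea γ)) hl list_nil (list_cons var var.wk)
    (hl.polyB.add (.const 1)) ?_
  intro γ s x hx
  have := size_le_size_ofList (ea γ) hx
  simp only [ofList, size]; omega

theorem append {l m : ∀ γ, List (α γ)} (hl : PT e (fun γ => ofList (ea γ) (l γ)))
    (hm : PT e (fun γ => ofList (ea γ) (m γ))) :
    PT e (fun γ => ofList (ea γ) (l γ ++ m γ)) := by
  have : ∀ γ, l γ ++ m γ = (l γ).reverse.foldl (fun m x => x :: m) (m γ) := by
    intro γ; simp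
  simp only [this]
  refine foldl_add (es := fun γ => ofList (ea γ)) (reverse hl) hm (list_cons var var.wk)
    (hl.polyB.add (.const 1)) ?_
  intro γ s x hx
  have := size_le_size_ofList (ea γ) (List.mem_reverse.1 hx)
  simp only [ofList, size]; omega

theorem flatMap {l : ∀ γ, List (α γ)} {f : ∀ γ, α γ → List (β γ)}
    (hl : PT e (fun γ => ofList (ea γ) (l γ)))
    (hf : PT (ctx e ea) (fun δ => ofList (eb δ.1) (f δ.1 δ.2))) :
    PT e (fun γ => ofList (eb γ) ((l γ).flatMap (f γ))) := by
  obtain ⟨B, hB, hb⟩ := bound_mem hl hf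
  have : ∀ γ, (l γ).flatMap (f γ) = (l γ).foldl (fun m x => m ++ f γ x) [] := by
    intro γ; rw [List.flatMap_eq_foldl]
  simp only [this]
  refine foldl_add (es := fun γ => ofList (eb γ)) hl list_nil
    (append var.wk ?_) hB ?_
  · exact subst (fun δ : (Σ δ : (Σ γ : Γ, List (β γ)), α δ.1) => (⟨δ.1.1, δ.2⟩ : Σ γ, α γ)) hf
      (cons base.wk var)
  · intro γ s x hx
    have h1 := size_ofList_append (eb γ) s (f γ x)
    have h2 : (ofList (eb γ) (f γ x)).size ≤ B γ := hb γ x hx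
    omega

theorem singleton {x : ∀ γ, α γ} (hx : PT e (fun γ => ea γ (x γ))) :
    PT e (fun γ => ofList (ea γ) [x γ]) := list_cons hx list_nil

theorem map {l : ∀ γ, List (α γ)} {f : ∀ γ, α γ → β γ}
    (hl : PT e (fun γ => ofList (ea γ) (l γ)))
    (hf : PT (ctx e ea) (fun δ => eb δ.1 (f δ.1 δ.2))) :
    PT e (fun γ => ofList (eb γ) ((l γ).map (f γ))) := by
  simp only [List.map_eq_flatMap]
  exact flatMap hl (singleton hf)

theorem filter {l : ∀ γ, List (α γ)} {p : ∀ γ, α γ → Bool}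
    (hl : PT e (fun γ => ofList (ea γ) (l γ)))
    (hp : PT (ctx e ea) (fun δ => ofBool (p δ.1 δ.2))) :
    PT e (fun γ => ofList (ea γ) ((l γ).filter (p γ))) := by
  have := flatMap (eb := ea) (f := fun γ x => if p γ x then [x] else []) hl
    (ite (α := fun δ : (Σ γ, α γ) => List (α δ.1)) (ea := fun δ => ofList (ea δ.1)) hp
      (singleton (α := fun δ : (Σ γ, α γ) => α δ.1) (ea := fun δ => ea δ.1) var) list_nil)
  convert this using 3 with γ
  induction l γ with
  | nil => rfl
  | cons x l ih => rw [List.filter_cons, List.flatMap_cons, ← ih]; cases p γ x <;> rfl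

theorem filterMap {l : ∀ γ, List (α γ)} {f : ∀ γ, α γ → Option (β γ)}
    (hl : PT e (fun γ => ofList (ea γ) (l γ)))
    (hf : PT (ctx e ea) (fun δ => ofOption (eb δ.1) (f δ.1 δ.2))) :
    PT e (fun γ => ofList (eb γ) ((l γ).filterMap (f γ))) := by
  have := flatMap (f := fun γ x => (f γ x).toList) hl hf
  convert this using 3 with γ
  induction l γ with
  | nil => rfl
  | cons x l ih => rw [List.filterMap_cons, List.flatMap_cons, ← ih]; cases f γ x <;> rfl

theorem prod {x : ∀ γ, α γ} {y : ∀ γ, β γ} (hx : PT e (fun γ => ea γ (x γ)))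
    (hy : PT e (fun γ => eb γ (y γ))) : PT e (fun γ => ofProd (ea γ) (eb γ) (x γ, y γ)) :=
  cons hx hy

theorem fst {x : ∀ γ, α γ × β γ} (hx : PT e (fun γ => ofProd (ea γ) (eb γ) (x γ))) :
    PT e (fun γ => ea γ (x γ).1) := head hx

theorem snd {x : ∀ γ, α γ × β γ} (hx : PT e (fun γ => ofProd (ea γ) (eb γ) (x γ))) :
    PT e (fun γ => eb γ (x γ).2) := tail hx

/-- A trail is derived through all its prefixes, each of which is a line. The total size is at most
quadratic in the size of the list. -/
theorem inits {l : ∀ γ, List (α γ)} (hl : PT e (fun γ => ofList (ea γ) (l γ))) :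
    PT e (fun γ => ofList (ofList (ea γ)) (l γ).inits) := by
  have key : ∀ γ (m : List (α γ)), m.foldl (fun (s : List (α γ) × List (List (α γ))) x =>
      (s.1 ++ [x], s.2 ++ [s.1 ++ [x]])) ([], [[]]) = (m, m.inits) := by
    intro γ m
    induction m using List.reverseRecOn with
    | nil => rfl
    | append_singleton m x ih => rw [List.foldl_concat, ih]; simp [List.inits_append]
  have h := foldl (l := l) (es := fun γ => ofProd (ofList (ea γ)) (ofList (ofList (ea γ))))
    (s := fun _ => ([], [[]])) (step := fun γ s x => (s.1 ++ [x], s.2 ++ [s.1 ++ [x]]))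
    (B := fun γ => (ofList (ea γ) (l γ)).size + (((ofList (ea γ) (l γ)).size + 1) *
      ((ofList (ea γ) (l γ)).size + 1) + 1) + 1) hl
    (const (.cons .nil (.cons .nil .nil))) ?_ ?_ ?_
  · simp only [key] at h
    exact snd (ea := fun γ => ofList (ea γ)) h
  · have h1 : PT (ctx (ctx e (fun γ => ofProd (ofList (ea γ)) (ofList (ofList (ea γ)))))
        (fun δ => ea δ.1)) (fun δ => ofList (ea δ.1.1) (δ.1.2.1 ++ [δ.2])) :=
      append (fst var.wk)
        (singleton var)
    exact prod h1
      (append (snd var.wk)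
        (singleton h1))
  · have := hl.polyB
    have h1 := this.add (.const 1)
    exact (this.add ((h1.mul h1).add (.const 1))).add (.const 1)
  · intro γ l₁ l₂ h
    rw [key]
    have hs : (ofList (ea γ) l₁).size ≤ (ofList (ea γ) (l γ)).size := by
      have h1 := size_ofList_append (ea γ) l₁ l₂
      have h2 := (ofList (ea γ) l₂).one_le_size
      rw [h]; omega
    have hi : (ofList (ofList (ea γ)) l₁.inits).size ≤
        l₁.inits.length * ((ofList (ea γ) (l γ)).size + 1) + 1 := by
      refine size_ofList_le _ fun m hm => ?_
      obtain ⟨m', rfl⟩ := List.mem_inits _ _ |>.1 hm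
      have h1 := size_ofList_append (ea γ) m m'
      have h2 := (ofList (ea γ) m').one_le_size
      omega
    have hlen : l₁.inits.length ≤ (ofList (ea γ) (l γ)).size + 1 := by
      have := length_le_size_ofList (ea γ) l₁
      rw [List.length_inits]; omega
    have := hi.trans (Nat.add_le_add_right (Nat.mul_le_mul_right _ hlen) 1)
    simp only [ofProd, size]
    omega

end
end PT
/-! ### The translation of resolution refutations: the algorithm -/

section Algorithm
variable {n : ℕ}

/-- The opposite literal. -/
def negLit (l : Lit n) : Lit n := (l.1, !l.2)

/-- All literals. -/
def allLits (n : ℕ) : List (Lit n) :=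
  (List.finRange n).flatMap fun i => [(i, true), (i, false)]

/-- Lines of `π-P₀` without their well-formedness conditions. -/
inductive RawLine (n : ℕ) : Type
  | clause (S : Finset (Lit n))
  | trail (t : List (Assignment n))

/-- The clause of a line. -/
def RawLine.asClause : RawLine n → Option (Finset (Lit n))
  | .clause S => some S
  | .trail _ => none

/-- `S` only has positive literals of the variables in `low`. -/
def posOn (low : List (Fin n)) (S : Finset (Lit n)) : Bool :=
  (allLits n).all fun l => !decide (l ∈ S) || (!low.contains l.1 || l.2)

/-- `S` is `G` together with positive literals of variables in `low`. -/
def isLift (low : List (Fin n)) (G S : Finset (Lit n)) : Bool :=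
  (allLits n).all fun l =>
    if low.contains l.1 then !decide (l ∈ G) && (!decide (l ∈ S) || l.2)
    else decide (l ∈ S) == decide (l ∈ G)

/-- A clause line that is a lift of `G`. -/
def findLift (low : List (Fin n)) (G : Finset (Lit n)) (Δ : List (RawLine n)) :
    Option (Finset (Lit n)) :=
  (Δ.filterMap RawLine.asClause).find? fun S => isLift low G S

/-- The decision trail that falsifies `R` and makes `g` false. -/
def decisionTrail (vs : List (Fin n)) (g : Lit n) (R : Finset (Lit n)) : List (Assignment n) :=
  vs.map fun v => ⟨v, if decide (v = g.1) then !g.2 else decide ((v, false) ∈ R), .d⟩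

/-- The lines that remove `g` from `S` by a resolution with `T`. -/
def removalLines (vs : List (Fin n)) (g : Lit n) (S T : Finset (Lit n)) : List (RawLine n) :=
  (decisionTrail vs g (S.erase g ∪ T.erase (negLit g))).inits.map .trail ++
    [.clause (S.erase g ∪ T.erase (negLit g))]

/-- Remove `g` from `S`, by means of a clause of `Δ` that is `¬ g` up to positive literals of
variables in `low`. -/
def remove (vs : List (Fin n)) (Δ : List (RawLine n)) (S : Finset (Lit n))
    (op : List (Fin n) × Lit n) : List (RawLine n) × Finset (Lit n) :=
  if decide (op.2 ∈ S) && (posOn op.1 S && !op.1.contains op.2.1) then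
    (findLift op.1 {negLit op.2} Δ).elim ([], S) fun T =>
      (removalLines vs op.2 S T, S.erase op.2 ∪ T.erase (negLit op.2))
  else ([], S)

/-- Remove several literals. -/
def removeAll (vs : List (Fin n)) (Δ : List (RawLine n)) (ops : List (List (Fin n) × Lit n))
    (S : Finset (Lit n)) : List (RawLine n) × Finset (Lit n) :=
  ops.foldl (fun s op => (s.1 ++ (remove vs Δ s.2 op).1, (remove vs Δ s.2 op).2)) ([], S)

/-- `E` is the resolvent of `A`, `B` on the literal `l`. -/
def isRes (l : Lit n) (A B E : Finset (Lit n)) : Bool :=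
  decide (l ∈ A) && (decide (negLit l ∈ B) && decide (E = A.erase l ∪ B.erase (negLit l)))

/-- The trail that sets `low` to zero, falsifies `E` and satisfies `l`. -/
def propagationTrail (low : List (Fin n)) (E : Finset (Lit n)) (l : Lit n) :
    List (Assignment n) :=
  low.map (fun v => ⟨v, false, .d⟩) ++
    (((allLits n).filter fun e => decide (e ∈ E)).map fun e => ⟨e.1, !e.2, .u⟩) ++
      [⟨l.1, l.2, .u⟩]

/-- The lines that resolve `S` and `T` on `l`, under a trail made by propagation. -/
def resolutionLines (low : List (Fin n)) (E : Finset (Lit n)) (l : Lit n)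
    (S T : Finset (Lit n)) : List (RawLine n) :=
  (propagationTrail low E l).inits.map .trail ++ [.clause (S.erase l ∪ T.erase (negLit l))]

/-- A member of the list, nonempty if possible. -/
def pick (cs : List (Finset (Lit n))) : Option (Finset (Lit n)) :=
  (cs.find? fun x => !decide (x = ∅)).elim (cs.find? fun _ => true) some

/-- The given reductions that do not contain the resolved literals. -/
def candidates (l : Lit n) (a b : Option (Finset (Lit n))) : List (Finset (Lit n)) :=
  a.toList.filter (fun x => !decide (l ∈ x)) ++ b.toList.filter fun y => !decide (negLit l ∈ y)

/-- A resolution step, for clauses with given reductions `a`, `b`. -/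
def combine (l : Lit n) (a b : Option (Finset (Lit n))) : Option (Finset (Lit n)) :=
  if a.elim false (fun x => decide (l ∈ x)) && b.elim false (fun y => decide (negLit l ∈ y)) then
    a.elim none fun x => b.elim none fun y => some (x.erase l ∪ y.erase (negLit l))
  -- A reduced premise that lacks its pivot literal is a subset of the original resolvent and can
  -- stand in for it.
  else pick (candidates l a b)

/-- A pair of clauses in the table with the resolvent `E`: the pivot and the reductions. -/
def findRes (M : List (Finset (Lit n) × Option (Finset (Lit n)))) (E : Finset (Lit n)) :
    Option (Lit n × Option (Finset (Lit n)) × Option (Finset (Lit n))) :=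
  M.findSome? fun x => M.findSome? fun y => (allLits n).findSome? fun l =>
    if isRes l x.1 y.1 E then some (l, x.2, y.2) else none

/-- The reduction of `E`, given the table of the reductions of the clauses before it. -/
def reduceClause (del forb : Finset (Lit n)) (M : List (Finset (Lit n) × Option (Finset (Lit n))))
    (E : Finset (Lit n)) : Option (Finset (Lit n)) :=
  (findRes M E).elim (if decide (E ∩ forb = ∅) then some (E \ del) else none)
    fun r => combine r.1 r.2.1 r.2.2

/-- The table of the reductions of the clauses of `P`. -/
def reduceTable (del forb : Finset (Lit n)) (P : List (Finset (Lit n))) :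
    List (Finset (Lit n) × Option (Finset (Lit n))) :=
  P.foldl (fun M E => M ++ [(E, reduceClause del forb M E)]) []

/-- The derivation `P` with the literals in `del` deleted, without the clauses that depend on
the literals in `forb`. -/
def reduce (del forb : Finset (Lit n)) (P : List (Finset (Lit n))) : List (Finset (Lit n)) :=
  (reduceTable del forb P).filterMap Prod.snd

/-- The literals of variables outside `low` both of whose literals have lifts. -/
def decided (low : List (Fin n)) (Δ : List (RawLine n)) : Finset (Lit n) :=
  Finset.univ.filter fun l => (!low.contains l.1 &&
    ((findLift low {l} Δ).isSome && (findLift low {negLit l} Δ).isSome)) = true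

/-- No variable occurs together with its negation. -/
def isConsistent (E : Finset (Lit n)) : Bool :=
  (allLits n).all fun l => !decide (l ∈ E) || !decide (negLit l ∈ E)

/-- Two lifts of clauses of `F` inside `X` with the resolvent `E`, and the pivot. -/
def findResLifts (low : List (Fin n)) (X : Finset (Lit n)) (F : List (Finset (Lit n)))
    (Δ : List (RawLine n)) (E : Finset (Lit n)) :
    Option (Lit n × Finset (Lit n) × Finset (Lit n)) :=
  F.findSome? fun A => F.findSome? fun B => (allLits n).findSome? fun l =>
    if isRes l A B E && (decide (A ⊆ X) && (decide (B ⊆ X) &&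
        (!decide (l ∈ E) && !decide (negLit l ∈ E)))) then
      (findLift low A Δ).elim none fun S => (findLift low B Δ).elim none fun T => some (l, S, T)
    else none

/-- Derive a lift of `E`, if possible. -/
def resolveLifts (low low' : List (Fin n)) (X : Finset (Lit n)) (F : List (Finset (Lit n)))
    (Δ : List (RawLine n)) (E : Finset (Lit n)) : List (RawLine n) :=
  if decide (E ⊆ X) && isConsistent E then
    (findResLifts low X F Δ E).elim [] fun r => resolutionLines low' E r.1 r.2.1 r.2.2
  else []

/-- The literals to be removed from lifts when `y` is added to `low`. -/
def removals (low low' : List (Fin n)) (y : Fin n) (X : Finset (Lit n)) :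
    List (List (Fin n) × Lit n) :=
  -- The literal `¬y` goes first, by a lift at `low`. Only then is the clause positive on `low'`, as
  -- the later removals require.
  (low, (y, false)) :: (((allLits n).filter fun l => decide (l ∈ X)).map fun l => (low', l))

/-- The derivation with the variable `y` removed. -/
def firstReduction (low : List (Fin n)) (y : Fin n) (P : List (Finset (Lit n)))
    (Δ : List (RawLine n)) : List (Finset (Lit n)) :=
  -- If the unit clause `y` has a lift, this is the restriction `y = 1`, and otherwise `y = 0`. In
  -- the second case the deleted literal `y` needs no removal from lifts, because `y` joins `low`.
  reduce {(y, !(findLift low {(y, true)} Δ).isSome)} {(y, (findLift low {(y, true)} Δ).isSome)} P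

/-- All lines that come from removals of literals. -/
def removalStage (vs low low' : List (Fin n)) (y : Fin n) (P : List (Finset (Lit n)))
    (Δ : List (RawLine n)) : List (RawLine n) :=
  P.flatMap fun G => (findLift low G Δ).elim [] fun S =>
    (removeAll vs Δ (removals low low' y (decided low' Δ)) S).1

/-- All lines that come from resolutions. -/
def resolutionStage (low low' : List (Fin n)) (X : Finset (Lit n)) (F P : List (Finset (Lit n)))
    (Δ : List (RawLine n)) : List (RawLine n) :=
  P.foldl (fun Δ E => Δ ++ resolveLifts low low' X F Δ E) Δ

/-- One level: `y` is added to `low`. -/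
def level (vs low : List (Fin n)) (y : Fin n) (s : List (Finset (Lit n)) × List (RawLine n)) :
    List (Finset (Lit n)) × List (RawLine n) :=
  -- Empty clauses must not serve as axioms at the next level. They are dropped, and the empty
  -- clause is put back at the end, where it is to be the resolvent of two complementary unit
  -- clauses.
  ((reduce (decided (low ++ [y]) s.2) ∅ (firstReduction low y s.1 s.2)).filter
      (fun G => !decide (G = ∅)) ++ [∅],
    resolutionStage low (low ++ [y]) (decided (low ++ [y]) s.2) (firstReduction low y s.1 s.2)
      (firstReduction low y s.1 s.2) (s.2 ++ removalStage vs low (low ++ [y]) y s.1 s.2))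

/-- One pass through all levels, from the derivation `P`. -/
def pass (vs : List (Fin n)) (levels : List (List (Fin n) × Fin n)) (P : List (Finset (Lit n)))
    (Δ : List (RawLine n)) : List (RawLine n) :=
  (levels.foldl (fun s k => level vs k.1 k.2 s) (P, Δ)).2

/-- The empty clause from two complementary unit clauses. -/
def finish (Δ : List (RawLine n)) : List (RawLine n) :=
  (allLits n).flatMap fun l => (findLift [] {l} Δ).elim [] fun S =>
    (findLift [] {negLit l} Δ).elim [] fun T => resolutionLines [] ∅ l S T

/-- The clauses that are not resolvents of clauses before them. -/
def hypotheses (P : List (Finset (Lit n))) : List (RawLine n) :=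
  (P.foldl (fun (s : List (Finset (Lit n) × Option (Finset (Lit n))) × List (RawLine n)) E =>
    (s.1 ++ [(E, none)], if (findRes s.1 E).isSome then s.2 else s.2 ++ [.clause E])) ([], [])).2

/-- The index set of the passes. -/
def passes (n : ℕ) : List (Lit n) :=
  (allLits n).flatMap fun _ => (allLits n).flatMap fun _ => allLits n

/-- The lines after all passes. -/
def allPasses (vs : List (Fin n)) (levels : List (List (Fin n) × Fin n))
    (P : List (Finset (Lit n))) : List (RawLine n) :=
  (passes n).foldl (fun Δ _ => pass vs levels P Δ) (hypotheses P)

/-- The whole translation. -/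
def translate (vs : List (Fin n)) (levels : List (List (Fin n) × Fin n))
    (P : List (Finset (Lit n))) : List (RawLine n) :=
  allPasses vs levels P ++ finish (allPasses vs levels P)

end Algorithm

/-! ### Specification of the auxiliary functions -/

section Spec
variable {n : ℕ}

@[simp] theorem negLit_negLit (l : Lit n) : negLit (negLit l) = l := by simp [negLit]

@[simp] theorem negLit_fst (l : Lit n) : (negLit l).1 = l.1 := rfl

theorem eq_or_eq_negLit {l m : Lit n} (h : m.1 = l.1) : m = l ∨ m = negLit l := by
  obtain ⟨i, a⟩ := l
  obtain ⟨j, b⟩ := m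
  cases a <;> cases b <;> simp_all [negLit]

@[simp] theorem mem_allLits (l : Lit n) : l ∈ allLits n := by
  obtain ⟨i, a⟩ := l
  simp only [allLits, List.mem_flatMap]
  exact ⟨i, List.mem_finRange i, by cases a <;> simp⟩

/-- `S` is `G` together with positive literals of variables in `low`. -/
def IsLift (low : List (Fin n)) (G S : Finset (Lit n)) : Prop :=
  (∀ l : Lit n, l.1 ∉ low → (l ∈ S ↔ l ∈ G)) ∧
    ∀ l : Lit n, l.1 ∈ low → l ∉ G ∧ (l ∈ S → l.2 = true)

/-- Some clause line of `Δ` is a lift of `G`. -/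
def HasLift (Δ : List (RawLine n)) (low : List (Fin n)) (G : Finset (Lit n)) : Prop :=
  ∃ S, RawLine.clause S ∈ Δ ∧ IsLift low G S

/-- No variable occurs together with its negation. -/
def Consistent (S : Finset (Lit n)) : Prop := ∀ l ∈ S, negLit l ∉ S

theorem isLift_iff {low : List (Fin n)} {G S : Finset (Lit n)} :
    isLift low G S = true ↔ IsLift low G S := by
  simp only [isLift, List.all_eq_true, mem_allLits, true_imp_iff, IsLift, ← forall_and]
  refine forall_congr' fun l => ?_
  by_cases h : l.1 ∈ low
  · simp [h, imp_iff_not_or]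
  · simp only [List.contains_eq_mem, h, decide_false, Bool.false_eq_true, if_false, beq_iff_eq,
      decide_eq_decide, not_false_eq_true, true_imp_iff, false_imp_iff, and_true]

theorem posOn_iff {low : List (Fin n)} {S : Finset (Lit n)} :
    posOn low S = true ↔ ∀ l ∈ S, l.1 ∈ low → l.2 = true := by
  simp only [posOn, List.all_eq_true, mem_allLits, true_imp_iff]
  refine forall_congr' fun l => ?_
  by_cases h : l.1 ∈ low <;> by_cases h' : l ∈ S <;> simp [h, h']

theorem isConsistent_iff {S : Finset (Lit n)} : isConsistent S = true ↔ Consistent S := by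
  simp [isConsistent, Consistent, List.all_eq_true, mem_allLits, imp_iff_not_or]

theorem isRes_iff {l : Lit n} {A B E : Finset (Lit n)} : isRes l A B E = true ↔
    l ∈ A ∧ negLit l ∈ B ∧ E = A.erase l ∪ B.erase (negLit l) := by
  simp [isRes]

theorem mem_clauses {Δ : List (RawLine n)} {S : Finset (Lit n)} :
    S ∈ Δ.filterMap RawLine.asClause ↔ RawLine.clause S ∈ Δ := by
  rw [List.mem_filterMap]
  constructor
  · rintro ⟨L, hL, h⟩
    cases L <;> simp_all [RawLine.asClause]
  · exact fun h => ⟨_, h, rfl⟩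

theorem findLift_eq_some {low : List (Fin n)} {G S : Finset (Lit n)} {Δ : List (RawLine n)}
    (h : findLift low G Δ = some S) : RawLine.clause S ∈ Δ ∧ IsLift low G S :=
  ⟨mem_clauses.1 (List.mem_of_find?_eq_some h), isLift_iff.1 (by
    have := List.find?_some h
    exact this)⟩

theorem isSome_findLift {low : List (Fin n)} {G : Finset (Lit n)} {Δ : List (RawLine n)} :
    (findLift low G Δ).isSome = true ↔ HasLift Δ low G := by
  constructor
  · intro h
    obtain ⟨S, hS⟩ := Option.isSome_iff_exists.1 h
    exact ⟨S, findLift_eq_some hS⟩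
  · rintro ⟨S, hS, h⟩
    rw [findLift, List.find?_isSome]
    exact ⟨S, mem_clauses.2 hS, isLift_iff.2 h⟩

theorem mem_decided {low : List (Fin n)} {Δ : List (RawLine n)} {l : Lit n} :
    l ∈ decided low Δ ↔ l.1 ∉ low ∧ HasLift Δ low {l} ∧ HasLift Δ low {negLit l} := by
  simp only [decided, Finset.mem_filter, Finset.mem_univ, true_and, Bool.and_eq_true,
    isSome_findLift]
  simp

theorem negLit_mem_decided {low : List (Fin n)} {Δ : List (RawLine n)} {l : Lit n} :
    negLit l ∈ decided low Δ ↔ l ∈ decided low Δ := by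
  simp only [mem_decided, negLit_fst, negLit_negLit]
  tauto

theorem HasLift.mono {Δ Δ' : List (RawLine n)} {low : List (Fin n)} {G : Finset (Lit n)}
    (h : Δ ⊆ Δ') : HasLift Δ low G → HasLift Δ' low G :=
  fun ⟨S, hS, hl⟩ => ⟨S, h hS, hl⟩

end Spec
/-! ### Soundness of the translation -/

theorem isProof_concat {α : Type} {step : Set α → α → Prop} {P : List α} {x : α} :
    IsProof step (P ++ [x]) ↔ IsProof step P ∧ step {l | l ∈ P} x := by
  constructor
  · intro h
    refine ⟨fun k hk => ?_, ?_⟩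
    · have := h k (by simp; omega)
      rwa [List.take_append_of_le_length hk.le, List.getElem_append_left hk] at this
    · have := h P.length (by simp)
      simpa using this
  · rintro ⟨h, h'⟩ k hk
    by_cases hk' : k < P.length
    · rw [List.take_append_of_le_length hk'.le, List.getElem_append_left hk']
      exact h k hk'
    · have : k = P.length := by simp at hk; omega
      subst this
      simpa using h'

section Soundness
variable {n : ℕ}

/-- The line without its well-formedness conditions. -/
def Line.toRaw : Line n → RawLine n
  | .clause C => .clause C.lits
  | .trail t => .trail t.list

theorem Line.toRaw_injective : Function.Injective (Line.toRaw (n := n)) := by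
  rintro (C | t) (D | s) h
  · simp only [Line.toRaw, RawLine.clause.injEq] at h; rw [Clause.ext h]
  · simp [Line.toRaw] at h
  · simp [Line.toRaw] at h
  · simp only [Line.toRaw, RawLine.trail.injEq] at h; rw [Trail.ext h]

/-- The lines form a derivation in `π-P₀`. -/
def Good (π : Equiv.Perm (Fin n)) (τ : CNF n) (Δ : List (RawLine n)) : Prop :=
  ∃ L : List (Line n), L.map Line.toRaw = Δ ∧ IsProof (PZeroStep π τ) L

/-- `vs` lists all variables in the order `π`. -/
structure Enumerates (π : Equiv.Perm (Fin n)) (vs : List (Fin n)) : Prop where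
  nodup : vs.Nodup
  mem : ∀ v, v ∈ vs
  le : ∀ t v t', vs = t ++ v :: t' → ∀ j, j ∉ t → π v ≤ π j

theorem enumerates_map_symm (π : Equiv.Perm (Fin n)) :
    Enumerates π ((List.finRange n).map π.symm) where
  nodup := (List.nodup_finRange n).map π.symm.injective
  mem v := List.mem_map.2 ⟨π v, List.mem_finRange _, by simp⟩
  le t v t' h j hj := by
    have hlen : t.length < n := by
      have := congrArg List.length h
      simp at this; omega
    have hv : v = π.symm ⟨t.length, hlen⟩ := by
      have : ((List.finRange n).map π.symm)[t.length]? = some v := by rw [h]; simp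
      simpa [hlen, eq_comm] using this
    by_contra! hlt
    refine hj ?_
    rw [hv, Equiv.apply_symm_apply, Fin.lt_def] at hlt
    have : ((List.finRange n).map π.symm)[(π j : ℕ)]? = some j := by simp
    rw [h, List.getElem?_append_left hlt] at this
    exact List.mem_of_getElem? this

variable {π : Equiv.Perm (Fin n)} {τ : CNF n} {Δ : List (RawLine n)}

theorem Good.nil : Good π τ [] := ⟨[], rfl, fun k h => absurd h (by simp)⟩

theorem Good.concat (h : Good π τ Δ) (L : Line n)
    (hL : PZeroStep π τ {L | L.toRaw ∈ Δ} L) : Good π τ (Δ ++ [L.toRaw]) := by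
  obtain ⟨P, rfl, hP⟩ := h
  refine ⟨P ++ [L], by simp, isProof_concat.2 ⟨hP, ?_⟩⟩
  convert hL using 2
  ext L
  simp [Line.toRaw_injective.eq_iff]

theorem Good.exists_clause (h : Good π τ Δ) {S : Finset (Lit n)} (hS : RawLine.clause S ∈ Δ) :
    ∃ C : Clause n, C.lits = S := by
  obtain ⟨P, rfl, -⟩ := h
  obtain ⟨L, -, hL⟩ := List.mem_map.1 hS
  cases L with
  | clause C => exact ⟨C, by simpa [Line.toRaw] using hL⟩
  | trail t => simp [Line.toRaw] at hL

theorem Clause.consistent' (C : Clause n) : Consistent C.lits := by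
  rintro ⟨i, a⟩ h h'
  cases a
  · exact C.consistent i ⟨h', h⟩
  · exact C.consistent i ⟨h, h'⟩

/-- The clause with a given consistent set of literals. -/
def Clause.ofConsistent (S : Finset (Lit n)) (h : Consistent S) : Clause n :=
  ⟨S, fun _ hi => h _ hi.1 hi.2⟩

theorem Good.consistent (h : Good π τ Δ) {S : Finset (Lit n)} (hS : RawLine.clause S ∈ Δ) :
    Consistent S := by
  obtain ⟨C, rfl⟩ := h.exists_clause hS
  exact C.consistent'

theorem Trail.sets_unique (t : Trail n) {i : Fin n} {a b : Bool} (ha : t.Sets i a)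
    (hb : t.Sets i b) : a = b := by
  obtain ⟨x, hx, rfl, rfl⟩ := ha
  obtain ⟨y, hy, h, rfl⟩ := hb
  rw [List.inj_on_of_nodup_map t.nodup hx hy h.symm]

-- The uses are a singleton `U`, for unit propagation, and `U = ∅`, for learning.
open Classical in
theorem Clause.restrict_eq_some (C : Clause n) (t : Trail n) (U : Finset (Lit n))
    (hU : U ⊆ C.lits) (hm : ∀ l ∈ U, ¬ t.Mentions l.1)
    (hf : ∀ l ∈ C.lits, l ∉ U → t.Sets l.1 (!l.2)) : C.restrict t = some U := by
  have hs : ∀ l ∈ U, ∀ a, ¬ t.Sets l.1 a := by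
    rintro l hl a ⟨x, hx, h, -⟩
    exact hm l hl ⟨x, hx, h⟩
  rw [Clause.restrict, if_neg]
  · congr 1
    ext l
    rw [Finset.mem_filter]
    constructor
    · rintro ⟨hl, h⟩
      by_contra hlU
      exact h (hf l hl hlU)
    · exact fun hl => ⟨hU hl, hs l hl _⟩
  · rintro ⟨l, hl, h⟩
    by_cases hlU : l ∈ U
    · exact hs l hlU _ h
    · have := t.sets_unique h (hf l hl hlU)
      simp at this

/-- The assignment `x` can be added to the trail `t`. -/
def CanExtend (π : Equiv.Perm (Fin n)) (Δ : List (RawLine n)) (t : List (Assignment n))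
    (x : Assignment n) : Prop :=
  (x.ann = .d ∧ ∀ j, j ∉ t.map Assignment.var → π x.var ≤ π j) ∨
  (x.ann = .u ∧ ∃ S, RawLine.clause S ∈ Δ ∧ (x.var, x.val) ∈ S ∧
    ∀ m ∈ S, m ≠ (x.var, x.val) → ∃ a ∈ t, a.var = m.1 ∧ a.val = !m.2)

/-- All prefixes of the trail are emitted as lines, and each extension is justified by the clauses
of `Δ` alone. -/
theorem Good.trails (h : Good π τ Δ) (tr : List (Assignment n))
    (hn : (tr.map Assignment.var).Nodup)
    (htr : ∀ t x t', tr = t ++ x :: t' → CanExtend π Δ t x) :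
    Good π τ (Δ ++ tr.inits.map .trail) := by
  induction tr using List.reverseRecOn with
  | nil => exact h.concat (.trail (Trail.empty n)) .emptyTrail
  | append_singleton t x ih =>
    have hn' : (t.map Assignment.var).Nodup := by
      rw [List.map_append] at hn; exact hn.of_append_left
    have hx : ∀ a ∈ t, a.var ≠ x.var := by
      rw [List.map_append, List.nodup_append] at hn
      exact fun a ha => hn.2.2 _ (List.mem_map_of_mem ha) _ (by simp)
    have ih := ih hn' fun t₁ y t₂ ht => htr t₁ y (t₂ ++ [x]) (by rw [ht]; simp)
    have hinits : (t ++ [x]).inits = t.inits ++ [t ++ [x]] := by simp [List.inits_append]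
    rw [hinits, List.map_append, ← List.append_assoc]
    have ht : Line.trail ⟨t, hn'⟩ ∈ {L | Line.toRaw L ∈ Δ ++ t.inits.map RawLine.trail} := by
      simp [Line.toRaw]
    refine ih.concat (.trail ⟨t ++ [x], hn⟩) ?_
    rcases htr t x [] rfl with ⟨ha, hd⟩ | ⟨ha, S, hS, hxS, hu⟩
    · refine .decision ⟨t, hn'⟩ _ x.var x.val ht ?_ ?_ ?_
      · rintro ⟨a, hat, hax⟩; exact hx a hat hax
      · intro j hj
        refine hd j fun hj' => hj ?_
        obtain ⟨a, ha, rfl⟩ := List.mem_map.1 hj'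
        exact ⟨a, ha, rfl⟩
      · cases x; simp_all
    · obtain ⟨C, rfl⟩ := h.exists_clause hS
      refine .unitPropagation ⟨t, hn'⟩ _ C x.var x.val ht ?_ ?_ ?_
      · exact List.mem_append_left _ hS
      · refine C.restrict_eq_some _ _ (by simpa using hxS) ?_ ?_
        · simp only [Finset.mem_singleton]
          rintro l rfl ⟨a, hat, hax⟩
          exact hx a hat hax
        · intro l hl hne
          exact hu l hl (by simpa using hne)
      · cases x; simp_all

theorem Good.learn (h : Good π τ Δ) {tr : List (Assignment n)}
    (htr : RawLine.trail tr ∈ Δ) {A B : Finset (Lit n)} (hA : RawLine.clause A ∈ Δ)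
    (hB : RawLine.clause B ∈ Δ) {l : Lit n} (hlA : l ∈ A) (hlB : negLit l ∈ B)
    (hR : Consistent (A.erase l ∪ B.erase (negLit l)))
    (hf : ∀ m ∈ A.erase l ∪ B.erase (negLit l), ∃ a ∈ tr, a.var = m.1 ∧ a.val = !m.2)
    {t₁ t₂ : List (Assignment n)} {s : Ann} (ht : tr = t₁ ++ ⟨l.1, l.2, s⟩ :: t₂)
    (hl : ∀ m ∈ A.erase l, ∃ a ∈ t₁, a.var = m.1) :
    Good π τ (Δ ++ [.clause (A.erase l ∪ B.erase (negLit l))]) := by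
  obtain ⟨A, rfl⟩ := h.exists_clause hA
  obtain ⟨B, rfl⟩ := h.exists_clause hB
  have htr' : ∃ t : Trail n, t.list = tr := by
    obtain ⟨P, rfl, -⟩ := h
    obtain ⟨L, -, hL⟩ := List.mem_map.1 htr
    cases L with
    | clause C => simp [Line.toRaw] at hL
    | trail t => exact ⟨t, by simpa [Line.toRaw] using hL⟩
  obtain ⟨t, rfl⟩ := htr'
  refine h.concat (.clause (Clause.ofConsistent _ hR))
    (.learning A B _ t l.1 l.2 hA hB htr ⟨hlA, hlB, rfl⟩ ?_ ⟨t₁, t₂, s, ht, hl⟩)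
  exact Clause.restrict_eq_some _ _ _ (by simp) (by simp) fun m hm _ => hf m hm

/-- A prefix of the enumeration contains the `π`-smallest variables in their order, so the next
entry is always the variable that the decision rule demands. -/
theorem CanExtend.decision {vs : List (Fin n)} (hv : Enumerates π vs)
    {f : Fin n → Assignment n} (hf : ∀ v, (f v).var = v ∧ (f v).ann = .d)
    {low : List (Fin n)} (hlow : low <+: vs) {t x t'} (h : low.map f = t ++ x :: t') :
    CanExtend π Δ t x := by
  obtain ⟨t₁, t₂, rfl, rfl, h2⟩ := List.map_eq_append_iff.1 h
  obtain ⟨v, t₃, rfl, rfl, rfl⟩ := List.map_eq_cons_iff.1 h2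
  obtain ⟨rest, rfl⟩ := hlow
  refine .inl ⟨(hf v).2, fun j hj => ?_⟩
  rw [(hf v).1]
  refine hv.le t₁ v (t₃ ++ rest) (by simp) j fun hj' => hj ?_
  rw [List.map_map, List.mem_map]
  exact ⟨j, hj', (hf j).1⟩

/-- The clause `T` is `¬g` with positive literals of `low`. Deciding all variables in the order `π`
places `low` before the variable of `g`, so `T` can be the premise whose pivot literal is true in
the trail. The learning rule puts no order condition on the other premise `S`. -/
theorem Good.removalLines {vs : List (Fin n)} (hv : Enumerates π vs) (h : Good π τ Δ)
    {low : List (Fin n)} (hlow : low <+: vs) {g : Lit n} {S T : Finset (Lit n)}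
    (hS : RawLine.clause S ∈ Δ) (hT : RawLine.clause T ∈ Δ) (hg : g ∈ S) (hgl : g.1 ∉ low)
    (hpos : ∀ l ∈ S, l.1 ∈ low → l.2 = true) (hlift : IsLift low {negLit g} T) :
    Good π τ (Δ ++ removalLines vs g S T) := by
  have hSc := h.consistent hS
  have hTc := h.consistent hT
  have hTlow : ∀ l ∈ T.erase (negLit g), l.1 ∈ low ∧ l.2 = true := by
    intro l hl
    rw [Finset.mem_erase] at hl
    by_cases hll : l.1 ∈ low
    · exact ⟨hll, (hlift.2 l hll).2 hl.2⟩
    · exact absurd (by simpa using (hlift.1 l hll).1 hl.2) hl.1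
  have hgT : negLit g ∈ T := (hlift.1 (negLit g) hgl).2 (by simp)
  obtain ⟨R, hRdef⟩ : ∃ R, R = S.erase g ∪ T.erase (negLit g) := ⟨_, rfl⟩
  have hR : Consistent R := by
    intro l hl hl'
    -- After `¬g` is erased, `T` has only positive literals in `low`, where `S` is positive as well.
    -- So no clash arises between the premises.
    have key : ∀ m ∈ S.erase g, negLit m ∉ T.erase (negLit g) := by
      intro m hm hm'
      have h1 := hTlow _ hm'
      have h2 := hpos m (Finset.mem_of_mem_erase hm) h1.1
      simp [negLit, h2] at h1
    rw [hRdef, Finset.mem_union] at hl hl'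
    rcases hl with hl | hl <;> rcases hl' with hl' | hl'
    · exact hSc l (Finset.mem_of_mem_erase hl) (Finset.mem_of_mem_erase hl')
    · exact key l hl hl'
    · exact key _ hl' (by simpa using hl)
    · exact hTc l (Finset.mem_of_mem_erase hl) (Finset.mem_of_mem_erase hl')
  have hRg : ∀ l ∈ R, l.1 ≠ g.1 := by
    intro l hl hlg
    rw [hRdef, Finset.mem_union] at hl
    rcases hl with hl | hl
    · rcases eq_or_eq_negLit hlg with rfl | rfl
      · simp at hl
      · exact hSc g hg (Finset.mem_of_mem_erase hl)
    · exact hgl (hlg ▸ (hTlow l hl).1)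
  have hmap : ∀ v : Fin n, (fun v => (⟨v, if decide (v = g.1) then !g.2 else
      decide ((v, false) ∈ R), .d⟩ : Assignment n)) v = _ := fun v => rfl
  have h1 : Good π τ (Δ ++ (decisionTrail vs g R).inits.map .trail) := by
    refine h.trails _ ?_ fun t x t' ht => ?_
    · rw [decisionTrail, List.map_map]
      convert hv.nodup
      simp [Function.comp_def]
    · exact CanExtend.decision hv (fun v => ⟨rfl, rfl⟩) List.prefix_rfl ht
  have hle : Δ ⊆ Δ ++ (decisionTrail vs g R).inits.map .trail := List.subset_append_left _ _
  obtain ⟨rest, hrest⟩ := hlow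
  have hgrest : g.1 ∈ rest := by
    have := hv.mem g.1
    rw [← hrest, List.mem_append] at this
    exact this.resolve_left hgl
  obtain ⟨r₁, r₂, rfl⟩ := List.append_of_mem hgrest
  have hcomm : S.erase g ∪ T.erase (negLit g) = T.erase (negLit g) ∪ S.erase (negLit (negLit g)) := by
    rw [negLit_negLit, Finset.union_comm]
  rw [OrderedCDCL.removalLines, ← hRdef, ← List.append_assoc]
  have hRdef' := hRdef
  rw [hcomm] at hRdef
  rw [hRdef] at hR hRg ⊢
  rw [← hRdef] at hR hRg ⊢
  -- The roles are exchanged: the premise with the order condition is `T`, with pivot `negLit g`.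
  -- The trail splits at the variable of `g`, and `low` lies in its first part.
  have := h1.learn (tr := decisionTrail vs g R) (A := T) (B := S) (l := negLit g) (s := .d)
    (t₁ := (low ++ r₁).map fun v => ⟨v, if decide (v = g.1) then !g.2 else
      decide ((v, false) ∈ R), .d⟩)
    (t₂ := r₂.map fun v => ⟨v, if decide (v = g.1) then !g.2 else
      decide ((v, false) ∈ R), .d⟩)
    (List.mem_append_right _ (List.mem_map_of_mem (by simp))) (hle hT) (hle hS) hgT
    (by simpa using hg) (by rwa [← hRdef]) ?_ ?_ ?_
  · rwa [← hRdef] at this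
  · rw [← hRdef]
    intro m hm
    refine ⟨_, List.mem_map_of_mem (hv.mem m.1), rfl, ?_⟩
    dsimp only
    rw [if_neg (by simpa using hRg m hm)]
    obtain ⟨v, b⟩ := m
    cases b
    · simpa using hm
    · have := hR _ hm
      simpa [negLit] using this
  · rw [decisionTrail, ← hrest]
    simp [negLit]
  · intro m hm
    exact ⟨_, List.mem_map_of_mem (List.mem_append_left _ (hTlow m hm).1), rfl⟩

theorem forall_split_append {α : Type} {a b : List α} {p : List α → α → Prop}
    (ha : ∀ t x t', a = t ++ x :: t' → p t x) (hb : ∀ t x t', b = t ++ x :: t' → p (a ++ t) x) :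
    ∀ t x t', a ++ b = t ++ x :: t' → p t x := by
  intro t x t' h
  rw [List.append_eq_append_iff] at h
  rcases h with ⟨s, rfl, h⟩ | ⟨s, h, h'⟩
  · exact hb s x t' h
  · cases s with
    | nil =>
      rw [List.append_nil] at h
      subst h
      simpa using hb [] x t' h'.symm
    | cons y s =>
      simp only [List.cons_append, List.cons.injEq] at h'
      obtain ⟨rfl, -⟩ := h'
      exact ha t x s h

/-- Once `low` is zero, the lift of each `negLit e` is a unit clause and propagates the
falsification of `e`, in any order. Then only `l` is left in `S`, and it is propagated last. So the
order condition of the learning rule holds automatically. -/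
theorem Good.resolutionLines {vs : List (Fin n)} (hv : Enumerates π vs) (h : Good π τ Δ)
    {low : List (Fin n)} (hlow : low <+: vs) {E : Finset (Lit n)} {l : Lit n}
    {S T : Finset (Lit n)} (hE : Consistent E) (hEl : ∀ e ∈ E, e.1 ∉ low)
    (hlift : ∀ e ∈ E, HasLift Δ low {negLit e}) (hl : l.1 ∉ low) (hlE : l ∉ E)
    (hlE' : negLit l ∉ E) (hS : RawLine.clause S ∈ Δ) (hT : RawLine.clause T ∈ Δ) (hlS : l ∈ S)
    (hlT : negLit l ∈ T) (hSE : ∀ m ∈ S, m ≠ l → m ∈ E ∨ (m.1 ∈ low ∧ m.2 = true))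
    (hTE : ∀ m ∈ T, m ≠ negLit l → m ∈ E ∨ (m.1 ∈ low ∧ m.2 = true)) :
    Good π τ (Δ ++ resolutionLines low E l S T) := by
  obtain ⟨es, hes⟩ : ∃ es, es = (allLits n).filter fun e => decide (e ∈ E) := ⟨_, rfl⟩
  have hmem : ∀ e, e ∈ es ↔ e ∈ E := by simp [hes]
  have hlv : ∀ e ∈ E, e.1 ≠ l.1 := by
    intro e he hel
    rcases eq_or_eq_negLit hel with rfl | rfl
    · exact hlE he
    · exact hlE' he
  have hesn : es.Nodup := by
    rw [hes]
    refine List.Nodup.filter _ ?_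
    rw [allLits, List.nodup_flatMap]
    refine ⟨fun i _ => by simp, ?_⟩
    refine (List.nodup_finRange n).imp fun {i j} hij => ?_
    simp only [Function.onFun]
    intro x hx hx'
    simp at hx hx'
    rcases hx with rfl | rfl <;> simp_all
  have hesv : (es.map Prod.fst).Nodup := by
    refine List.Nodup.map_on (fun e he f hf hef => ?_) hesn
    rw [hmem] at he hf
    rcases eq_or_eq_negLit hef with rfl | rfl
    · rfl
    · exact absurd he (hE f hf)
  obtain ⟨tz, htz⟩ : ∃ tz : List (Assignment n), tz = low.map fun v => ⟨v, false, .d⟩ := ⟨_, rfl⟩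
  obtain ⟨te, hte⟩ : ∃ te : List (Assignment n), te = es.map fun e => ⟨e.1, !e.2, .u⟩ := ⟨_, rfl⟩
  have htr : propagationTrail low E l = tz ++ te ++ [⟨l.1, l.2, .u⟩] := by
    rw [htz, hte, hes]; rfl
  have hfal : ∀ m : Lit n, m ∈ E ∨ (m.1 ∈ low ∧ m.2 = true) →
      ∃ a ∈ tz ++ te, a.var = m.1 ∧ a.val = !m.2 := by
    rintro m (hm | ⟨hm, hm'⟩)
    · exact ⟨⟨m.1, !m.2, .u⟩, List.mem_append_right _ (by
        rw [hte]; exact List.mem_map.2 ⟨m, (hmem m).2 hm, rfl⟩), rfl, rfl⟩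
    · exact ⟨⟨m.1, false, .d⟩, List.mem_append_left _ (by
        rw [htz]; exact List.mem_map.2 ⟨m.1, hm, rfl⟩), rfl, by simp [hm']⟩
  have hR : ∀ m ∈ S.erase l ∪ T.erase (negLit l), m ∈ E ∨ (m.1 ∈ low ∧ m.2 = true) := by
    intro m hm
    rw [Finset.mem_union, Finset.mem_erase, Finset.mem_erase] at hm
    exact hm.elim (fun hm => hSE m hm.2 hm.1) fun hm => hTE m hm.2 hm.1
  have hRc : Consistent (S.erase l ∪ T.erase (negLit l)) := by
    intro m hm hm'
    rcases hR _ hm with h1 | h1 <;> rcases hR _ hm' with h2 | h2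
    · exact hE _ h1 h2
    · exact hEl _ h1 h2.1
    · exact hEl _ h2 h1.1
    · simp [negLit, h1.2] at h2
  have h1 : Good π τ (Δ ++ (propagationTrail low E l).inits.map .trail) := by
    refine h.trails _ ?_ fun t x t' ht => ?_
    · have e1 : tz.map Assignment.var = low := by rw [htz, List.map_map]; simp [Function.comp_def]
      have e2 : te.map Assignment.var = es.map Prod.fst := by
        rw [hte, List.map_map]; rfl
      rw [htr, List.map_append, List.map_append, e1, e2, List.nodup_append, List.nodup_append]
      refine ⟨⟨hv.nodup.sublist hlow.sublist, hesv, ?_⟩, by simp, ?_⟩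
      · rintro v hv' w hw rfl
        obtain ⟨e, he, rfl⟩ := List.mem_map.1 hw
        exact hEl e ((hmem e).1 he) hv'
      · rintro v hv' w hw rfl
        simp only [List.map_cons, List.map_nil, List.mem_singleton] at hw
        subst hw
        rcases List.mem_append.1 hv' with hv' | hv'
        · exact hl hv'
        · obtain ⟨e, he, hel⟩ := List.mem_map.1 hv'
          exact hlv e ((hmem e).1 he) hel
    · rw [htr] at ht
      refine forall_split_append (forall_split_append ?_ ?_) ?_ t x t' ht
      · intro t x t' ht
        rw [htz] at ht
        exact CanExtend.decision hv (fun v => ⟨rfl, rfl⟩) hlow ht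
      · intro t x t' ht
        have hx : x ∈ te := by rw [ht]; simp
        rw [hte] at hx
        obtain ⟨e, he, rfl⟩ := List.mem_map.1 hx
        have he := (hmem e).1 he
        obtain ⟨U, hU, hUl⟩ := hlift e he
        refine .inr ⟨rfl, U, hU, (hUl.1 (negLit e) (hEl e he)).2 (by simp), fun m hm hml => ?_⟩
        have : m.1 ∈ low := by
          by_contra hml'
          exact hml (by simpa [negLit] using (hUl.1 m hml').1 hm)
        refine ⟨⟨m.1, false, .d⟩, List.mem_append_left _ ?_, rfl, by simp [(hUl.2 m this).2 hm]⟩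
        rw [htz]
        exact List.mem_map.2 ⟨m.1, this, rfl⟩
      · intro t x t' ht
        rw [List.singleton_eq_append_iff] at ht
        rcases ht with ⟨rfl, ht⟩ | ⟨rfl, ht⟩
        · simp only [List.cons.injEq] at ht
          obtain ⟨rfl, -⟩ := ht
          refine .inr ⟨rfl, S, hS, hlS, fun m hm hml => ?_⟩
          simpa using hfal m (hSE m hm hml)
        · simp at ht
  rw [OrderedCDCL.resolutionLines, ← List.append_assoc]
  have hle : Δ ⊆ Δ ++ (propagationTrail low E l).inits.map .trail := List.subset_append_left _ _
  refine h1.learn (tr := propagationTrail low E l) (t₁ := tz ++ te) (t₂ := []) (s := .u)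
    (List.mem_append_right _ (List.mem_map_of_mem (by simp))) (hle hS) (hle hT) hlS hlT hRc
    (fun m hm => ?_) htr (fun m hm => ?_)
  · obtain ⟨a, ha, h⟩ := hfal m (hR m hm)
    exact ⟨a, by rw [htr]; exact List.mem_append_left _ ha, h⟩
  · obtain ⟨a, ha, h, -⟩ := hfal m (hR m (Finset.mem_union_left _ hm))
    exact ⟨a, ha, h⟩

end Soundness

/-! ### The stages of the algorithm produce valid derivations -/

section Stages
variable {n : ℕ} {π : Equiv.Perm (Fin n)} {τ : CNF n} {Δ Δ' : List (RawLine n)}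
  {vs : List (Fin n)}

/-- Lifts are looked up in the fixed list `Δ`, while new lines are appended to the growing list
`Δ'`. -/
theorem Good.remove (hv : Enumerates π vs) (h : Good π τ Δ') (hsub : Δ ⊆ Δ')
    {S : Finset (Lit n)} (hS : RawLine.clause S ∈ Δ') {op : List (Fin n) × Lit n}
    (hop : op.1 <+: vs) :
    Good π τ (Δ' ++ (remove vs Δ S op).1) ∧
      RawLine.clause (remove vs Δ S op).2 ∈ Δ' ++ (remove vs Δ S op).1 := by
  unfold OrderedCDCL.remove
  split
  · next hc =>
    simp only [Bool.and_eq_true, decide_eq_true_eq, posOn_iff] at hc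
    cases hT : findLift op.1 {negLit op.2} Δ with
    | none => simpa using ⟨h, hS⟩
    | some T =>
      obtain ⟨h1, h2⟩ := findLift_eq_some hT
      exact ⟨h.removalLines hv hop hS (hsub h1) hc.1 (by simpa using hc.2.2) hc.2.1 h2,
        by simp [OrderedCDCL.removalLines]⟩
  · simpa using ⟨h, hS⟩

theorem Good.removeAll (hv : Enumerates π vs) (h : Good π τ Δ') (hsub : Δ ⊆ Δ')
    {S : Finset (Lit n)} (hS : RawLine.clause S ∈ Δ') {ops : List (List (Fin n) × Lit n)}
    (hops : ∀ op ∈ ops, op.1 <+: vs) :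
    Good π τ (Δ' ++ (removeAll vs Δ ops S).1) ∧
      RawLine.clause (removeAll vs Δ ops S).2 ∈ Δ' ++ (removeAll vs Δ ops S).1 := by
  induction ops using List.reverseRecOn with
  | nil => simpa [OrderedCDCL.removeAll] using ⟨h, hS⟩
  | append_singleton ops op ih =>
    obtain ⟨h1, h2⟩ := ih fun o ho => hops o (List.mem_append_left _ ho)
    have := h1.remove hv (List.Subset.trans hsub (List.subset_append_left _ _)) h2 (hops op (by simp))
    simpa [OrderedCDCL.removeAll] using this

theorem removals_prefix {low low' : List (Fin n)} {y : Fin n} {X : Finset (Lit n)}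
    (h : low <+: vs) (h' : low' <+: vs) : ∀ op ∈ removals low low' y X, op.1 <+: vs := by
  intro op hop
  rw [removals, List.mem_cons] at hop
  rcases hop with rfl | hop
  · exact h
  · obtain ⟨l, -, rfl⟩ := List.mem_map.1 hop
    exact h'

theorem Good.removalStage (hv : Enumerates π vs) {low low' : List (Fin n)} (hl : low <+: vs)
    (hl' : low' <+: vs) (y : Fin n) (P : List (Finset (Lit n))) (hsub : Δ ⊆ Δ')
    (h : Good π τ Δ') : Good π τ (Δ' ++ removalStage vs low low' y P Δ) := by
  induction P generalizing Δ' with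
  | nil => simpa [OrderedCDCL.removalStage] using h
  | cons G P ih =>
    simp only [OrderedCDCL.removalStage, List.flatMap_cons, ← List.append_assoc] at ih ⊢
    refine ih (List.Subset.trans hsub (List.subset_append_left _ _)) ?_
    cases hS : findLift low G Δ with
    | none => simpa using h
    | some S =>
      exact (h.removeAll hv hsub (hsub (findLift_eq_some hS).1) (removals_prefix hl hl')).1

theorem findResLifts_eq_some {low : List (Fin n)} {X : Finset (Lit n)}
    {F : List (Finset (Lit n))} {E : Finset (Lit n)}
    {r : Lit n × Finset (Lit n) × Finset (Lit n)} (h : findResLifts low X F Δ E = some r) :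
    ∃ A ∈ F, ∃ B ∈ F, isRes r.1 A B E = true ∧ A ⊆ X ∧ B ⊆ X ∧ r.1 ∉ E ∧ negLit r.1 ∉ E ∧
      findLift low A Δ = some r.2.1 ∧ findLift low B Δ = some r.2.2 := by
  obtain ⟨A, hA, h⟩ := List.exists_of_findSome?_eq_some h
  obtain ⟨B, hB, h⟩ := List.exists_of_findSome?_eq_some h
  obtain ⟨l, -, h⟩ := List.exists_of_findSome?_eq_some h
  split at h
  · next hc =>
    simp only [Bool.and_eq_true, decide_eq_true_eq, Bool.not_eq_true', decide_eq_false_iff_not] at hc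
    cases hS : findLift low A Δ with
    | none => simp [hS] at h
    | some S =>
      cases hT : findLift low B Δ with
      | none => simp [hS, hT] at h
      | some T =>
        simp only [hS, hT, Option.elim_some, Option.some.injEq] at h
        subst h
        exact ⟨A, hA, B, hB, hc.1, hc.2.1, hc.2.2.1, hc.2.2.2.1, hc.2.2.2.2, hS, hT⟩
  · simp at h

/-- The premises are lifts at `low`, but the trail zeroes all of `low'`: the literals of the clauses
involved are decided only at `low'`. -/
theorem Good.resolveLifts (hv : Enumerates π vs) {low low' : List (Fin n)} (hll : low ⊆ low')
    (hl' : low' <+: vs) (hsub : Δ ⊆ Δ') (h : Good π τ Δ') (F : List (Finset (Lit n)))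
    (E : Finset (Lit n)) :
    Good π τ (Δ' ++ resolveLifts low low' (decided low' Δ) F Δ' E) := by
  unfold OrderedCDCL.resolveLifts
  split
  · next hc =>
    simp only [Bool.and_eq_true, decide_eq_true_eq, isConsistent_iff] at hc
    cases hr : findResLifts low (decided low' Δ) F Δ' E with
    | none => simpa using h
    | some r =>
      obtain ⟨A, hA, B, hB, hres, hAX, hBX, hlE, hlE', hS, hT⟩ := findResLifts_eq_some hr
      obtain ⟨l, S, T⟩ := r
      obtain ⟨hlA, hlB, rfl⟩ := isRes_iff.1 hres
      obtain ⟨hS, hSl⟩ := findLift_eq_some hS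
      obtain ⟨hT, hTl⟩ := findLift_eq_some hT
      have hX : ∀ e ∈ decided low' Δ, e.1 ∉ low := fun e he hel =>
        (mem_decided.1 he).1 (hll hel)
      refine h.resolutionLines hv hl' hc.2 (fun e he => (mem_decided.1 (hc.1 he)).1)
        (fun e he => ((mem_decided.1 (hc.1 he)).2.2).mono hsub) (mem_decided.1 (hAX hlA)).1
        hlE hlE' hS hT ((hSl.1 l (hX l (hAX hlA))).2 hlA)
        ((hTl.1 _ (hX _ (hBX hlB))).2 hlB) ?_ ?_
      · intro m hm hml
        by_cases hlow : m.1 ∈ low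
        · exact .inr ⟨hll hlow, (hSl.2 m hlow).2 hm⟩
        · exact .inl (Finset.mem_union_left _ (Finset.mem_erase.2 ⟨hml, (hSl.1 m hlow).1 hm⟩))
      · intro m hm hml
        by_cases hlow : m.1 ∈ low
        · exact .inr ⟨hll hlow, (hTl.2 m hlow).2 hm⟩
        · exact .inl (Finset.mem_union_right _ (Finset.mem_erase.2 ⟨hml, (hTl.1 m hlow).1 hm⟩))
  · simpa using h

theorem resolutionStage_concat (low low' : List (Fin n)) (X : Finset (Lit n))
    (F P : List (Finset (Lit n))) (E : Finset (Lit n)) (Δ : List (RawLine n)) :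
    resolutionStage low low' X F (P ++ [E]) Δ = resolutionStage low low' X F P Δ ++
      resolveLifts low low' X F (resolutionStage low low' X F P Δ) E := by
  simp [resolutionStage]

theorem subset_resolutionStage (low low' : List (Fin n)) (X : Finset (Lit n))
    (F P : List (Finset (Lit n))) (Δ : List (RawLine n)) :
    Δ ⊆ resolutionStage low low' X F P Δ := by
  induction P using List.reverseRecOn with
  | nil => simp [resolutionStage]
  | append_singleton P E ih =>
    rw [resolutionStage_concat]
    exact List.Subset.trans ih (List.subset_append_left _ _)

theorem Good.resolutionStage (hv : Enumerates π vs) {low low' : List (Fin n)} (hll : low ⊆ low')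
    (hl' : low' <+: vs) (hsub : Δ ⊆ Δ') (h : Good π τ Δ') (F P : List (Finset (Lit n))) :
    Good π τ (resolutionStage low low' (decided low' Δ) F P Δ') := by
  induction P using List.reverseRecOn with
  | nil => exact h
  | append_singleton P E ih =>
    rw [resolutionStage_concat]
    exact ih.resolveLifts hv hll hl' (List.Subset.trans hsub (subset_resolutionStage _ _ _ _ _ _)) F E

theorem Good.level (hv : Enumerates π vs) {low : List (Fin n)} {y : Fin n}
    (hl' : low ++ [y] <+: vs) (P : List (Finset (Lit n))) (h : Good π τ Δ) :
    Good π τ (level vs low y (P, Δ)).2 :=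
  (h.removalStage hv ((List.prefix_append _ _).trans hl') hl' y P (List.Subset.refl Δ)).resolutionStage
    hv (List.subset_append_left _ _) hl' (List.subset_append_left _ _) _ _

theorem subset_level (low : List (Fin n)) (y : Fin n) (s : List (Finset (Lit n)) × List (RawLine n)) :
    s.2 ⊆ (level vs low y s).2 :=
  List.Subset.trans (List.subset_append_left _ _) (subset_resolutionStage _ _ _ _ _ _)

/-- The levels: all proper prefixes of `vs`, each with the variable that follows it. -/
def IsLevels (vs : List (Fin n)) (levels : List (List (Fin n) × Fin n)) : Prop :=
  ∀ k ∈ levels, k.1 ++ [k.2] <+: vs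

theorem foldl_level_spec (hv : Enumerates π vs) {levels : List (List (Fin n) × Fin n)}
    (hk : IsLevels vs levels) (h : Good π τ Δ) (P : List (Finset (Lit n))) :
    Good π τ (levels.foldl (fun s k => level vs k.1 k.2 s) (P, Δ)).2 ∧
      Δ ⊆ (levels.foldl (fun s k => level vs k.1 k.2 s) (P, Δ)).2 := by
  induction levels using List.reverseRecOn with
  | nil => exact ⟨h, List.Subset.refl _⟩
  | append_singleton ks k ih =>
    obtain ⟨h1, h2⟩ := ih fun k hk' => hk k (List.mem_append_left _ hk')
    rw [List.foldl_concat]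
    exact ⟨h1.level hv (hk k (by simp)) _, List.Subset.trans h2 (subset_level _ _ _)⟩

theorem Good.pass (hv : Enumerates π vs) {levels : List (List (Fin n) × Fin n)}
    (hk : IsLevels vs levels) (h : Good π τ Δ) (P : List (Finset (Lit n))) :
    Good π τ (pass vs levels P Δ) := (foldl_level_spec hv hk h P).1

theorem Good.foldl_pass (hv : Enumerates π vs) {levels : List (List (Fin n) × Fin n)}
    (hk : IsLevels vs levels) (h : Good π τ Δ) (P : List (Finset (Lit n))) {α : Type} (l : List α) :
    Good π τ (l.foldl (fun Δ _ => OrderedCDCL.pass vs levels P Δ) Δ) := by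
  induction l generalizing Δ with
  | nil => exact h
  | cons a l ih => exact ih (h.pass hv hk P)

theorem hypotheses_fold (P : List (Finset (Lit n))) :
    (P.foldl (fun (s : List (Finset (Lit n) × Option (Finset (Lit n))) × List (RawLine n)) E =>
      (s.1 ++ [(E, none)], if (findRes s.1 E).isSome then s.2 else s.2 ++ [.clause E]))
      ([], [])) = (P.map fun E => (E, none), hypotheses P) := by
  refine Prod.ext ?_ rfl
  induction P using List.reverseRecOn with
  | nil => rfl
  | append_singleton P E ih => simp [ih]

theorem hypotheses_concat (P : List (Finset (Lit n))) (E : Finset (Lit n)) :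
    hypotheses (P ++ [E]) = if (findRes (P.map fun E => (E, none)) E).isSome then hypotheses P
      else hypotheses P ++ [.clause E] := by
  rw [hypotheses, List.foldl_concat, hypotheses_fold]

theorem Good.hypotheses {P : List (Finset (Lit n))}
    (h : ∀ E, RawLine.clause E ∈ hypotheses P → ∃ C ∈ τ, C.lits = E) :
    Good π τ (hypotheses P) := by
  induction P using List.reverseRecOn with
  | nil => exact .nil
  | append_singleton P E ih =>
    rw [hypotheses_concat] at h ⊢
    by_cases hc : (findRes (P.map fun E => (E, none)) E).isSome = true
    · rw [if_pos hc] at h ⊢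
      exact ih h
    · rw [if_neg hc] at h ⊢
      obtain ⟨C, hC, rfl⟩ := h E (by simp)
      exact (ih fun E hE => h E (List.mem_append_left _ hE)).concat (.clause C) (.hyp C hC)

theorem Good.finish (hv : Enumerates π vs) (h : Good π τ Δ) : Good π τ (Δ ++ finish Δ) := by
  have : ∀ (ls : List (Lit n)) Δ', Δ ⊆ Δ' → Good π τ Δ' → Good π τ (Δ' ++ ls.flatMap fun l =>
      (findLift [] {l} Δ).elim [] fun S =>
        (findLift [] {negLit l} Δ).elim [] fun T => OrderedCDCL.resolutionLines [] ∅ l S T) := by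
    intro ls
    induction ls with
    | nil => intro Δ' _ h; simpa using h
    | cons l ls ih =>
      intro Δ' hsub h
      rw [List.flatMap_cons, ← List.append_assoc]
      refine ih _ (List.Subset.trans hsub (List.subset_append_left _ _)) ?_
      cases hS : findLift [] {l} Δ with
      | none => simpa using h
      | some S =>
        cases hT : findLift [] {negLit l} Δ with
        | none => simpa using h
        | some T =>
          obtain ⟨hS, hSl⟩ := findLift_eq_some hS
          obtain ⟨hT, hTl⟩ := findLift_eq_some hT
          simp only [IsLift, List.not_mem_nil, not_false_eq_true, true_imp_iff,
            Finset.mem_singleton, false_imp_iff, implies_true, and_true] at hSl hTl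
          refine h.resolutionLines hv List.nil_prefix (by simp [Consistent]) (by simp) (by simp)
            (by simp) (by simp) (by simp) (hsub hS) (hsub hT) ((hSl l).2 rfl) ((hTl _).2 rfl) ?_ ?_
          · exact fun m hm hml => absurd ((hSl m).1 hm) hml
          · exact fun m hm hml => absurd ((hTl m).1 hm) hml
  exact this _ Δ (List.Subset.refl _) h

theorem Good.translate (hv : Enumerates π vs) {levels : List (List (Fin n) × Fin n)}
    (hk : IsLevels vs levels) {P : List (Finset (Lit n))}
    (h : ∀ E, RawLine.clause E ∈ OrderedCDCL.hypotheses P → ∃ C ∈ τ, C.lits = E) :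
    Good π τ (translate vs levels P) :=
  ((Good.hypotheses h).foldl_pass hv hk P _).finish hv

theorem zero_mem_finish {l : Lit n} (h : HasLift Δ [] {l}) (h' : HasLift Δ [] {negLit l}) :
    RawLine.clause ∅ ∈ finish Δ := by
  refine List.mem_flatMap.2 ⟨l, mem_allLits l, ?_⟩
  obtain ⟨S, hS⟩ := Option.isSome_iff_exists.1 (isSome_findLift.2 h)
  obtain ⟨T, hT⟩ := Option.isSome_iff_exists.1 (isSome_findLift.2 h')
  have hSl := (findLift_eq_some hS).2
  have hTl := (findLift_eq_some hT).2
  have e1 : S = {l} := by ext m; simpa using hSl.1 m (by simp)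
  have e2 : T = {negLit l} := by ext m; simpa using hTl.1 m (by simp)
  simp [hS, hT, OrderedCDCL.resolutionLines, e1, e2]

end Stages
/-! ### Completeness of the translation -/

section Reduction
variable {n : ℕ}

/-- A resolution derivation from clauses that satisfy `ax`. -/
inductive Deriv (ax : Finset (Lit n) → Prop) : List (Finset (Lit n)) → Prop
  | nil : Deriv ax []
  | concat {P : List (Finset (Lit n))} {E : Finset (Lit n)} : Deriv ax P →
      (ax E ∨ ∃ l, ∃ A ∈ P, ∃ B ∈ P, isRes l A B E = true) → Deriv ax (P ++ [E])

variable {ax ax' : Finset (Lit n) → Prop} {P : List (Finset (Lit n))}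
  {E : Finset (Lit n)} {del forb : Finset (Lit n)}

theorem deriv_concat_iff : Deriv ax (P ++ [E]) ↔
    Deriv ax P ∧ (ax E ∨ ∃ l, ∃ A ∈ P, ∃ B ∈ P, isRes l A B E = true) := by
  constructor
  · intro h
    generalize hQ : P ++ [E] = Q at h
    cases h with
    | nil => simp at hQ
    | concat h h' =>
      obtain ⟨rfl, h2⟩ := List.append_inj' hQ rfl
      simp only [List.cons.injEq, and_true] at h2
      subst h2
      exact ⟨h, h'⟩
  · exact fun h => h.1.concat h.2

theorem Deriv.of_mem (h : Deriv ax P) (hE : E ∈ P) :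
    ax E ∨ ∃ l, ∃ A ∈ P, ∃ B ∈ P, isRes l A B E = true := by
  induction h with
  | nil => simp at hE
  | concat h h' ih =>
    have key : ∀ {E : Finset (Lit n)} {Q R : List (Finset (Lit n))},
        (ax E ∨ ∃ l, ∃ A ∈ Q, ∃ B ∈ Q, isRes l A B E = true) →
        (ax E ∨ ∃ l, ∃ A ∈ Q ++ R, ∃ B ∈ Q ++ R, isRes l A B E = true) := by
      rintro E Q R (h | ⟨l, A, hA, B, hB, h⟩)
      · exact .inl h
      · exact .inr ⟨l, A, List.mem_append_left _ hA, B, List.mem_append_left _ hB, h⟩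
    rcases List.mem_append.1 hE with hE | hE
    · exact key (ih hE)
    · rw [List.mem_singleton] at hE
      subst hE
      exact key h'

theorem Deriv.mono (h : Deriv ax P) (hax : ∀ G ∈ P, ax G → ax' G) : Deriv ax' P := by
  induction h with
  | nil => exact .nil
  | concat h h' ih =>
    exact (ih fun G hG => hax G (List.mem_append_left _ hG)).concat (h'.imp_left (hax _ (by simp)))

/-- A premise of a resolution step contains its pivot literal, so empty clauses are never used as
premises. -/
theorem Deriv.filter_ne_empty (h : Deriv ax P) :
    Deriv (fun G => ax G ∧ G ≠ ∅) (P.filter fun G => !decide (G = ∅)) := by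
  induction h with
  | nil => exact .nil
  | @concat P E h h' ih =>
    rw [List.filter_append]
    by_cases hE : E = ∅
    · simpa [hE] using ih
    · rw [List.filter_singleton, decide_eq_false hE, Bool.not_false, cond_true]
      refine ih.concat (h'.imp (fun h => ⟨h, hE⟩) ?_)
      rintro ⟨l, A, hA, B, hB, h⟩
      obtain ⟨hlA, hlB, -⟩ := isRes_iff.1 h
      refine ⟨l, A, List.mem_filter.2 ⟨hA, ?_⟩, B, List.mem_filter.2 ⟨hB, ?_⟩, h⟩
      · simpa using Finset.ne_empty_of_mem hlA
      · simpa using Finset.ne_empty_of_mem hlB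

theorem pick_eq_some {cs : List (Finset (Lit n))} {c : Finset (Lit n)} (h : pick cs = some c) :
    c ∈ cs ∧ ((∃ x ∈ cs, x ≠ ∅) → c ≠ ∅) := by
  unfold pick at h
  cases hf : cs.find? fun x => !decide (x = ∅) with
  | none =>
    rw [hf] at h
    refine ⟨List.mem_of_find?_eq_some h, ?_⟩
    rintro ⟨x, hx, hne⟩
    simpa [hne] using List.find?_eq_none.1 hf x hx
  | some d =>
    rw [hf, Option.elim_some, Option.some.injEq] at h
    subst h
    exact ⟨List.mem_of_find?_eq_some hf, fun _ => by simpa using List.find?_some hf⟩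

theorem isSome_pick {cs : List (Finset (Lit n))} {c : Finset (Lit n)} (h : c ∈ cs) :
    (pick cs).isSome = true := by
  unfold pick
  cases cs.find? fun x => !decide (x = ∅) with
  | none => exact List.find?_isSome.2 ⟨c, h, rfl⟩
  | some d => rfl

theorem mem_candidates {l : Lit n} {a b : Option (Finset (Lit n))} {c : Finset (Lit n)} :
    c ∈ candidates l a b ↔ (a = some c ∧ l ∉ c) ∨ (b = some c ∧ negLit l ∉ c) := by
  simp [candidates]

theorem combine_eq_some {l : Lit n} {a b : Option (Finset (Lit n))} {c : Finset (Lit n)}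
    (h : combine l a b = some c) :
    (∃ x y, a = some x ∧ b = some y ∧ l ∈ x ∧ negLit l ∈ y ∧
      c = x.erase l ∪ y.erase (negLit l)) ∨ (a = some c ∧ l ∉ c) ∨ (b = some c ∧ negLit l ∉ c) := by
  unfold combine at h
  split at h
  · next hc =>
    rcases a with _ | x <;> rcases b with _ | y <;> simp at h hc
    exact .inl ⟨x, y, rfl, rfl, hc.1, hc.2, h.symm⟩
  · exact .inr (mem_candidates.1 (pick_eq_some h).1)

theorem isSome_combine {l : Lit n} {a b : Option (Finset (Lit n))}
    (h : (∃ x, a = some x ∧ l ∉ x) ∨ (∃ y, b = some y ∧ negLit l ∉ y) ∨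
      (a.isSome = true ∧ b.isSome = true)) : (combine l a b).isSome = true := by
  unfold combine
  split
  · next hc => rcases a with _ | x <;> rcases b with _ | y <;> simp at hc ⊢
  · next hc =>
    suffices hs : ∃ c, c ∈ candidates l a b from isSome_pick hs.choose_spec
    simp only [mem_candidates]
    rcases h with ⟨x, h⟩ | ⟨y, h⟩ | ⟨ha, hb⟩
    · exact ⟨x, .inl h⟩
    · exact ⟨y, .inr h⟩
    · obtain ⟨x, rfl⟩ := Option.isSome_iff_exists.1 ha
      obtain ⟨y, rfl⟩ := Option.isSome_iff_exists.1 hb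
      by_cases hx : l ∈ x
      · exact ⟨y, .inr ⟨rfl, fun hy => hc (by simp [hx, hy])⟩⟩
      · exact ⟨x, .inl ⟨rfl, hx⟩⟩

/-- This is the purpose of the preference of `pick` for nonempty clauses: one nonempty reduced
premise without its pivot literal suffices to make the reduced resolvent nonempty. -/
theorem combine_ne_empty {l : Lit n} {a b : Option (Finset (Lit n))} {c : Finset (Lit n)}
    (hc : combine l a b = some c) (h : (∃ x, a = some x ∧ l ∉ x ∧ x ≠ ∅) ∨
      (∃ y, b = some y ∧ negLit l ∉ y ∧ y ≠ ∅)) : c ≠ ∅ := by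
  unfold combine at hc
  rw [if_neg] at hc
  · refine (pick_eq_some hc).2 ?_
    simp only [mem_candidates]
    rcases h with ⟨x, h1, h2, h3⟩ | ⟨y, h1, h2, h3⟩
    · exact ⟨x, .inl ⟨h1, h2⟩, h3⟩
    · exact ⟨y, .inr ⟨h1, h2⟩, h3⟩
  · rcases h with ⟨x, rfl, h2, h3⟩ | ⟨y, rfl, h2, h3⟩ <;> simp [h2]

theorem findRes_eq_some {M : List (Finset (Lit n) × Option (Finset (Lit n)))}
    {r : Lit n × Option (Finset (Lit n)) × Option (Finset (Lit n))} (h : findRes M E = some r) :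
    ∃ A B, (A, r.2.1) ∈ M ∧ (B, r.2.2) ∈ M ∧ isRes r.1 A B E = true := by
  obtain ⟨⟨A, a⟩, hA, h⟩ := List.exists_of_findSome?_eq_some h
  obtain ⟨⟨B, b⟩, hB, h⟩ := List.exists_of_findSome?_eq_some h
  obtain ⟨l, -, h⟩ := List.exists_of_findSome?_eq_some h
  split at h
  · next hc =>
    simp only [Option.some.injEq] at h
    subst h
    exact ⟨A, B, hA, hB, hc⟩
  · simp at h

theorem findRes_eq_none {M : List (Finset (Lit n) × Option (Finset (Lit n)))} :
    findRes M E = none ↔ ∀ x ∈ M, ∀ y ∈ M, ∀ l, ¬ isRes l x.1 y.1 E = true := by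
  simp only [findRes, List.findSome?_eq_none_iff, mem_allLits, true_imp_iff, ite_eq_right_iff,
    reduceCtorEq]

theorem reduceTable_concat : reduceTable del forb (P ++ [E]) =
    reduceTable del forb P ++ [(E, reduceClause del forb (reduceTable del forb P) E)] := by
  simp [reduceTable]

theorem reduce_concat : reduce del forb (P ++ [E]) =
    reduce del forb P ++ (reduceClause del forb (reduceTable del forb P) E).toList := by
  rw [reduce, reduceTable_concat, List.filterMap_append, ← reduce]
  cases h : reduceClause del forb (reduceTable del forb P) E <;> simp

theorem map_fst_reduceTable : (reduceTable del forb P).map Prod.fst = P := by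
  induction P using List.reverseRecOn with
  | nil => rfl
  | append_singleton P E ih => rw [reduceTable_concat, List.map_append, ih]; rfl

theorem mem_reduceTable_of_mem (h : E ∈ P) : ∃ o, (E, o) ∈ reduceTable del forb P := by
  rw [← map_fst_reduceTable (del := del) (forb := forb) (P := P)] at h
  obtain ⟨⟨E', o⟩, h', rfl⟩ := List.mem_map.1 h
  exact ⟨o, h'⟩

theorem mem_of_mem_reduceTable {o} (h : (E, o) ∈ reduceTable del forb P) : E ∈ P := by
  rw [← map_fst_reduceTable (del := del) (forb := forb) (P := P)]
  exact List.mem_map.2 ⟨_, h, rfl⟩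

theorem mem_reduce {c : Finset (Lit n)} :
    c ∈ reduce del forb P ↔ ∃ E, (E, some c) ∈ reduceTable del forb P := by
  simp [reduce]

theorem reduceClause_cases (del forb : Finset (Lit n))
    (M : List (Finset (Lit n) × Option (Finset (Lit n)))) (E : Finset (Lit n)) :
    (∃ l A B a b, (A, a) ∈ M ∧ (B, b) ∈ M ∧ isRes l A B E = true ∧
      reduceClause del forb M E = combine l a b) ∨
    ((∀ x ∈ M, ∀ y ∈ M, ∀ l, ¬ isRes l x.1 y.1 E = true) ∧
      reduceClause del forb M E = if E ∩ forb = ∅ then some (E \ del) else none) := by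
  cases h : findRes M E with
  | none => exact .inr ⟨findRes_eq_none.1 h, by simp [reduceClause, h]⟩
  | some r =>
    obtain ⟨A, B, hA, hB, hr⟩ := findRes_eq_some h
    exact .inl ⟨r.1, A, B, r.2.1, r.2.2, hA, hB, hr, by simp [reduceClause, h]⟩

/-- By induction along the derivation. When a single premise replaces the resolvent, the absence of
the pivot literal is what puts it inside the resolvent. -/
theorem reduceTable_subset {c : Finset (Lit n)} (h : (E, some c) ∈ reduceTable del forb P) :
    c ⊆ E \ del ∧ c ∩ forb = ∅ := by
  induction P using List.reverseRecOn generalizing E c with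
  | nil => simp [reduceTable] at h
  | append_singleton P F ih =>
    rw [reduceTable_concat, List.mem_append, List.mem_singleton, Prod.mk.injEq] at h
    rcases h with h | ⟨rfl, h⟩
    · exact ih h
    · rcases reduceClause_cases del forb (reduceTable del forb P) E with
        ⟨l, A, B, a, b, hA, hB, hr, hc⟩ | ⟨-, hc⟩
      · obtain ⟨-, -, rfl⟩ := isRes_iff.1 hr
        rw [hc] at h
        rcases combine_eq_some h.symm with ⟨x, y, rfl, rfl, hx, hy, rfl⟩ | ⟨rfl, hl⟩ | ⟨rfl, hl⟩
        · have h1 := ih hA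
          have h2 := ih hB
          constructor
          · intro m hm
            have := @h1.1 m
            have := @h2.1 m
            simp only [Finset.mem_union, Finset.mem_erase, Finset.mem_sdiff] at *
            tauto
          · rw [Finset.eq_empty_iff_forall_notMem] at *
            intro m hm
            have := h1.2 m
            have := h2.2 m
            simp only [Finset.mem_union, Finset.mem_erase, Finset.mem_inter] at *
            tauto
        · refine ⟨fun m hm => ?_, (ih hA).2⟩
          have := (ih hA).1 hm
          have : m ≠ l := fun h => hl (h ▸ hm)
          simp only [Finset.mem_union, Finset.mem_erase, Finset.mem_sdiff] at *
          tauto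
        · refine ⟨fun m hm => ?_, (ih hB).2⟩
          have := (ih hB).1 hm
          have : m ≠ negLit l := fun h => hl (h ▸ hm)
          simp only [Finset.mem_union, Finset.mem_erase, Finset.mem_sdiff] at *
          tauto
      · rw [hc] at h
        split at h
        · next hf =>
          simp only [Option.some.injEq] at h
          subst h
          refine ⟨Finset.Subset.refl _, ?_⟩
          rw [Finset.eq_empty_iff_forall_notMem] at *
          intro m hm
          exact hf m (by simp only [Finset.mem_inter, Finset.mem_sdiff] at *; tauto)
        · simp at h

/-- Only clauses that meet `forb` can be lost. If a pivot literal is forbidden, its negation is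
deleted everywhere, so the reduction of the other premise lacks its pivot literal and remains as a
candidate. -/
theorem isSome_of_mem_reduceTable (hf : ∀ f ∈ forb, negLit f ∈ del ∧ negLit f ∉ forb) {o}
    (h : (E, o) ∈ reduceTable del forb P) (hE : E ∩ forb = ∅) : o.isSome = true := by
  induction P using List.reverseRecOn generalizing E o with
  | nil => simp [reduceTable] at h
  | append_singleton P F ih =>
    rw [reduceTable_concat, List.mem_append, List.mem_singleton, Prod.mk.injEq] at h
    rcases h with h | ⟨rfl, rfl⟩
    · exact ih h hE
    · rcases reduceClause_cases del forb (reduceTable del forb P) E with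
        ⟨l, A, B, a, b, hA, hB, hr, hc⟩ | ⟨-, hc⟩
      · obtain ⟨hlA, hlB, rfl⟩ := isRes_iff.1 hr
        rw [hc]
        have hA' : l ∉ forb → A ∩ forb = ∅ := by
          intro hl
          rw [Finset.eq_empty_iff_forall_notMem] at *
          intro m hm
          have := hE m
          have : m ≠ l := by rintro rfl; exact hl (Finset.mem_inter.1 hm).2
          simp only [Finset.mem_union, Finset.mem_erase, Finset.mem_inter] at *
          tauto
        have hB' : negLit l ∉ forb → B ∩ forb = ∅ := by
          intro hl
          rw [Finset.eq_empty_iff_forall_notMem] at *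
          intro m hm
          have := hE m
          have : m ≠ negLit l := by rintro rfl; exact hl (Finset.mem_inter.1 hm).2
          simp only [Finset.mem_union, Finset.mem_erase, Finset.mem_inter] at *
          tauto
        refine isSome_combine ?_
        by_cases h1 : l ∈ forb
        · obtain ⟨y, rfl⟩ := Option.isSome_iff_exists.1 (ih hB (hB' (hf l h1).2))
          refine .inr (.inl ⟨y, rfl, fun hy => ?_⟩)
          exact (Finset.mem_sdiff.1 ((reduceTable_subset hB).1 hy)).2 (hf l h1).1
        · by_cases h2 : negLit l ∈ forb
          · obtain ⟨x, rfl⟩ := Option.isSome_iff_exists.1 (ih hA (hA' h1))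
            refine .inl ⟨x, rfl, fun hx => ?_⟩
            exact (Finset.mem_sdiff.1 ((reduceTable_subset hA).1 hx)).2
              (by simpa using (hf _ h2).1)
          · exact .inr (.inr ⟨ih hA (hA' h1), ih hB (hB' h2)⟩)
      · simp [hc, hE]

/-- A restricted derivation is again a derivation: a resolution step is either repeated or replaced
by one of its reduced premises, which inherits its earlier justification. -/
theorem Deriv.reduce (h : Deriv ax P) (del forb : Finset (Lit n)) :
    Deriv (fun c => ∃ G ∈ P, ax G ∧ G ∩ forb = ∅ ∧ c = G \ del) (reduce del forb P) := by
  induction h with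
  | nil => exact .nil
  | @concat P E h h' ih =>
    have ih := ih.mono (ax' := fun c => ∃ G ∈ P ++ [E], ax G ∧ G ∩ forb = ∅ ∧ c = G \ del)
      fun c _ ⟨G, hG, h⟩ => ⟨G, List.mem_append_left _ hG, h⟩
    rw [reduce_concat]
    cases ho : reduceClause del forb (reduceTable del forb P) E with
    | none => simpa using ih
    | some c =>
      refine ih.concat ?_
      rcases reduceClause_cases del forb (reduceTable del forb P) E with
        ⟨l, A, B, a, b, hA, hB, hr, hc⟩ | ⟨hn, hc⟩
      · rw [hc] at ho
        rcases combine_eq_some ho with ⟨x, y, rfl, rfl, hx, hy, rfl⟩ | ⟨rfl, hl⟩ | ⟨rfl, hl⟩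
        · exact .inr ⟨l, x, mem_reduce.2 ⟨A, hA⟩, y, mem_reduce.2 ⟨B, hB⟩,
            isRes_iff.2 ⟨hx, hy, rfl⟩⟩
        · exact ih.of_mem (mem_reduce.2 ⟨A, hA⟩)
        · exact ih.of_mem (mem_reduce.2 ⟨B, hB⟩)
      · rw [hc] at ho
        split at ho
        · next hf =>
          simp only [Option.some.injEq] at ho
          refine .inl ⟨E, by simp, ?_, hf, ho.symm⟩
          refine h'.resolve_right ?_
          rintro ⟨l, A, hA, B, hB, hr⟩
          obtain ⟨a, hA⟩ := mem_reduceTable_of_mem (del := del) (forb := forb) hA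
          obtain ⟨b, hB⟩ := mem_reduceTable_of_mem (del := del) (forb := forb) hB
          exact hn _ hA _ hB l hr
        · simp at ho

/-- If the deletion of the symmetric set `X` does not produce complementary unit clauses, then
the clauses inside `X` form a derivation. -/
theorem Deriv.filter_subset {X : Finset (Lit n)} (hX : ∀ l, negLit l ∈ X ↔ l ∈ X)
    (h : Deriv ax P) (hn : ∀ l, {l} ∈ OrderedCDCL.reduce X ∅ P →
      {negLit l} ∉ OrderedCDCL.reduce X ∅ P) :
    Deriv ax (P.filter fun E => decide (E ⊆ X)) ∧
      ∀ E c, (E, some c) ∈ reduceTable X ∅ P → ¬ E ⊆ X → c ≠ ∅ := by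
  induction h with
  | nil => exact ⟨.nil, by simp [reduceTable]⟩
  | @concat P E h h' ih =>
    have hsub : OrderedCDCL.reduce X ∅ P ⊆ OrderedCDCL.reduce X ∅ (P ++ [E]) := by
      rw [reduce_concat]; exact List.subset_append_left _ _
    obtain ⟨ih1, ih2⟩ := ih fun l h h' => hn l (hsub h) (hsub h')
    -- The invariant that clauses outside `X` have nonempty reductions is what forces the premises
    -- of a clause inside `X` to lie inside `X`.
    suffices hs : (E ⊆ X → (ax E ∨ ∃ l, ∃ A ∈ P.filter fun E => decide (E ⊆ X),
        ∃ B ∈ P.filter fun E => decide (E ⊆ X), isRes l A B E = true)) ∧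
        ∀ c, reduceClause X ∅ (reduceTable X ∅ P) E = some c → ¬ E ⊆ X → c ≠ ∅ by
      constructor
      · rw [List.filter_append, List.filter_singleton]
        by_cases hE : E ⊆ X
        · rw [decide_eq_true hE, cond_true]
          exact ih1.concat (hs.1 hE)
        · simpa [hE] using ih1
      · intro E' c hc hE
        rw [reduceTable_concat, List.mem_append, List.mem_singleton, Prod.mk.injEq] at hc
        rcases hc with hc | ⟨rfl, hc⟩
        · exact ih2 E' c hc hE
        · exact hs.2 c hc.symm hE
    rcases reduceClause_cases X ∅ (reduceTable X ∅ P) E with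
      ⟨l, A, B, a, b, hA, hB, hr, hc⟩ | ⟨hno, hc⟩
    · obtain ⟨hlA, hlB, hEeq⟩ := isRes_iff.1 hr
      obtain ⟨x, rfl⟩ := Option.isSome_iff_exists.1
        (isSome_of_mem_reduceTable (by simp) hA (by simp))
      obtain ⟨y, rfl⟩ := Option.isSome_iff_exists.1
        (isSome_of_mem_reduceTable (by simp) hB (by simp))
      obtain ⟨c, hc'⟩ := Option.isSome_iff_exists.1
        (isSome_of_mem_reduceTable (P := P ++ [E]) (del := X) (forb := ∅) (E := E)
          (o := reduceClause X ∅ (reduceTable X ∅ P) E) (by simp)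
          (by rw [reduceTable_concat]; simp) (by simp))
      have hcs : c ⊆ E \ X := (reduceTable_subset (P := P ++ [E]) (forb := ∅)
        (by rw [reduceTable_concat]; simp [hc'])).1
      have hxA := (reduceTable_subset hA).1
      have hyB := (reduceTable_subset hB).1
      have hcE : E ⊆ X → c = ∅ := fun hE => Finset.subset_empty.1 (by
        rwa [Finset.sdiff_eq_empty_iff_subset.2 hE] at hcs)
      have hAne : ¬ A ⊆ X → x ≠ ∅ := ih2 A x hA
      have hBne : ¬ B ⊆ X → y ≠ ∅ := ih2 B y hB
      rw [hc] at hc'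
      have hcand : ((l ∉ x ∧ x ≠ ∅) ∨ (negLit l ∉ y ∧ y ≠ ∅)) → c ≠ ∅ := by
        rintro (h | h)
        · exact combine_ne_empty hc' (.inl ⟨x, rfl, h⟩)
        · exact combine_ne_empty hc' (.inr ⟨y, rfl, h⟩)
      -- By the symmetry of `X`, a pivot variable outside `X` puts both premises outside `X`.
      have hlX : l ∉ X → ¬ A ⊆ X ∧ ¬ B ⊆ X := fun hl =>
        ⟨fun h => hl (h hlA), fun h => hl ((hX l).1 (h hlB))⟩
      -- An empty resolvent could come only from complementary unit clauses, which `hn` excludes.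
      have hboth : l ∈ x → negLit l ∈ y → c ≠ ∅ := by
        intro hx hy hce
        have : c = x.erase l ∪ y.erase (negLit l) := by
          simpa [combine, hx, hy, eq_comm] using hc'
        rw [hce, eq_comm, Finset.union_eq_empty, Finset.erase_eq_empty_iff,
          Finset.erase_eq_empty_iff] at this
        have h1 : x = {l} := this.1.resolve_left (Finset.ne_empty_of_mem hx)
        have h2 : y = {negLit l} := this.2.resolve_left (Finset.ne_empty_of_mem hy)
        subst h1 h2
        exact hn l (hsub (mem_reduce.2 ⟨A, hA⟩)) (hsub (mem_reduce.2 ⟨B, hB⟩))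
      constructor
      · intro hE
        have hce := hcE hE
        -- Otherwise both premises have nonempty reductions, and in each case the reduced resolvent
        -- is nonempty, although it is contained in `E \ X = ∅`.
        have hl : l ∈ X := by
          by_contra hl
          obtain ⟨h1, h2⟩ := hlX hl
          by_cases hx : l ∈ x
          · by_cases hy : negLit l ∈ y
            · exact hboth hx hy hce
            · exact hcand (.inr ⟨hy, hBne h2⟩) hce
          · exact hcand (.inl ⟨hx, hAne h1⟩) hce
        refine .inr ⟨l, A, ?_, B, ?_, hr⟩
        · refine List.mem_filter.2 ⟨mem_of_mem_reduceTable hA, decide_eq_true fun m hm => ?_⟩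
          by_cases hml : m = l
          · rwa [hml]
          · exact hE (by rw [hEeq]; exact Finset.mem_union_left _ (Finset.mem_erase.2 ⟨hml, hm⟩))
        · refine List.mem_filter.2 ⟨mem_of_mem_reduceTable hB, decide_eq_true fun m hm => ?_⟩
          by_cases hml : m = negLit l
          · rw [hml]; exact (hX l).2 hl
          · exact hE (by rw [hEeq]; exact Finset.mem_union_right _ (Finset.mem_erase.2 ⟨hml, hm⟩))
      · intro c' hc'' hE
        rw [hc, hc', Option.some.injEq] at hc''
        subst hc''
        by_cases hx : l ∈ x
        · by_cases hy : negLit l ∈ y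
          · exact hboth hx hy
          · exact hcand (.inr ⟨hy, hBne (hlX (Finset.mem_sdiff.1 (hxA hx)).2).2⟩)
        · by_cases hy : negLit l ∈ y
          · refine hcand (.inl ⟨hx, hAne (hlX fun hl => ?_).1⟩)
            exact (Finset.mem_sdiff.1 (hyB hy)).2 ((hX l).2 hl)
          -- Neither reduction contains its pivot literal. If both were empty, both premises would
          -- lie inside `X`, and with them their resolvent `E`.
          · refine hcand ?_
            by_contra hcon
            push Not at hcon
            have h1 : A ⊆ X := by by_contra h; exact hAne h (hcon.1 hx)
            have h2 : B ⊆ X := by by_contra h; exact hBne h (hcon.2 hy)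
            refine hE ?_
            rw [hEeq]
            exact Finset.union_subset ((Finset.erase_subset _ _).trans h1)
              ((Finset.erase_subset _ _).trans h2)
    · constructor
      · intro _
        refine .inl (h'.resolve_right ?_)
        rintro ⟨l, A, hA, B, hB, hr⟩
        obtain ⟨a, hA⟩ := mem_reduceTable_of_mem (del := X) (forb := ∅) hA
        obtain ⟨b, hB⟩ := mem_reduceTable_of_mem (del := X) (forb := ∅) hB
        exact hno _ hA _ hB l hr
      · intro c hc' hE
        rw [hc, if_pos (by simp), Option.some.injEq] at hc'
        subst hc'
        rwa [ne_eq, Finset.sdiff_eq_empty_iff_subset]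

end Reduction

/-! ### Progress at one level -/

section Completeness
variable {n : ℕ} {Δ Δ' : List (RawLine n)} {vs : List (Fin n)}

/-- The last part also covers the variables in `low`: a removal may add positive literals there but
never loses one. This later preserves the literal `y` in a clause from which everything else outside
`low` is removed. -/
theorem remove_spec {low : List (Fin n)} {g : Lit n} {S : Finset (Lit n)} (hg : g.1 ∉ low)
    (hS : ∀ l ∈ S, l.1 ∈ low → l.2 = true) (hl : HasLift Δ low {negLit g}) :
    (∀ m, m.1 ∉ low → (m ∈ (remove vs Δ S (low, g)).2 ↔ m ∈ S ∧ m ≠ g)) ∧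
    (∀ m ∈ (remove vs Δ S (low, g)).2, m.1 ∈ low → m.2 = true) ∧
    (∀ m ∈ S, m ≠ g → m ∈ (remove vs Δ S (low, g)).2) := by
  obtain ⟨T, hT⟩ := Option.isSome_iff_exists.1 (isSome_findLift.2 hl)
  have hTl := (findLift_eq_some hT).2
  by_cases hgS : g ∈ S
  · have : (remove vs Δ S (low, g)).2 = S.erase g ∪ T.erase (negLit g) := by
      simp [remove, hgS, posOn_iff.2 hS, hg, hT]
    rw [this]
    refine ⟨fun m hm => ?_, fun m hm hml => ?_, fun m hm hmg => ?_⟩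
    · have h1 := hTl.1 m hm
      rw [Finset.mem_singleton] at h1
      simp only [Finset.mem_union, Finset.mem_erase]
      tauto
    · rw [Finset.mem_union, Finset.mem_erase, Finset.mem_erase] at hm
      rcases hm with hm | hm
      · exact hS m hm.2 hml
      · exact (hTl.2 m hml).2 hm.2
    · exact Finset.mem_union_left _ (Finset.mem_erase.2 ⟨hmg, hm⟩)
  · have : (remove vs Δ S (low, g)).2 = S := by simp [remove, hgS]
    rw [this]
    refine ⟨fun m _ => ⟨fun hm => ⟨hm, ?_⟩, fun hm => hm.1⟩, hS, fun m hm _ => hm⟩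
    rintro rfl
    exact hgS hm

theorem remove_of_notMem {low : List (Fin n)} {g : Lit n} {S : Finset (Lit n)} (hg : g ∉ S) :
    (remove vs Δ S (low, g)).2 = S := by simp [remove, hg]

theorem remove_mem (S : Finset (Lit n)) (op : List (Fin n) × Lit n) :
    (remove vs Δ S op).2 = S ∨ RawLine.clause (remove vs Δ S op).2 ∈ (remove vs Δ S op).1 := by
  unfold remove
  split
  · cases findLift op.1 {negLit op.2} Δ with
    | none => exact .inl rfl
    | some T => exact .inr (by simp [removalLines])
  · exact .inl rfl

theorem removeAll_nil (S : Finset (Lit n)) : removeAll vs Δ [] S = ([], S) := rfl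

theorem removeAll_cons (op : List (Fin n) × Lit n) (ops : List (List (Fin n) × Lit n))
    (S : Finset (Lit n)) : removeAll vs Δ (op :: ops) S =
      ((remove vs Δ S op).1 ++ (removeAll vs Δ ops (remove vs Δ S op).2).1,
        (removeAll vs Δ ops (remove vs Δ S op).2).2) := by
  have key : ∀ (ops : List (List (Fin n) × Lit n)) (acc : List (RawLine n)) (S : Finset (Lit n)),
      ops.foldl (fun s op => (s.1 ++ (remove vs Δ s.2 op).1, (remove vs Δ s.2 op).2)) (acc, S) =
        (acc ++ (removeAll vs Δ ops S).1, (removeAll vs Δ ops S).2) := by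
    intro ops
    induction ops with
    | nil => intro acc S; simp [removeAll]
    | cons op ops ih =>
      intro acc S
      simp only [removeAll, List.foldl_cons] at ih ⊢
      rw [ih, ih ([] ++ _)]
      simp
  rw [removeAll, List.foldl_cons, key]
  simp

theorem removeAll_mem (S : Finset (Lit n)) (ops : List (List (Fin n) × Lit n)) :
    (removeAll vs Δ ops S).2 = S ∨
      RawLine.clause (removeAll vs Δ ops S).2 ∈ (removeAll vs Δ ops S).1 := by
  induction ops generalizing S with
  | nil => exact .inl rfl
  | cons op ops ih =>
    rw [removeAll_cons]
    rcases ih (remove vs Δ S op).2 with h | h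
    · rw [h]
      exact (remove_mem S op).imp_right fun h => List.mem_append_left _ h
    · exact .inr (List.mem_append_right _ h)

theorem removeAll_spec {low : List (Fin n)} {ls : List (Lit n)}
    (hls : ∀ g ∈ ls, g.1 ∉ low ∧ HasLift Δ low {negLit g}) {S : Finset (Lit n)}
    (hS : ∀ l ∈ S, l.1 ∈ low → l.2 = true) :
    (∀ m, m.1 ∉ low →
      (m ∈ (removeAll vs Δ (ls.map fun l => (low, l)) S).2 ↔ m ∈ S ∧ m ∉ ls)) ∧
    (∀ m ∈ (removeAll vs Δ (ls.map fun l => (low, l)) S).2, m.1 ∈ low → m.2 = true) ∧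
    (∀ m ∈ S, m ∉ ls → m ∈ (removeAll vs Δ (ls.map fun l => (low, l)) S).2) := by
  induction ls generalizing S with
  | nil => simpa [removeAll_nil] using hS
  | cons g ls ih =>
    obtain ⟨h1, h2, h3⟩ := remove_spec (vs := vs) (hls g (by simp)).1 hS (hls g (by simp)).2
    obtain ⟨i1, i2, i3⟩ := ih (fun g hg => hls g (List.mem_cons_of_mem _ hg)) h2
    rw [List.map_cons, removeAll_cons]
    refine ⟨fun m hm => ?_, i2, fun m hm hmg => ?_⟩
    · rw [i1 m hm, h1 m hm, List.mem_cons]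
      tauto
    · rw [List.mem_cons, not_or] at hmg
      exact i3 m (h3 m hm hmg.1) hmg.2

/-- The clauses that are made from a lift of `G` when `y` is added to `low`. -/
theorem removalStage_spec {low : List (Fin n)} {y : Fin n} (hy : y ∉ low)
    {P : List (Finset (Lit n))} {G : Finset (Lit n)} (hG : G ∈ P) (hGl : HasLift Δ low G)
    (hyG : HasLift Δ low {(y, true)} ∨ (y, false) ∉ G) :
    (∃ C, RawLine.clause C ∈ Δ ++ removalStage vs low (low ++ [y]) y P Δ ∧
      IsLift low (G.erase (y, false)) C) ∧
    ∃ C, RawLine.clause C ∈ Δ ++ removalStage vs low (low ++ [y]) y P Δ ∧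
      (∀ m, m.1 ∉ low ++ [y] → (m ∈ C ↔ m ∈ G ∧ m ∉ decided (low ++ [y]) Δ)) ∧
      (∀ m ∈ C, m.1 ∈ low ++ [y] → m.2 = true) ∧ ((y, true) ∈ G → (y, true) ∈ C) := by
  obtain ⟨S, hS⟩ := Option.isSome_iff_exists.1 (isSome_findLift.2 hGl)
  obtain ⟨hSΔ, hSl⟩ := findLift_eq_some hS
  obtain ⟨S', hS'⟩ : ∃ S', S' = (remove vs Δ S (low, (y, false))).2 := ⟨_, rfl⟩
  have hsub : ∀ L ∈ (removeAll vs Δ (removals low (low ++ [y]) y (decided (low ++ [y]) Δ)) S).1,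
      L ∈ Δ ++ removalStage vs low (low ++ [y]) y P Δ := by
    intro L hL
    refine List.mem_append_right _ (List.mem_flatMap.2 ⟨G, hG, ?_⟩)
    rwa [hS]
  rw [removals, removeAll_cons, ← hS'] at hsub
  have h0 : (∀ m, m.1 ∉ low → (m ∈ S' ↔ m ∈ S ∧ m ≠ (y, false))) ∧
      (∀ m ∈ S', m.1 ∈ low → m.2 = true) ∧ (∀ m ∈ S, m ≠ (y, false) → m ∈ S') := by
    have hpos : ∀ l ∈ S, l.1 ∈ low → l.2 = true := fun l hl hll => (hSl.2 l hll).2 hl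
    rw [hS']
    rcases hyG with hyG | hyG
    · exact remove_spec hy hpos hyG
    · have : (y, false) ∉ S := fun h => hyG ((hSl.1 (y, false) hy).1 h)
      rw [remove_of_notMem this]
      refine ⟨fun m _ => ⟨fun hm => ⟨hm, ?_⟩, fun hm => hm.1⟩, hpos, fun m hm _ => hm⟩
      rintro rfl
      exact this hm
  have hS'Δ : RawLine.clause S' ∈ Δ ++ removalStage vs low (low ++ [y]) y P Δ := by
    rcases remove_mem (vs := vs) (Δ := Δ) S (low, (y, false)) with h | h
    · rw [hS', h]; exact List.mem_append_left _ hSΔ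
    · rw [← hS'] at h
      exact hsub _ (List.mem_append_left _ h)
  have hS'y : (y, false) ∉ S' := fun h => ((h0.1 (y, false) hy).1 h).2 rfl
  refine ⟨⟨S', hS'Δ, fun m hm => ?_, fun m hm => ⟨?_, fun h => h0.2.1 m h hm⟩⟩, ?_⟩
  · rw [h0.1 m hm, Finset.mem_erase, hSl.1 m hm]
    tauto
  · exact fun h => (hSl.2 m hm).1 (Finset.mem_of_mem_erase h)
  · obtain ⟨i1, i2, i3⟩ := removeAll_spec (vs := vs) (Δ := Δ) (low := low ++ [y])
      (ls := (allLits n).filter fun l => decide (l ∈ decided (low ++ [y]) Δ)) (S := S')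
      (fun g hg => by
        rw [List.mem_filter, decide_eq_true_eq, mem_decided] at hg
        exact ⟨hg.2.1, hg.2.2.2⟩)
      -- With `¬y` gone, `S'` is positive on `low ++ [y]`, the condition for removals at the longer
      -- prefix.
      (fun l hl hll => by
        rw [List.mem_append, List.mem_singleton] at hll
        rcases hll with hll | hll
        · exact h0.2.1 l hl hll
        · obtain ⟨i, a⟩ := l
          cases a
          · dsimp only at hll
            subst hll
            exact absurd hl hS'y
          · rfl)
    refine ⟨_, ?_, fun m hm => ?_, i2, fun hyG' => ?_⟩
    · rcases removeAll_mem (vs := vs) (Δ := Δ) S' (((allLits n).filter fun l =>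
        decide (l ∈ decided (low ++ [y]) Δ)).map fun l => (low ++ [y], l)) with h | h
      · rw [h]; exact hS'Δ
      · exact hsub _ (List.mem_append_right _ h)
    · rw [i1 m hm, h0.1 m fun h => hm (List.mem_append_left _ h),
        hSl.1 m fun h => hm (List.mem_append_left _ h), List.mem_filter]
      have : m ≠ (y, false) := by rintro rfl; simp at hm
      simp [this]
    · refine i3 _ (h0.2.2 _ ((hSl.1 (y, true) hy).2 hyG') (by simp)) ?_
      simp [List.mem_filter, mem_decided]

/-- By induction along `P`. Although the trails zero `low'`, resolving two lifts at `low` adds no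
literal from outside them, so the results are lifts at `low` itself. -/
theorem resolutionStage_spec {low low' : List (Fin n)} {X : Finset (Lit n)}
    {F P : List (Finset (Lit n))} {ax : Finset (Lit n) → Prop} (hX : ∀ l ∈ X, l.1 ∉ low)
    (hF : ∀ G ∈ F, Consistent G) (hP : P ⊆ F)
    (hd : Deriv ax (P.filter fun E => decide (E ⊆ X)))
    (hax : ∀ G, ax G → G ⊆ X → HasLift Δ low G) {E : Finset (Lit n)} (hE : E ∈ P) (hEX : E ⊆ X) :
    HasLift (resolutionStage low low' X F P Δ) low E := by
  induction P using List.reverseRecOn generalizing E with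
  | nil => simp at hE
  | append_singleton P D ih =>
    have ih' := fun hd => @ih (List.Subset.trans (List.subset_append_left _ _) hP) hd
    rw [resolutionStage_concat]
    rw [List.filter_append, List.filter_singleton] at hd
    by_cases hD : D ⊆ X
    · rw [decide_eq_true hD, cond_true, deriv_concat_iff] at hd
      rcases List.mem_append.1 hE with hE | hE
      · exact (ih' hd.1 hE hEX).mono (List.subset_append_left _ _)
      · rw [List.mem_singleton] at hE
        subst hE
        rcases hd.2 with h | ⟨l, A, hA, B, hB, hr⟩
        · exact (hax E h hEX).mono (List.Subset.trans (subset_resolutionStage _ _ _ _ _ _)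
            (List.subset_append_left _ _))
        · rw [List.mem_filter, decide_eq_true_eq] at hA hB
          have hAF := hP (List.mem_append_left _ hA.1)
          have hBF := hP (List.mem_append_left _ hB.1)
          have hEF := hP (List.mem_append_right _ (List.mem_singleton_self E))
          obtain ⟨S, hS⟩ := Option.isSome_iff_exists.1 (isSome_findLift.2 (ih' hd.1 hA.1 hA.2))
          obtain ⟨T, hT⟩ := Option.isSome_iff_exists.1 (isSome_findLift.2 (ih' hd.1 hB.1 hB.2))
          obtain ⟨hlA, hlB, hEeq⟩ := isRes_iff.1 hr
          have hlE : l ∉ E := by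
            rw [hEeq, Finset.mem_union, Finset.mem_erase, Finset.mem_erase]
            rintro (h | h)
            · exact h.1 rfl
            · exact hF B hBF l h.2 hlB
          have hlE' : negLit l ∉ E := by
            rw [hEeq, Finset.mem_union, Finset.mem_erase, Finset.mem_erase]
            rintro (h | h)
            · exact hF A hAF l hlA h.2
            · exact h.1 rfl
          have hsome : (findResLifts low X F (resolutionStage low low' X F P Δ) E).isSome = true := by
            rw [findResLifts, List.findSome?_isSome_iff]
            refine ⟨A, hAF, ?_⟩
            rw [List.findSome?_isSome_iff]
            refine ⟨B, hBF, ?_⟩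
            rw [List.findSome?_isSome_iff]
            refine ⟨l, mem_allLits l, ?_⟩
            simp [hr, hA.2, hB.2, hlE, hlE', hS, hT]
          -- The search may return premises and a pivot other than those at hand. Any successful
          -- outcome resolves to a lift of the same `E`.
          obtain ⟨⟨l', S', T'⟩, hr'⟩ := Option.isSome_iff_exists.1 hsome
          obtain ⟨A', hA', B', hB', hres, hAX, hBX, -, -, hS', hT'⟩ := findResLifts_eq_some hr'
          dsimp only at hres hS' hT'
          refine ⟨S'.erase l' ∪ T'.erase (negLit l'), ?_, ?_⟩
          · refine List.mem_append_right _ ?_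
            simp [resolveLifts, hEX, isConsistent_iff.2 (hF E hEF), hr', resolutionLines]
          · obtain ⟨-, -, hEeq'⟩ := isRes_iff.1 hres
            have hSl := (findLift_eq_some hS').2
            have hTl := (findLift_eq_some hT').2
            refine ⟨fun m hm => ?_, fun m hm => ⟨fun h => hX m (hEX h) hm, fun h => ?_⟩⟩
            · rw [hEeq', Finset.mem_union, Finset.mem_union, Finset.mem_erase, Finset.mem_erase,
                Finset.mem_erase, Finset.mem_erase, hSl.1 m hm, hTl.1 m hm]
            · rw [Finset.mem_union, Finset.mem_erase, Finset.mem_erase] at h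
              exact h.elim (fun h => (hSl.2 m hm).2 h.2) fun h => (hTl.2 m hm).2 h.2
    · rw [decide_eq_false hD, cond_false, List.append_nil] at hd
      rcases List.mem_append.1 hE with hE | hE
      · exact (ih' hd hE hEX).mono (List.subset_append_left _ _)
      · rw [List.mem_singleton] at hE
        exact absurd (hE ▸ hEX) hD

/-- Some unit clause has gained a lift at some prefix of `vs`. -/
def NewLift (vs : List (Fin n)) (Δ Δ' : List (RawLine n)) : Prop :=
  ∃ low l, low <+: vs ∧ ¬ HasLift Δ low {l} ∧ HasLift Δ' low {l}

/-- The derivation `P` is a refutation from restrictions of lines of `Δ`, over variables that are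
undecided at `low`. -/
structure Reduced (low : List (Fin n)) (P : List (Finset (Lit n))) (Δ : List (RawLine n)) :
    Prop where
  zero : ∅ ∈ P
  deriv : Deriv (fun G => G ≠ ∅ ∧ HasLift Δ low G) P
  consistent : ∀ G ∈ P, Consistent G
  undecided : ∀ G ∈ P, ∀ l ∈ G, l.1 ∉ low ∧ ¬ (HasLift Δ low {l} ∧ HasLift Δ low {negLit l})

/-- Assume that no unit clause gains a lift. If deleting the decided literals leaves complementary
unit clauses, the reduced derivation passes to the next level. Otherwise the decided clauses alone
refute, and carrying out this refutation yields lifts at `low` that contradict undecidedness or the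
choice of `d`. -/
theorem newLift_or_reduced {low : List (Fin n)} {y : Fin n} (hy : y ∉ low)
    (hpre : low ++ [y] <+: vs) {P : List (Finset (Lit n))} (h : Reduced low P Δ) :
    NewLift vs Δ (level vs low y (P, Δ)).2 ∨
      Reduced (low ++ [y]) (level vs low y (P, Δ)).1 (level vs low y (P, Δ)).2 := by
  rw [or_iff_not_imp_left]
  intro hnew
  obtain ⟨X, hXdef⟩ : ∃ X, X = decided (low ++ [y]) Δ := ⟨_, rfl⟩
  -- Here `d = false` means that the unit clause `y` has a lift and `y` is set to 1; `d = true`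
  -- means that `y` is set to 0. The deleted literal is `(y, d)`.
  obtain ⟨d, hd⟩ : ∃ d, d = !(findLift low {(y, true)} Δ).isSome := ⟨_, rfl⟩
  obtain ⟨F, hFdef⟩ : ∃ F, F = reduce {(y, d)} {(y, !d)} P := ⟨_, rfl⟩
  obtain ⟨Δ₁, hΔ₁⟩ : ∃ Δ₁, Δ₁ = Δ ++ removalStage vs low (low ++ [y]) y P Δ := ⟨_, rfl⟩
  obtain ⟨Δ₂, hΔ₂⟩ : ∃ Δ₂, Δ₂ = resolutionStage low (low ++ [y]) X F F Δ₁ := ⟨_, rfl⟩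
  have hlevel : level vs low y (P, Δ) =
      ((reduce X ∅ F).filter (fun G => !decide (G = ∅)) ++ [∅], Δ₂) := by
    simp only [level, firstReduction, hΔ₂, hΔ₁, hFdef, hXdef, hd, Bool.not_not]
  rw [hlevel] at hnew ⊢
  dsimp only at hnew ⊢
  have hdt : d = false ↔ HasLift Δ low {(y, true)} := by
    rw [hd, Bool.not_eq_false', isSome_findLift]
  have hsub₁ : Δ ⊆ Δ₁ := by rw [hΔ₁]; exact List.subset_append_left _ _
  have hsub₂ : Δ₁ ⊆ Δ₂ := by rw [hΔ₂]; exact subset_resolutionStage _ _ _ _ _ _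
  have hlow : low <+: vs := (List.prefix_append _ _).trans hpre
  -- Without new lifts, having a lift as a unit clause means the same before and after the level.
  have hkeep : ∀ low l, low <+: vs → HasLift Δ₂ low {l} → HasLift Δ low {l} := by
    intro low l hp hl
    by_contra hl'
    exact hnew ⟨low, l, hp, hl', hl⟩
  have hXl : ∀ l ∈ X, l.1 ∉ low ++ [y] := fun l hl => (mem_decided.1 (hXdef ▸ hl)).1
  have hXl' : ∀ l ∈ X, l.1 ∉ low := fun l hl h => hXl l hl (List.mem_append_left _ h)
  have hXsymm : ∀ l, negLit l ∈ X ↔ l ∈ X := fun l => by rw [hXdef, negLit_mem_decided]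
  have hFmem : ∀ c ∈ F, ∃ G ∈ P, c ⊆ G \ {(y, d)} ∧ (y, !d) ∉ c := by
    intro c hc
    rw [hFdef] at hc
    obtain ⟨G, hG⟩ := mem_reduce.1 hc
    have := reduceTable_subset hG
    refine ⟨G, mem_of_mem_reduceTable hG, this.1, fun hyc => ?_⟩
    have h2 := this.2
    rw [Finset.eq_empty_iff_forall_notMem] at h2
    exact h2 (y, !d) (by simp [hyc])
  have hFl : ∀ c ∈ F, ∀ l ∈ c, l.1 ∉ low ++ [y] := by
    intro c hc l hl hll
    obtain ⟨G, hG, hcG, hcy⟩ := hFmem c hc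
    rw [List.mem_append, List.mem_singleton] at hll
    have hlG := Finset.mem_sdiff.1 (hcG hl)
    rcases hll with hll | hll
    · exact (h.undecided G hG l hlG.1).1 hll
    · obtain ⟨i, a⟩ := l
      dsimp only at hll
      subst hll
      have h1 : a ≠ d := by rintro rfl; simp at hlG
      have h2 : a ≠ !d := by rintro rfl; exact hcy hl
      revert h1 h2
      cases a <;> cases d <;> simp
  have hFc : ∀ c ∈ F, Consistent c := by
    intro c hc l hl hl'
    obtain ⟨G, hG, hcG, -⟩ := hFmem c hc
    exact h.consistent G hG l (Finset.mem_sdiff.1 (hcG hl)).1 (Finset.mem_sdiff.1 (hcG hl')).1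
  have hFd := h.deriv.reduce {(y, d)} {(y, !d)}
  rw [← hFdef] at hFd
  have hspec : ∀ G ∈ P, HasLift Δ low G → G ∩ {(y, !d)} = ∅ →
      (y, !d) ∉ G ∧ (HasLift Δ low {(y, true)} ∨ (y, false) ∉ G) := by
    intro G hG hGl hGd
    have hyG : (y, !d) ∉ G := fun hyG => by
      rw [Finset.eq_empty_iff_forall_notMem] at hGd
      exact hGd (y, !d) (by simp [hyG])
    refine ⟨hyG, ?_⟩
    by_cases hdf : d = false
    · exact .inl (hdt.1 hdf)
    · rw [Bool.not_eq_false] at hdf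
      exact .inr (by simpa [hdf] using hyG)
  by_cases hfound : ∃ u, {u} ∈ reduce X ∅ F ∧ {negLit u} ∈ reduce X ∅ F
  · obtain ⟨u, hu, hu'⟩ := hfound
    have hmem : ∀ c ∈ (reduce X ∅ F).filter (fun G => !decide (G = ∅)) ++ [∅],
        ∃ G ∈ F, c ⊆ G \ X := by
      intro c hc
      rw [List.mem_append, List.mem_singleton, List.mem_filter] at hc
      rcases hc with ⟨hc, -⟩ | rfl
      · obtain ⟨G, hG⟩ := mem_reduce.1 hc
        exact ⟨G, mem_of_mem_reduceTable hG, (reduceTable_subset hG).1⟩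
      · obtain ⟨G, hG⟩ := mem_reduce.1 hu
        exact ⟨G, mem_of_mem_reduceTable hG, Finset.empty_subset _⟩
    refine ⟨by simp, ?_, fun c hc => ?_, fun c hc l hl => ?_⟩
    -- The axioms of the new derivation have lifts because the literals in `X` have been removed
    -- from lifts of the old axioms; the closing empty clause is the resolvent of `{u}` and `{negLit
    -- u}`.
    · refine Deriv.concat ?_ (.inr ⟨u, {u}, ?_, {negLit u}, ?_, ?_⟩)
      · refine (hFd.reduce X ∅).filter_ne_empty.mono fun c _ hc => ⟨hc.2, ?_⟩
        obtain ⟨⟨c₁, -, ⟨G, hG, hGax, hGd, rfl⟩, -, rfl⟩, -⟩ := hc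
        obtain ⟨hyG, hyG'⟩ := hspec G hG hGax.2 hGd
        obtain ⟨-, C, hC, h1, h2, -⟩ := removalStage_spec (vs := vs) hy hG hGax.2 hyG'
        refine ⟨C, hsub₂ (hΔ₁ ▸ hC), fun m hm => ?_, fun m hm => ⟨fun hm' => ?_, fun hm' => h2 m hm' hm⟩⟩
        · have : m ≠ (y, d) := by rintro rfl; simp at hm
          rw [h1 m hm, hXdef]
          simp [this]
        · rw [Finset.mem_sdiff, Finset.mem_sdiff, Finset.mem_singleton] at hm'
          rw [List.mem_append, List.mem_singleton] at hm
          rcases hm with hm | hm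
          · exact (h.undecided G hG m hm'.1.1).1 hm
          · obtain ⟨i, a⟩ := m
            dsimp only at hm
            subst hm
            have h1 : a ≠ d := by rintro rfl; simp at hm'
            have h2 : a ≠ !d := by rintro rfl; exact hyG hm'.1.1
            revert h1 h2
            cases a <;> cases d <;> simp
      · simp [List.mem_filter, hu]
      · simp [List.mem_filter, hu']
      · simp [isRes]
    · obtain ⟨G, hG, hcG⟩ := hmem c hc
      exact fun l hl hl' => hFc G hG l (Finset.mem_sdiff.1 (hcG hl)).1 (Finset.mem_sdiff.1 (hcG hl')).1
    · obtain ⟨G, hG, hcG⟩ := hmem c hc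
      have hlG := Finset.mem_sdiff.1 (hcG hl)
      refine ⟨hFl G hG l hlG.1, fun hll => hlG.2 ?_⟩
      rw [hXdef, mem_decided]
      exact ⟨hFl G hG l hlG.1, hkeep _ _ hpre hll.1, hkeep _ _ hpre hll.2⟩
  · exfalso
    push Not at hfound
    have hXd := (hFd.filter_subset hXsymm hfound).1
    have hax : ∀ c, (∃ G ∈ P, (G ≠ ∅ ∧ HasLift Δ low G) ∧ G ∩ {(y, !d)} = ∅ ∧ c = G \ {(y, d)}) →
        c ⊆ X → HasLift Δ₁ low c := by
      rintro c ⟨G, hG, hGax, hGd, rfl⟩ hcX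
      obtain ⟨hyG, hyG'⟩ := hspec G hG hGax.2 hGd
      obtain ⟨⟨C₀, hC₀, hC₀l⟩, C, hC, h1, h2, h3⟩ :=
        removalStage_spec (vs := vs) hy hG hGax.2 hyG'
      rw [← hΔ₁] at hC₀ hC
      by_cases hdf : d = false
      · rw [hdf, Finset.sdiff_singleton_eq_erase]
        exact ⟨C₀, hC₀, hC₀l⟩
      · have hdf' := (Bool.not_eq_false _).mp hdf
        rw [hdf'] at hyG hcX ⊢
        -- If `y` is in `G`, all other literals of `G` lie in `X` and have been removed, so what
        -- remains is a lift of the unit clause `y` at `low`. For `d = true` no such lift exists.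
        by_cases hyt : (y, true) ∈ G
        · refine absurd (hdt.2 (hkeep low (y, true) hlow ⟨C, hsub₂ hC, fun m hm => ?_, fun m hm =>
            ⟨?_, fun hm' => h2 m hm' (List.mem_append_left _ hm)⟩⟩)) hdf
          · rw [Finset.mem_singleton]
            constructor
            · intro hmC
              by_contra hne
              by_cases hmy : m.1 = y
              · have := h2 m hmC (by simp [hmy])
                exact hne (Prod.ext hmy this)
              · have hml : m.1 ∉ low ++ [y] := by simp [hm, hmy]
                obtain ⟨hmG, hmX⟩ := (h1 m hml).1 hmC
                exact hmX (hXdef ▸ hcX (by simp [hmG, hne]))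
            · rintro rfl
              exact h3 hyt
          · rw [Finset.mem_singleton]
            rintro rfl
            exact hy hm
        · rw [Finset.sdiff_singleton_eq_erase, Finset.erase_eq_of_notMem hyt]
          rw [Finset.erase_eq_of_notMem (by simpa using hyG)] at hC₀l
          exact ⟨C₀, hC₀, hC₀l⟩
    have hlift : ∀ E ∈ F, E ⊆ X → HasLift Δ₂ low E := by
      intro E hE hEX
      rw [hΔ₂]
      exact resolutionStage_spec hXl' hFc (List.Subset.refl _) hXd hax hE hEX
    have hzero : ∅ ∈ F := by
      obtain ⟨o, ho⟩ := mem_reduceTable_of_mem (del := {(y, d)}) (forb := {(y, !d)}) h.zero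
      obtain ⟨c, rfl⟩ := Option.isSome_iff_exists.1
        (isSome_of_mem_reduceTable (by simp [negLit]) ho (by simp))
      have hc := (reduceTable_subset ho).1
      rw [Finset.empty_sdiff, Finset.subset_empty] at hc
      subst hc
      rw [hFdef]
      exact mem_reduce.2 ⟨_, ho⟩
    have hzX : ∅ ∈ F.filter fun E => decide (E ⊆ X) := List.mem_filter.2 ⟨hzero, by simp⟩
    -- If the empty clause is a restricted axiom, this axiom was the unit clause `(y, d)`: for `d =
    -- true` its lift contradicts the choice of `d`, and for `d = false` it makes `y` decided at
    -- `low`. If it is a resolvent, two complementary unit clauses have lifts at `low`, although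
    -- their variable is undecided.
    rcases hXd.of_mem hzX with ⟨G, hG, hGax, hGd, hGe⟩ | ⟨l, A, hA, B, hB, hr⟩
    · rw [eq_comm, Finset.sdiff_eq_empty_iff_subset, Finset.subset_singleton_iff] at hGe
      have hGe := hGe.resolve_left hGax.1
      subst hGe
      by_cases hdf : d = false
      · have h1 := hdt.1 hdf
        refine (h.undecided _ hG (y, d) (by simp)).2 ⟨hGax.2, ?_⟩
        simpa [negLit, hdf] using h1
      · have hdf' := (Bool.not_eq_false _).mp hdf
        exact hdf (hdt.2 (hdf' ▸ hGax.2))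
    · rw [List.mem_filter, decide_eq_true_eq] at hA hB
      obtain ⟨hlA, hlB, he⟩ := isRes_iff.1 hr
      rw [eq_comm, Finset.union_eq_empty, Finset.erase_eq_empty_iff,
        Finset.erase_eq_empty_iff] at he
      have hA1 := he.1.resolve_left (Finset.ne_empty_of_mem hlA)
      have hB1 := he.2.resolve_left (Finset.ne_empty_of_mem hlB)
      obtain ⟨G, hG, hAG, -⟩ := hFmem A hA.1
      refine (h.undecided G hG l (Finset.mem_sdiff.1 (hAG hlA)).1).2 ⟨?_, ?_⟩
      · exact hkeep low l hlow (hA1 ▸ hlift A hA.1 hA.2)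
      · exact hkeep low _ hlow (hB1 ▸ hlift B hB.1 hB.2)

end Completeness

/-! ### Counting the passes -/

section Passes
variable {n : ℕ} {Δ Δ' Δ'' : List (RawLine n)} {vs : List (Fin n)} {P : List (Finset (Lit n))}

/-- All proper prefixes of `vs`, each with the variable that follows it. -/
def levelsOf (vs : List (Fin n)) : List (List (Fin n) × Fin n) :=
  (vs.foldl (fun (s : List (Fin n) × List (List (Fin n) × Fin n)) v =>
    (s.1 ++ [v], s.2 ++ [(s.1, v)])) ([], [])).2

theorem levelsOf_fold (vs : List (Fin n)) :
    vs.foldl (fun (s : List (Fin n) × List (List (Fin n) × Fin n)) v =>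
      (s.1 ++ [v], s.2 ++ [(s.1, v)])) ([], []) = (vs, levelsOf vs) := by
  refine Prod.ext ?_ rfl
  induction vs using List.reverseRecOn with
  | nil => rfl
  | append_singleton vs v ih => simp [ih]

theorem levelsOf_concat (vs : List (Fin n)) (v : Fin n) :
    levelsOf (vs ++ [v]) = levelsOf vs ++ [(vs, v)] := by
  rw [levelsOf, List.foldl_concat, levelsOf_fold]

theorem length_levelsOf (vs : List (Fin n)) : (levelsOf vs).length = vs.length := by
  induction vs using List.reverseRecOn with
  | nil => rfl
  | append_singleton vs v ih => simp [levelsOf_concat, ih]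

theorem isLevels_levelsOf {l : List (Fin n)} (h : l <+: vs) : IsLevels vs (levelsOf l) := by
  induction l using List.reverseRecOn with
  | nil => intro k hk; simp [levelsOf] at hk
  | append_singleton l v ih =>
    rw [levelsOf_concat]
    intro k hk
    rcases List.mem_append.1 hk with hk | hk
    · exact ih ((List.prefix_append _ _).trans h) k hk
    · rw [List.mem_singleton] at hk
      subst hk
      exact h

theorem NewLift.mono (h : NewLift vs Δ Δ') (h' : Δ' ⊆ Δ'') : NewLift vs Δ Δ'' := by
  obtain ⟨low, l, h1, h2, h3⟩ := h
  exact ⟨low, l, h1, h2, h3.mono h'⟩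

theorem NewLift.anti (h : NewLift vs Δ' Δ'') (h' : Δ ⊆ Δ') : NewLift vs Δ Δ'' := by
  obtain ⟨low, l, h1, h2, h3⟩ := h
  exact ⟨low, l, h1, fun h => h2 (h.mono h'), h3⟩

theorem subset_foldl_level (levels : List (List (Fin n) × Fin n))
    (s : List (Finset (Lit n)) × List (RawLine n)) :
    s.2 ⊆ (levels.foldl (fun s k => level vs k.1 k.2 s) s).2 := by
  induction levels generalizing s with
  | nil => exact List.Subset.refl _
  | cons k ks ih => exact List.Subset.trans (subset_level k.1 k.2 s) (ih _)

theorem subset_pass (levels : List (List (Fin n) × Fin n)) : Δ ⊆ pass vs levels P Δ :=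
  subset_foldl_level levels (P, Δ)

/-- With no variable left all clauses are empty, and the empty clause is neither an admissible axiom
nor a resolvent of empty clauses. -/
theorem not_reduced_of_forall_mem (hvs : ∀ v, v ∈ vs) : ¬ Reduced vs P Δ := by
  intro h
  rcases h.deriv.of_mem h.zero with h' | ⟨l, A, hA, B, hB, hr⟩
  · exact h'.1 rfl
  · exact (h.undecided A hA l (isRes_iff.1 hr).1).1 (hvs _)

/-- If no level gained a lift, a reduced refutation would survive up to the full list of variables,
where none exists. -/
theorem newLift_pass {π : Equiv.Perm (Fin n)} (hv : Enumerates π vs) (h : Reduced [] P Δ) :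
    NewLift vs Δ (pass vs (levelsOf vs) P Δ) := by
  have key : ∀ l, l <+: vs →
      NewLift vs Δ ((levelsOf l).foldl (fun s k => level vs k.1 k.2 s) (P, Δ)).2 ∨
      Reduced l ((levelsOf l).foldl (fun s k => level vs k.1 k.2 s) (P, Δ)).1
        ((levelsOf l).foldl (fun s k => level vs k.1 k.2 s) (P, Δ)).2 := by
    intro l
    induction l using List.reverseRecOn with
    | nil => intro _; exact .inr h
    | append_singleton l v ih =>
      intro hl
      rw [levelsOf_concat, List.foldl_concat]
      rcases ih ((List.prefix_append _ _).trans hl) with ih | ih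
      · exact .inl (ih.mono (subset_level _ _ _))
      · have hvl : v ∉ l := by
          have := hv.nodup.sublist hl.sublist
          rw [List.nodup_append] at this
          exact fun hvl => this.2.2 v hvl v (by simp) rfl
        refine (newLift_or_reduced hvl hl ih).imp_left fun h' => h'.anti ?_
        exact subset_foldl_level _ (P, Δ)
  exact (key vs List.prefix_rfl).resolve_right (not_reduced_of_forall_mem hv.mem)

open Classical in
/-- The unit clauses that have lifts. -/
noncomputable def lifted (vs : List (Fin n)) (Δ : List (RawLine n)) :
    Finset (List (Fin n) × Lit n) :=
  (vs.inits.toFinset ×ˢ Finset.univ).filter fun p => HasLift Δ p.1 {p.2}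

theorem card_lifted_le (vs : List (Fin n)) (Δ : List (RawLine n)) :
    (lifted vs Δ).card ≤ (vs.length + 1) * (2 * n) := by
  classical
  refine (Finset.card_filter_le _ _).trans ?_
  rw [Finset.card_product]
  refine Nat.mul_le_mul ((List.toFinset_card_le _).trans (by simp)) ?_
  simp [Lit, mul_comm]

theorem NewLift.card_lt (h : NewLift vs Δ Δ') (hsub : Δ ⊆ Δ') :
    (lifted vs Δ).card < (lifted vs Δ').card := by
  classical
  obtain ⟨low, l, h1, h2, h3⟩ := h
  refine Finset.card_lt_card ⟨fun p hp => ?_, fun hsub' => ?_⟩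
  · rw [lifted, Finset.mem_filter] at hp ⊢
    exact ⟨hp.1, hp.2.mono hsub⟩
  · have : (low, l) ∈ lifted vs Δ := hsub' (by simp [lifted, h3, h1])
    rw [lifted, Finset.mem_filter] at this
    exact h2 this.2

theorem deriv_hypotheses (P : List (Finset (Lit n))) :
    Deriv (fun G => RawLine.clause G ∈ hypotheses P) P := by
  induction P using List.reverseRecOn with
  | nil => exact .nil
  | append_singleton P E ih =>
    rw [hypotheses_concat]
    split
    · next h =>
      refine ih.concat (.inr ?_)
      obtain ⟨r, hr⟩ := Option.isSome_iff_exists.1 h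
      obtain ⟨A, B, hA, hB, hr⟩ := findRes_eq_some hr
      simp only [List.mem_map, Prod.mk.injEq] at hA hB
      obtain ⟨A, hA, rfl, -⟩ := hA
      obtain ⟨B, hB, rfl, -⟩ := hB
      exact ⟨_, A, hA, B, hB, hr⟩
    · exact (ih.mono fun G _ h => List.mem_append_left _ h).concat (.inl (by simp))

/-- The CNF is not part of the input. A line that is no resolvent of earlier lines must be one of
its clauses, so axioms can be recognised from the refutation alone. -/
theorem Deriv.of_mem_hypotheses {ax : Finset (Lit n) → Prop} (h : Deriv ax P)
    {E : Finset (Lit n)} (hE : RawLine.clause E ∈ hypotheses P) : ax E := by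
  induction h with
  | nil => simp [hypotheses] at hE
  | @concat P D h h' ih =>
    rw [hypotheses_concat] at hE
    split at hE
    · exact ih hE
    · next hf =>
      rcases List.mem_append.1 hE with hE | hE
      · exact ih hE
      · simp only [List.mem_singleton, RawLine.clause.injEq] at hE
        subst hE
        refine h'.resolve_right ?_
        rintro ⟨l, A, hA, B, hB, hr⟩
        rw [Bool.not_eq_true, Option.isSome_eq_false_iff, Option.isNone_iff_eq_none,
          findRes_eq_none] at hf
        exact hf (A, none) (List.mem_map.2 ⟨A, hA, rfl⟩) (B, none) (List.mem_map.2 ⟨B, hB, rfl⟩) l hr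

theorem length_allLits (n : ℕ) : (allLits n).length = 2 * n := by
  simp [allLits, mul_comm]

theorem length_passes (n : ℕ) : (passes n).length = (2 * n) * ((2 * n) * (2 * n)) := by
  simp [passes, length_allLits]

/-- As long as the empty clause is out of reach, each pass enlarges the set `lifted`, whose
cardinality is smaller than the number of passes when `n > 0`. -/
theorem zero_mem_translate {π : Equiv.Perm (Fin n)} (hv : Enumerates π vs)
    (hP : ∀ G ∈ P, Consistent G) (hz : ∅ ∈ P) :
    RawLine.clause ∅ ∈ translate vs (levelsOf vs) P := by
  by_contra hcon
  obtain ⟨Δ₀, hΔ₀⟩ : ∃ Δ₀, Δ₀ = allPasses vs (levelsOf vs) P := ⟨_, rfl⟩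
  rw [translate, List.mem_append, not_or, ← hΔ₀] at hcon
  -- At the empty prefix a lift is the clause itself, so a decided variable would let `finish`
  -- derive the empty clause. Hence all variables are undecided for every intermediate `Δ`.
  have hred : ∀ Δ, hypotheses P ⊆ Δ → Δ ⊆ Δ₀ → Reduced [] P Δ := by
    intro Δ h1 h2
    refine ⟨hz, (deriv_hypotheses P).mono fun G hG h => ⟨?_, ?_⟩, hP, fun G hG l hl =>
      ⟨by simp, fun hh => hcon.2 (zero_mem_finish (hh.1.mono h2) (hh.2.mono h2))⟩⟩
    · rintro rfl
      exact hcon.1 (h2 (h1 h))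
    · exact ⟨G, h1 h, by simp [IsLift]⟩
  have hsub : ∀ {α : Type} (ks : List α) Δ,
      Δ ⊆ ks.foldl (fun Δ _ => pass vs (levelsOf vs) P Δ) Δ := by
    intro α ks
    induction ks with
    | nil => exact fun _ => List.Subset.refl _
    | cons k ks ih => exact fun Δ => List.Subset.trans (subset_pass _) (ih _)
  have hcard : ∀ {α : Type} (ks : List α) Δ, hypotheses P ⊆ Δ →
      ks.foldl (fun Δ _ => pass vs (levelsOf vs) P Δ) Δ ⊆ Δ₀ →
      ks.length ≤ (lifted vs (ks.foldl (fun Δ _ => pass vs (levelsOf vs) P Δ) Δ)).card := by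
    intro α ks Δ h1 h2
    induction ks using List.reverseRecOn with
    | nil => simp
    | append_singleton ks k ih =>
      rw [List.foldl_concat] at h2 ⊢
      have h3 := List.Subset.trans (subset_pass _) h2
      have h4 := (newLift_pass hv (hred _ (List.Subset.trans h1 (hsub ks Δ)) h3)).card_lt
        (subset_pass _)
      have h5 := ih h3
      rw [List.length_append, List.length_singleton]
      omega
  have h1 := hcard (passes n) (hypotheses P) (List.Subset.refl _)
    (by rw [hΔ₀]; exact List.Subset.refl _)
  have h2 := h1.trans (card_lifted_le _ _)
  have hlen : vs.length = n := by
    have h3 : vs.toFinset = Finset.univ := Finset.eq_univ_iff_forall.2 fun v => by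
      simpa using hv.mem v
    rw [← List.toFinset_card_of_nodup hv.nodup, h3, Finset.card_univ, Fintype.card_fin]
  rw [length_passes, hlen] at h2
  -- For `n = 0` there are no passes to count, but a reduced refutation is already impossible. For
  -- `n > 0` the count gives `4n² ≤ n + 1`, which is false.
  rcases Nat.eq_zero_or_pos n with rfl | hn
  · refine not_reduced_of_forall_mem (vs := []) (fun v => v.elim0)
      (hred _ (List.Subset.refl _) ?_)
    rw [hΔ₀]
    exact hsub _ _
  · have h3 : 2 * n * (2 * n) ≤ n + 1 := by
      rw [mul_comm (n + 1)] at h2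
      exact Nat.le_of_mul_le_mul_left h2 (by omega)
    nlinarith

end Passes

/-! ### The number of lines -/

section Length
variable {n : ℕ} {Δ : List (RawLine n)} {vs : List (Fin n)} {P : List (Finset (Lit n))}

theorem length_remove_le (S : Finset (Lit n)) (op : List (Fin n) × Lit n) :
    (remove vs Δ S op).1.length ≤ vs.length + 2 := by
  unfold remove
  split
  · cases findLift op.1 {negLit op.2} Δ <;> simp [removalLines, decisionTrail]
  · simp

theorem length_removeAll_le (S : Finset (Lit n)) (ops : List (List (Fin n) × Lit n)) :
    (removeAll vs Δ ops S).1.length ≤ ops.length * (vs.length + 2) := by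
  induction ops generalizing S with
  | nil => simp [removeAll]
  | cons op ops ih =>
    rw [removeAll_cons, List.length_append, List.length_cons, Nat.add_mul]
    have := ih (remove vs Δ S op).2
    have := length_remove_le (vs := vs) (Δ := Δ) S op
    omega

theorem length_removals_le (low low' : List (Fin n)) (y : Fin n) (X : Finset (Lit n)) :
    (removals low low' y X).length ≤ 2 * n + 1 := by
  have := List.length_filter_le (fun l => decide (l ∈ X)) (allLits n)
  rw [length_allLits] at this
  simpa [removals] using this

theorem length_flatMap_le {α β : Type} (l : List α) (f : α → List β) (B : ℕ)
    (h : ∀ x ∈ l, (f x).length ≤ B) : (l.flatMap f).length ≤ l.length * B := by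
  induction l with
  | nil => simp
  | cons x l ih =>
    have := ih fun y hy => h y (List.mem_cons_of_mem _ hy)
    have := h x List.mem_cons_self
    rw [List.flatMap_cons, List.length_append, List.length_cons, Nat.add_mul]
    omega

theorem length_removalStage_le (low low' : List (Fin n)) (y : Fin n) :
    (removalStage vs low low' y P Δ).length ≤ P.length * ((2 * n + 1) * (vs.length + 2)) := by
  refine length_flatMap_le _ _ _ fun G _ => ?_
  cases findLift low G Δ with
  | none => simp
  | some S =>
    exact (length_removeAll_le _ _).trans (Nat.mul_le_mul_right _ (length_removals_le _ _ _ _))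

theorem length_resolutionLines_le (low : List (Fin n)) (E : Finset (Lit n)) (l : Lit n)
    (S T : Finset (Lit n)) : (resolutionLines low E l S T).length ≤ low.length + 2 * n + 3 := by
  have := List.length_filter_le (fun l => decide (l ∈ E)) (allLits n)
  rw [length_allLits] at this
  simp [resolutionLines, propagationTrail]
  omega

theorem length_resolutionStage_le (low low' : List (Fin n)) (X : Finset (Lit n))
    (F P : List (Finset (Lit n))) : (resolutionStage low low' X F P Δ).length ≤
      Δ.length + P.length * (low'.length + 2 * n + 3) := by
  induction P using List.reverseRecOn with
  | nil => simp [resolutionStage]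
  | append_singleton P E ih =>
    rw [resolutionStage_concat, List.length_append, List.length_append, List.length_singleton,
      Nat.add_mul]
    have : (resolveLifts low low' X F (resolutionStage low low' X F P Δ) E).length ≤
        low'.length + 2 * n + 3 := by
      unfold resolveLifts
      split
      · cases findResLifts low X F (resolutionStage low low' X F P Δ) E with
        | none => simp
        | some r => exact length_resolutionLines_le _ _ _ _ _
      · simp
    omega

theorem length_reduce_le (del forb : Finset (Lit n)) (P : List (Finset (Lit n))) :
    (reduce del forb P).length ≤ P.length := by
  refine (List.length_filterMap_le _ _).trans ?_
  rw [← List.length_map (f := Prod.fst), map_fst_reduceTable]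

theorem length_level_fst_le (low : List (Fin n)) (y : Fin n) :
    (level vs low y (P, Δ)).1.length ≤ P.length + 1 := by
  simp only [level, List.length_append, List.length_singleton]
  exact Nat.add_le_add_right ((List.length_filter_le _ _).trans ((length_reduce_le _ _ _).trans
    (length_reduce_le _ _ _))) 1

theorem length_level_snd_le (low : List (Fin n)) (y : Fin n) :
    (level vs low y (P, Δ)).2.length ≤ Δ.length + P.length *
      ((2 * n + 1) * (vs.length + 2) + (low.length + 2 * n + 4)) := by
  have h1 := length_resolutionStage_le (Δ := Δ ++ removalStage vs low (low ++ [y]) y P Δ)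
    low (low ++ [y]) (decided (low ++ [y]) Δ) (firstReduction low y P Δ) (firstReduction low y P Δ)
  have h2 : (firstReduction low y P Δ).length ≤ P.length := length_reduce_le _ _ _
  have h3 := length_removalStage_le (vs := vs) (Δ := Δ) (P := P) low (low ++ [y]) y
  have h4 := Nat.mul_le_mul_right (low.length + 1 + 2 * n + 3) h2
  rw [List.length_append, List.length_append, List.length_singleton] at h1
  rw [Nat.mul_add]
  refine h1.trans ?_
  have e : low.length + 1 + 2 * n + 3 = low.length + 2 * n + 4 := by omega
  rw [e] at h4 ⊢
  omega

/-- A bound for the number of new lines in one pass. -/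
def passBound (n m : ℕ) : ℕ := n * ((m + n) * ((2 * n + 1) * (n + 2) + (3 * n + 4)))

/-- A reduction never lengthens the derivation, so each level adds at most one clause to it, the
final empty one. Thus `P.length + n` bounds its length throughout the pass, and the lines added per
level are bounded uniformly. -/
theorem length_foldl_level_le (hlen : vs.length = n) {l : List (Fin n)} (hl : l <+: vs) :
    ((levelsOf l).foldl (fun s k => level vs k.1 k.2 s) (P, Δ)).1.length ≤ P.length + l.length ∧
    ((levelsOf l).foldl (fun s k => level vs k.1 k.2 s) (P, Δ)).2.length ≤ Δ.length +
      l.length * ((P.length + n) * ((2 * n + 1) * (n + 2) + (3 * n + 4))) := by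
  induction l using List.reverseRecOn with
  | nil => simp [levelsOf]
  | append_singleton l v ih =>
    obtain ⟨h1, h2⟩ := ih ((List.prefix_append _ _).trans hl)
    have hll := hl.length_le
    rw [List.length_append, List.length_singleton, hlen] at hll
    rw [levelsOf_concat, List.foldl_concat, List.length_append, List.length_singleton]
    generalize (levelsOf l).foldl (fun s k => level vs k.1 k.2 s) (P, Δ) = s at *
    obtain ⟨Q, Δ'⟩ := s
    dsimp only at *
    have h3 := length_level_fst_le (vs := vs) (P := Q) (Δ := Δ') l v
    have h4 := length_level_snd_le (vs := vs) (P := Q) (Δ := Δ') l v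
    refine ⟨by omega, h4.trans ?_⟩
    rw [hlen, Nat.add_mul l.length, Nat.one_mul, ← Nat.add_assoc Δ.length]
    exact Nat.add_le_add h2 (Nat.mul_le_mul (by omega) (by omega))

theorem length_pass_le (hlen : vs.length = n) :
    (pass vs (levelsOf vs) P Δ).length ≤ Δ.length + passBound n P.length := by
  have := (length_foldl_level_le (P := P) (Δ := Δ) hlen List.prefix_rfl).2
  rwa [hlen] at this

theorem length_foldl_pass_le (hlen : vs.length = n) {α : Type} (ks : List α) :
    (ks.foldl (fun Δ _ => pass vs (levelsOf vs) P Δ) Δ).length ≤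
      Δ.length + ks.length * passBound n P.length := by
  induction ks generalizing Δ with
  | nil => simp
  | cons k ks ih =>
    rw [List.foldl_cons, List.length_cons, Nat.add_mul]
    have := ih (Δ := pass vs (levelsOf vs) P Δ)
    have := length_pass_le (P := P) (Δ := Δ) hlen
    omega

theorem length_hypotheses_le (P : List (Finset (Lit n))) : (hypotheses P).length ≤ P.length := by
  induction P using List.reverseRecOn with
  | nil => simp [hypotheses]
  | append_singleton P E ih =>
    rw [hypotheses_concat, List.length_append, List.length_singleton]
    split
    · omega
    · rw [List.length_append, List.length_singleton]; omega

theorem length_translate_le (hlen : vs.length = n) :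
    (translate vs (levelsOf vs) P).length ≤ P.length +
      2 * n * (2 * n * (2 * n)) * passBound n P.length + 2 * n * (2 * n + 3) := by
  have h1 := length_foldl_pass_le (P := P) (Δ := hypotheses P) hlen (passes n)
  have h2 := length_hypotheses_le P
  rw [length_passes] at h1
  have h3 : (finish (allPasses vs (levelsOf vs) P)).length ≤ 2 * n * (2 * n + 3) := by
    rw [← length_allLits]
    refine length_flatMap_le _ _ _ fun l _ => ?_
    rw [length_allLits]
    cases findLift [] {l} (allPasses vs (levelsOf vs) P) with
    | none => simp
    | some S =>
      cases findLift [] {negLit l} (allPasses vs (levelsOf vs) P) with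
      | none => simp
      | some T => simpa using length_resolutionLines_le [] ∅ l S T
  rw [translate, List.length_append]
  unfold allPasses at h3 ⊢
  omega

end Length
open SExp

/-! ### The translation runs in polynomial time -/

section Encodings
variable {n : ℕ}

/-- Variables in unary. -/
def encVar (i : Fin n) : SExp := .ofNat i

/-- Literals. -/
def encLit (l : Lit n) : SExp := .cons (encVar l.1) (.ofBool l.2)

/-- Sets of literals by their characteristic vectors. -/
def encSet (S : Finset (Lit n)) : SExp :=
  .ofList (fun i : Fin n =>
    .cons (.ofBool (decide ((i, true) ∈ S))) (.ofBool (decide ((i, false) ∈ S))))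
    (List.finRange n)

/-- Lines, encoded as in `Line.encode`. -/
def RawLine.encode : RawLine n → SExp
  | .clause S => .cons (.ofBool false) (encSet S)
  | .trail t => .cons (.ofBool true) (.ofList Assignment.encode t)

theorem encode_toRaw (L : Line n) : L.toRaw.encode = L.encode := by cases L <;> rfl

theorem encVar_injective : Function.Injective (encVar (n := n)) := fun _ _ h =>
  Fin.ext (ofNat_injective h)

theorem ofList_map {α β : Type} (f : α → β) (eb : β → SExp) (l : List α) :
    ofList eb (l.map f) = ofList (fun x => eb (f x)) l := by
  induction l with
  | nil => rfl
  | cons x l ih => simp [ofList, ih]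

theorem ofList_congr {α : Type} {ea eb : α → SExp} {l : List α} (h : ofList ea l = ofList eb l) :
    ∀ x ∈ l, ea x = eb x := by
  induction l with
  | nil => simp
  | cons x l ih =>
    simp only [ofList, cons.injEq] at h
    intro y hy
    rcases List.mem_cons.1 hy with rfl | hy
    · exact h.1
    · exact ih h.2 y hy

theorem encSet_injective : Function.Injective (encSet (n := n)) := by
  intro S T h
  ext ⟨i, a⟩
  have := ofList_congr h i (List.mem_finRange i)
  simp only [cons.injEq, ofBool_injective.eq_iff, decide_eq_decide] at this
  cases a
  · exact this.2
  · exact this.1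

theorem size_encSet_le (S : Finset (Lit n)) : (encSet S).size ≤ n * 8 + 1 := by
  have := size_ofList_le (B := 7) (fun i : Fin n => SExp.cons (.ofBool (decide ((i, true) ∈ S)))
    (.ofBool (decide ((i, false) ∈ S)))) (l := List.finRange n) (fun i _ => by
      have h1 := size_ofBool_le (decide ((i, true) ∈ S))
      have h2 := size_ofBool_le (decide ((i, false) ∈ S))
      simp only [size]
      omega)
  rwa [List.length_finRange] at this

theorem size_encVar_le (i : Fin n) : (encVar i).size ≤ 2 * n + 1 := by
  rw [encVar, size_ofNat]
  omega

theorem size_encLit_le (l : Lit n) : (encLit l).size ≤ 2 * n + 5 := by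
  have h1 := size_encVar_le l.1
  have h2 := size_ofBool_le l.2
  rw [encLit, size]
  omega

/-- A unary number is the encoding of a list, so it can drive an iteration. -/
theorem ofNat_eq_ofList (k : ℕ) :
    ofNat k = ofList (fun _ : Unit => .nil) (List.replicate k ()) := by
  induction k with
  | zero => rfl
  | succ k ih => rw [List.replicate_succ, ofNat, ofList, ih]

end Encodings

/-- The values of the encoding `ea` are uniformly bounded by a polynomial in the size of the
context. -/
def Small {Γ : Type} {α : Γ → Type} (e : Γ → SExp) (ea : ∀ γ, α γ → SExp) : Prop :=
  ∃ B, PolyB (fun γ => (e γ).size) B ∧ ∀ γ x, (ea γ x).size ≤ B γ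

/-- Eliminates a variable from the context: if its values have uniformly bounded encodings, a bound
that depends on it becomes uniform in it. -/
theorem PolyB.of_ctx {Γ : Type} {α : Γ → Type} {e : Γ → SExp} {ea : ∀ γ, α γ → SExp}
    {f : (Σ γ, α γ) → ℕ} (h : PolyB (fun δ => (ctx e ea δ).size) f) (hs : Small e ea) :
    ∃ B, PolyB (fun γ => (e γ).size) B ∧ ∀ γ x, f ⟨γ, x⟩ ≤ B γ := by
  obtain ⟨c, hc⟩ := h
  obtain ⟨B, hB, hb⟩ := hs
  refine ⟨_, (((PolyB.self.add hB).add (.const 1)).add (.const 2)).pow c, fun γ x => ?_⟩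
  refine (hc ⟨γ, x⟩).trans (Nat.pow_le_pow_left ?_ c)
  have := hb γ x
  simp only [ctx, size]
  omega

/-! ### Polynomial-time operations on literals, clauses and lines -/

namespace PT
set_option linter.unusedVariables false
variable {Γ : Type} {e : Γ → SExp} {N : Γ → ℕ}

section Basic
variable (hn : PT e (fun γ => ofList encVar (List.finRange (N γ))))
include hn

theorem polyB_n : PolyB (fun γ => (e γ).size) N :=
  hn.polyB.mono fun γ => by
    have := length_le_size_ofList (encVar (n := N γ)) (List.finRange (N γ))
    rw [List.length_finRange] at this
    omega

theorem small_encSet : Small e (fun γ => encSet (n := N γ)) :=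
  ⟨_, ((polyB_n hn).mul (.const 8)).add (.const 1), fun γ S => size_encSet_le S⟩

theorem small_encLit : Small e (fun γ => encLit (n := N γ)) :=
  ⟨_, (PolyB.mul (.const 2) (polyB_n hn)).add (.const 5), fun γ S => size_encLit_le S⟩

end Basic

theorem lit {v : ∀ γ, Fin (N γ)} {b : Γ → Bool} (hv : PT e (fun γ => encVar (v γ)))
    (hb : PT e (fun γ => ofBool (b γ))) : PT e (fun γ => encLit (v γ, b γ)) := cons hv hb

theorem lit_fst {l : ∀ γ, Lit (N γ)} (hl : PT e (fun γ => encLit (l γ))) :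
    PT e (fun γ => encVar (l γ).1) := head hl

theorem lit_snd {l : ∀ γ, Lit (N γ)} (hl : PT e (fun γ => encLit (l γ))) :
    PT e (fun γ => ofBool (l γ).2) := tail hl

theorem negLit {l : ∀ γ, Lit (N γ)} (hl : PT e (fun γ => encLit (l γ))) :
    PT e (fun γ => encLit (negLit (l γ))) := lit (lit_fst hl) (not (lit_snd hl))

theorem allLits (hn : PT e (fun γ => ofList encVar (List.finRange (N γ)))) :
    PT e (fun γ => ofList encLit (allLits (N γ))) :=
  flatMap hn (list_cons (lit var true) (list_cons (lit var false) list_nil))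

theorem var_eq {v w : ∀ γ, Fin (N γ)} (hv : PT e (fun γ => encVar (v γ)))
    (hw : PT e (fun γ => encVar (w γ))) : PT e (fun γ => ofBool (decide (v γ = w γ))) :=
  decide_eq (fun γ => encVar_injective) hv hw

theorem contains {low : ∀ γ, List (Fin (N γ))} {v : ∀ γ, Fin (N γ)}
    (hl : PT e (fun γ => ofList encVar (low γ))) (hv : PT e (fun γ => encVar (v γ))) :
    PT e (fun γ => ofBool ((low γ).contains (v γ))) := by
  have := any (p := fun γ w => decide (v γ = w)) hl (var_eq hv.wk var)
  convert this using 3 with γ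
  rw [List.contains_eq_any_beq]
  rfl

/-- The unary index of the variable says how many tails of the characteristic vector to take; the
sign then selects a component of the entry reached. -/
theorem mem {S : ∀ γ, Finset (Lit (N γ))} {l : ∀ γ, Lit (N γ)}
    (hS : PT e (fun γ => encSet (S γ))) (hl : PT e (fun γ => encLit (l γ))) :
    PT e (fun γ => ofBool (decide (l γ ∈ S γ))) := by
  have h1 := lit_fst hl
  simp only [encVar, ofNat_eq_ofList] at h1
  have h2 := foldl (l := fun γ => List.replicate ((l γ).1 : ℕ) ()) (σ := fun _ => SExp)
    (es := fun _ x => x) (s := fun γ => encSet (S γ)) (step := fun _ x _ => x.tail) h1 hS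
    (tail var.wk) hS.polyB (by
      intro γ l₁ l₂ h
      clear h
      have : ∀ (x : SExp), (l₁.foldl (fun x _ => x.tail) x).size ≤ x.size := by
        induction l₁ with
        | nil => intro x; exact le_rfl
        | cons a l₁ ih => intro x; exact le_trans (ih _) x.size_tail_le
      exact this _)
  have h3 := ite (ea := fun _ x => x) (lit_snd hl) (head (head h2)) (tail (head h2))
  have key : ∀ {α : Type} (ea : α → SExp) (m : List α) (k : ℕ) (hk : k < m.length),
      (((List.replicate k ()).foldl (fun x _ => x.tail) (ofList ea m))).head = ea m[k] := by
    intro α ea m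
    induction m with
    | nil => intro k hk; simp at hk
    | cons x m ih =>
      intro k hk
      cases k with
      | zero => rfl
      | succ k =>
        rw [List.replicate_succ, List.foldl_cons]
        exact ih k (by simpa using hk)
  convert h3 using 2 with γ
  rw [encSet, key _ _ _ (by simp)]
  generalize l γ = x
  obtain ⟨i, a⟩ := x
  cases a <;> simp [SExp.head, SExp.tail]

/-- The characteristic vector is computed entry by entry, which reduces every operation on sets to a
membership test. -/
theorem set (hn : PT e (fun γ => ofList encVar (List.finRange (N γ))))
    {F : ∀ γ, Finset (Lit (N γ))}
    (h : PT (ctx e (fun γ => encLit (n := N γ))) (fun δ => ofBool (decide (δ.2 ∈ F δ.1)))) :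
    PT e (fun γ => encSet (F γ)) := by
  have key : ∀ b : Bool, PT (ctx e (fun γ => encVar (n := N γ)))
      (fun δ => ofBool (decide ((δ.2, b) ∈ F δ.1))) := fun b =>
    subst (e' := ctx e (fun γ => encVar (n := N γ)))
      (fun δ => (⟨δ.1, (δ.2, b)⟩ : Σ γ, Lit (N γ))) h (cons base (lit var (const _)))
  have := map (eb := fun _ x => x) (f := fun γ (i : Fin (N γ)) =>
    SExp.cons (ofBool (decide ((i, Bool.true) ∈ F γ))) (ofBool (decide ((i, Bool.false) ∈ F γ))))
    hn (cons (key _) (key _))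
  simp only [ofList_map] at this
  exact this

section Sets
variable (hn : PT e (fun γ => ofList encVar (List.finRange (N γ)))) {S T : ∀ γ, Finset (Lit (N γ))}
  {l : ∀ γ, Lit (N γ)}

theorem set_eq (hS : PT e (fun γ => encSet (S γ))) (hT : PT e (fun γ => encSet (T γ))) :
    PT e (fun γ => ofBool (decide (S γ = T γ))) :=
  decide_eq (fun γ => encSet_injective) hS hT

theorem lit_eq {l m : ∀ γ, Lit (N γ)} (hl : PT e (fun γ => encLit (l γ)))
    (hm : PT e (fun γ => encLit (m γ))) : PT e (fun γ => ofBool (decide (l γ = m γ))) :=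
  decide_eq (ea := fun γ => encLit) (fun γ x y h => by
    simp only [encLit, SExp.cons.injEq, encVar_injective.eq_iff, ofBool_injective.eq_iff] at h
    exact Prod.ext h.1 h.2) hl hm

include hn

theorem set_empty : PT e (fun γ => encSet (∅ : Finset (Lit (N γ)))) := by
  refine set hn ?_
  simp only [Finset.notMem_empty, decide_false]
  exact false

theorem set_singleton (hl : PT e (fun γ => encLit (l γ))) :
    PT e (fun γ => encSet ({l γ} : Finset (Lit (N γ)))) := by
  refine set hn ?_
  simp only [Finset.mem_singleton]
  exact lit_eq var hl.wk

theorem set_erase (hS : PT e (fun γ => encSet (S γ))) (hl : PT e (fun γ => encLit (l γ))) :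
    PT e (fun γ => encSet ((S γ).erase (l γ))) := by
  refine set hn ?_
  simp only [Finset.mem_erase, Bool.decide_and, ne_eq, decide_not]
  exact and (not (lit_eq var hl.wk)) (mem hS.wk var)

theorem set_union (hS : PT e (fun γ => encSet (S γ))) (hT : PT e (fun γ => encSet (T γ))) :
    PT e (fun γ => encSet (S γ ∪ T γ)) := by
  refine set hn ?_
  simp only [Finset.mem_union, Bool.decide_or]
  exact or (mem hS.wk var) (mem hT.wk var)

theorem set_inter (hS : PT e (fun γ => encSet (S γ))) (hT : PT e (fun γ => encSet (T γ))) :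
    PT e (fun γ => encSet (S γ ∩ T γ)) := by
  refine set hn ?_
  simp only [Finset.mem_inter, Bool.decide_and]
  exact and (mem hS.wk var) (mem hT.wk var)

theorem set_sdiff (hS : PT e (fun γ => encSet (S γ))) (hT : PT e (fun γ => encSet (T γ))) :
    PT e (fun γ => encSet (S γ \ T γ)) := by
  refine set hn ?_
  simp only [Finset.mem_sdiff, Bool.decide_and, decide_not]
  exact and (mem hS.wk var) (not (mem hT.wk var))

theorem set_subset (hS : PT e (fun γ => encSet (S γ))) (hT : PT e (fun γ => encSet (T γ))) :
    PT e (fun γ => ofBool (decide (S γ ⊆ T γ))) := by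
  have := set_eq (set_sdiff hn hS hT) (set_empty hn)
  simpa only [Finset.sdiff_eq_empty_iff_subset] using this

end Sets

theorem find {α : Γ → Type} {ea : ∀ γ, α γ → SExp} {l : ∀ γ, List (α γ)} {p : ∀ γ, α γ → Bool}
    (hl : PT e (fun γ => ofList (ea γ) (l γ)))
    (hp : PT (ctx e ea) (fun δ => ofBool (p δ.1 δ.2))) :
    PT e (fun γ => ofOption (ea γ) ((l γ).find? (p γ))) := by
  have := findSome (f := fun γ x => if p γ x then Option.some x else Option.none) hl
    (ite (α := fun δ : (Σ γ, α γ) => Option (α δ.1)) (ea := fun δ => ofOption (ea δ.1)) hp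
      (some (α := fun δ : (Σ γ, α γ) => α δ.1) (ea := fun δ => ea δ.1) var) none)
  convert this using 3 with γ
  induction l γ with
  | nil => rfl
  | cons x l ih => rw [List.find?_cons, List.findSome?_cons, ← ih]; cases p γ x <;> rfl

theorem toList {α : Γ → Type} {ea : ∀ γ, α γ → SExp} {o : ∀ γ, Option (α γ)}
    (h : PT e (fun γ => ofOption (ea γ) (o γ))) : PT e (fun γ => ofList (ea γ) (o γ).toList) := h

theorem asClause {L : ∀ γ, RawLine (N γ)} (h : PT e (fun γ => (L γ).encode)) :
    PT e (fun γ => ofOption encSet (L γ).asClause) := by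
  have hb : PT e (fun γ => ofBool (match L γ with | .clause _ => Bool.false | .trail _ => Bool.true)) := by
    convert head h using 2 with γ
    cases L γ <;> rfl
  have := ite (ea := fun _ x => x) hb nil (cons (tail h) nil)
  convert this using 2 with γ
  cases L γ <;> rfl

theorem clause {S : ∀ γ, Finset (Lit (N γ))} (h : PT e (fun γ => encSet (S γ))) :
    PT e (fun γ => (RawLine.clause (S γ)).encode) := cons false h

theorem trail {t : ∀ γ, List (Assignment (N γ))} (h : PT e (fun γ => ofList Assignment.encode (t γ))) :
    PT e (fun γ => (RawLine.trail (t γ)).encode) := cons true h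

theorem assignment {v : ∀ γ, Fin (N γ)} {b : Γ → Bool} {a : Γ → Ann}
    (hv : PT e (fun γ => encVar (v γ))) (hb : PT e (fun γ => ofBool (b γ)))
    (ha : PT e (fun γ => (a γ).encode)) :
    PT e (fun γ => (⟨v γ, b γ, a γ⟩ : Assignment (N γ)).encode) := cons hv (cons hb ha)

/-! ### Polynomial time for the components of the translation -/

section Algorithm
variable (hn : PT e (fun γ => ofList encVar (List.finRange (N γ))))
  {S T E A B G X del forb : ∀ γ, Finset (Lit (N γ))} {l g : ∀ γ, Lit (N γ)}
  {vs low low' : ∀ γ, List (Fin (N γ))} {Δ : ∀ γ, List (RawLine (N γ))} {y : ∀ γ, Fin (N γ)}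
  {F P : ∀ γ, List (Finset (Lit (N γ)))}
  {ops : ∀ γ, List (List (Fin (N γ)) × Lit (N γ))} {op : ∀ γ, List (Fin (N γ)) × Lit (N γ)}
  {a b : ∀ γ, Option (Finset (Lit (N γ)))}
  {M : ∀ γ, List (Finset (Lit (N γ)) × Option (Finset (Lit (N γ))))}

/-- The encoding of removals. -/
abbrev encOp {n : ℕ} : List (Fin n) × Lit n → SExp := ofProd (ofList encVar) encLit

/-- The encoding of table entries. -/
abbrev encEntry {n : ℕ} : Finset (Lit n) × Option (Finset (Lit n)) → SExp :=
  ofProd encSet (ofOption encSet)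

include hn

theorem posOn (hl : PT e (fun γ => ofList encVar (low γ))) (hS : PT e (fun γ => encSet (S γ))) :
    PT e (fun γ => ofBool (posOn (low γ) (S γ))) :=
  all (allLits hn) (or (not (mem hS.wk var)) (or (not (contains hl.wk (lit_fst var))) (lit_snd var)))

theorem isLift (hl : PT e (fun γ => ofList encVar (low γ))) (hG : PT e (fun γ => encSet (G γ)))
    (hS : PT e (fun γ => encSet (S γ))) : PT e (fun γ => ofBool (isLift (low γ) (G γ) (S γ))) := by
  refine all (allLits hn) (ite (ea := fun _ => ofBool) (contains hl.wk (lit_fst var))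
    (and (not (mem hG.wk var)) (or (not (mem hS.wk var)) (lit_snd var))) ?_)
  exact decide_eq (ea := fun _ => ofBool) (fun _ => ofBool_injective) (mem hS.wk var) (mem hG.wk var)

theorem findLift (hl : PT e (fun γ => ofList encVar (low γ))) (hG : PT e (fun γ => encSet (G γ)))
    (hΔ : PT e (fun γ => ofList RawLine.encode (Δ γ))) :
    PT e (fun γ => ofOption encSet (findLift (low γ) (G γ) (Δ γ))) :=
  find (filterMap hΔ (asClause var)) (isLift hn.wk hl.wk hG.wk var)

theorem isSome_findLift (hl : PT e (fun γ => ofList encVar (low γ)))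
    (hG : PT e (fun γ => encSet (G γ))) (hΔ : PT e (fun γ => ofList RawLine.encode (Δ γ))) :
    PT e (fun γ => ofBool (OrderedCDCL.findLift (low γ) (G γ) (Δ γ)).isSome) :=
  isSome (findLift hn hl hG hΔ)

omit hn in
theorem decisionTrail (hv : PT e (fun γ => ofList encVar (vs γ)))
    (hg : PT e (fun γ => encLit (g γ))) (hS : PT e (fun γ => encSet (S γ))) :
    PT e (fun γ => ofList Assignment.encode (decisionTrail (vs γ) (g γ) (S γ))) :=
  map hv (assignment var (ite (ea := fun _ => ofBool) (var_eq var (lit_fst hg.wk))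
    (not (lit_snd hg.wk)) (mem hS.wk (lit var false))) (const _))

theorem resolventSet (hg : PT e (fun γ => encLit (g γ))) (hS : PT e (fun γ => encSet (S γ)))
    (hT : PT e (fun γ => encSet (T γ))) :
    PT e (fun γ => encSet ((S γ).erase (g γ) ∪ (T γ).erase (OrderedCDCL.negLit (g γ)))) :=
  set_union hn (set_erase hn hS hg) (set_erase hn hT (negLit hg))

theorem removalLines (hv : PT e (fun γ => ofList encVar (vs γ)))
    (hg : PT e (fun γ => encLit (g γ))) (hS : PT e (fun γ => encSet (S γ)))
    (hT : PT e (fun γ => encSet (T γ))) :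
    PT e (fun γ => ofList RawLine.encode (removalLines (vs γ) (g γ) (S γ) (T γ))) :=
  append (map (inits (decisionTrail hv hg (resolventSet hn hg hS hT))) (trail var))
    (singleton (clause (resolventSet hn hg hS hT)))

theorem remove (hv : PT e (fun γ => ofList encVar (vs γ)))
    (hΔ : PT e (fun γ => ofList RawLine.encode (Δ γ))) (hS : PT e (fun γ => encSet (S γ)))
    (hop : PT e (fun γ => encOp (op γ))) :
    PT e (fun γ => ofProd (ofList RawLine.encode) encSet (remove (vs γ) (Δ γ) (S γ) (op γ))) := by
  have h1 : PT e (fun γ => ofList encVar (op γ).1) := fst hop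
  have h2 : PT e (fun γ => encLit (op γ).2) := snd hop
  refine ite (ea := fun γ => ofProd (ofList (RawLine.encode (n := N γ))) encSet)
    (and (mem hS h2) (and (posOn hn h1 hS) (not (contains h1 (lit_fst h2)))))
    (option_elim (findLift hn h1 (set_singleton hn (negLit h2)) hΔ) (prod list_nil hS) ?_)
    (prod list_nil hS)
  exact prod (removalLines hn.wk hv.wk h2.wk hS.wk var) (resolventSet hn.wk h2.wk hS.wk var)

/-- The bound must be uniform in `S`, because `S` is part of the accumulator in `removeAll` and
`foldl_add` asks for an increment independent of the accumulator. -/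
theorem removalLines_bound (hv : PT e (fun γ => ofList encVar (vs γ))) :
    ∃ B, PolyB (fun γ => (e γ).size) B ∧
      ∀ γ g S T, (ofList RawLine.encode (OrderedCDCL.removalLines (vs γ) g S T)).size ≤ B γ := by
  have h := (removalLines (e := ctx (ctx (ctx e (fun γ => encLit (n := N γ)))
    (fun δ => encSet (n := N δ.1))) (fun δ => encSet (n := N δ.1.1)))
    hn.wk.wk.wk hv.wk.wk.wk var.wk.wk var.wk var).polyB
  obtain ⟨B₁, h₁, k₁⟩ := h.of_ctx (small_encSet hn.wk.wk)
  obtain ⟨B₂, h₂, k₂⟩ := h₁.of_ctx (small_encSet hn.wk)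
  obtain ⟨B₃, h₃, k₃⟩ := h₂.of_ctx (small_encLit hn)
  exact ⟨B₃, h₃, fun γ g S T => (k₁ ⟨⟨γ, g⟩, S⟩ T).trans ((k₂ ⟨γ, g⟩ S).trans (k₃ γ g))⟩

theorem removeAll (hv : PT e (fun γ => ofList encVar (vs γ)))
    (hΔ : PT e (fun γ => ofList RawLine.encode (Δ γ)))
    (hops : PT e (fun γ => ofList encOp (ops γ))) (hS : PT e (fun γ => encSet (S γ))) :
    PT e (fun γ => ofProd (ofList RawLine.encode) encSet
      (removeAll (vs γ) (Δ γ) (ops γ) (S γ))) := by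
  obtain ⟨B, hB, hb⟩ := removalLines_bound hn hv
  obtain ⟨B', hB', hb'⟩ := small_encSet hn
  dsimp only at hb'
  have hstep : PT (ctx (ctx e (fun γ => ofProd (ofList (RawLine.encode (n := N γ))) encSet))
      (fun δ => encOp (n := N δ.1))) (fun δ => ofProd (ofList RawLine.encode) encSet
        (OrderedCDCL.remove (vs δ.1.1) (Δ δ.1.1) δ.1.2.2 δ.2)) :=
    remove hn.wk.wk hv.wk.wk hΔ.wk.wk (snd (ea := fun δ => ofList RawLine.encode) var.wk) var
  refine foldl_add (es := fun γ => ofProd (ofList (RawLine.encode (n := N γ))) encSet)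
    hops (prod list_nil hS) (prod (append (fst var.wk) (fst hstep)) (snd hstep))
    ((hB.add hB').add (.const 2)) ?_
  intro γ s op _
  have h1 := size_ofList_append RawLine.encode s.1 (OrderedCDCL.remove (vs γ) (Δ γ) s.2 op).1
  have h2 := hb' γ (OrderedCDCL.remove (vs γ) (Δ γ) s.2 op).2
  have h3 : (ofList RawLine.encode (OrderedCDCL.remove (vs γ) (Δ γ) s.2 op).1).size ≤ B γ + 1 := by
    unfold OrderedCDCL.remove
    split
    · cases OrderedCDCL.findLift op.1 {OrderedCDCL.negLit op.2} (Δ γ) with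
      | none => simp [ofList, size]
      | some T => exact (hb γ _ _ _).trans (Nat.le_succ _)
    · simp [ofList, size]
  simp only [ofProd, size]
  omega

theorem isRes (hl : PT e (fun γ => encLit (l γ))) (hA : PT e (fun γ => encSet (A γ)))
    (hB : PT e (fun γ => encSet (B γ))) (hE : PT e (fun γ => encSet (E γ))) :
    PT e (fun γ => ofBool (isRes (l γ) (A γ) (B γ) (E γ))) :=
  and (mem hA hl) (and (mem hB (negLit hl)) (set_eq hE (resolventSet hn hl hA hB)))

theorem propagationTrail (hlow : PT e (fun γ => ofList encVar (low γ)))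
    (hE : PT e (fun γ => encSet (E γ))) (hl : PT e (fun γ => encLit (l γ))) :
    PT e (fun γ => ofList Assignment.encode (propagationTrail (low γ) (E γ) (l γ))) :=
  append (append (map hlow (assignment var false (const _)))
    (map (filter (allLits hn) (mem hE.wk var))
      (assignment (lit_fst var) (not (lit_snd var)) (const _))))
    (singleton (assignment (lit_fst hl) (lit_snd hl) (const _)))

theorem resolutionLines (hlow : PT e (fun γ => ofList encVar (low γ)))
    (hE : PT e (fun γ => encSet (E γ))) (hl : PT e (fun γ => encLit (l γ)))
    (hS : PT e (fun γ => encSet (S γ))) (hT : PT e (fun γ => encSet (T γ))) :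
    PT e (fun γ => ofList RawLine.encode
      (resolutionLines (low γ) (E γ) (l γ) (S γ) (T γ))) :=
  append (map (inits (propagationTrail hn hlow hE hl)) (trail var))
    (singleton (clause (resolventSet hn hl hS hT)))

theorem pick (hF : PT e (fun γ => ofList encSet (F γ))) :
    PT e (fun γ => ofOption encSet (pick (F γ))) :=
  option_elim (find hF (not (set_eq var (set_empty hn.wk)))) (find hF true) (some var)

omit hn in
theorem candidates (hl : PT e (fun γ => encLit (l γ)))
    (ha : PT e (fun γ => ofOption encSet (a γ))) (hb : PT e (fun γ => ofOption encSet (b γ))) :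
    PT e (fun γ => ofList encSet (candidates (l γ) (a γ) (b γ))) :=
  append (filter (toList ha) (not (mem var hl.wk))) (filter (toList hb) (not (mem var (negLit hl.wk))))

theorem combine (hl : PT e (fun γ => encLit (l γ)))
    (ha : PT e (fun γ => ofOption encSet (a γ))) (hb : PT e (fun γ => ofOption encSet (b γ))) :
    PT e (fun γ => ofOption encSet (combine (l γ) (a γ) (b γ))) :=
  ite (ea := fun γ => ofOption (encSet (n := N γ)))
    (and (option_elim (eb := fun _ => ofBool) ha false (mem var hl.wk))
      (option_elim (eb := fun _ => ofBool) hb false (mem var (negLit hl.wk))))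
    (option_elim ha none (option_elim hb.wk none (some (resolventSet hn.wk.wk hl.wk.wk var.wk var))))
    (pick hn (candidates hl ha hb))

theorem findRes (hM : PT e (fun γ => ofList encEntry (M γ))) (hE : PT e (fun γ => encSet (E γ))) :
    PT e (fun γ => ofOption (ofProd encLit (ofProd (ofOption encSet) (ofOption encSet)))
      (findRes (M γ) (E γ))) := by
  refine findSome hM (findSome hM.wk (findSome (allLits hn.wk.wk) (ite
    (ea := fun δ => ofOption (ofProd encLit (ofProd (ofOption encSet) (ofOption encSet))))
    (isRes hn.wk.wk.wk var (fst var.wk.wk) (fst var.wk) hE.wk.wk.wk) (some ?_) none)))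
  exact prod var (prod (snd var.wk.wk) (snd var.wk))

theorem reduceClause (hd : PT e (fun γ => encSet (del γ))) (hf : PT e (fun γ => encSet (forb γ)))
    (hM : PT e (fun γ => ofList encEntry (M γ))) (hE : PT e (fun γ => encSet (E γ))) :
    PT e (fun γ => ofOption encSet (reduceClause (del γ) (forb γ) (M γ) (E γ))) :=
  option_elim (findRes hn hM hE) (ite (ea := fun γ => ofOption (encSet (n := N γ)))
    (set_eq (set_inter hn hE hf) (set_empty hn)) (some (set_sdiff hn hE hd)) none)
    (combine hn.wk (fst var) (fst (snd var)) (snd (snd var)))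

theorem small_entry : Small e (fun γ => encEntry (n := N γ)) := by
  obtain ⟨B, hB, hb⟩ := small_encSet hn
  dsimp only at hb
  refine ⟨_, (hB.add hB).add (.const 4), fun γ x => ?_⟩
  obtain ⟨S, o⟩ := x
  have h1 := hb γ S
  cases o with
  | none => simp only [encEntry, ofProd, ofOption, Option.toList, ofList, size]; omega
  | some T =>
    have h2 := hb γ T
    simp only [encEntry, ofProd, ofOption, Option.toList, ofList, size]; omega

theorem reduceTable (hd : PT e (fun γ => encSet (del γ))) (hf : PT e (fun γ => encSet (forb γ)))
    (hP : PT e (fun γ => ofList encSet (P γ))) :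
    PT e (fun γ => ofList encEntry (reduceTable (del γ) (forb γ) (P γ))) := by
  obtain ⟨B, hB, hb⟩ := small_entry hn
  dsimp only at hb
  refine foldl_add (es := fun γ => ofList (encEntry (n := N γ))) hP list_nil
    (append var.wk (singleton (prod var (reduceClause hn.wk.wk hd.wk.wk hf.wk.wk var.wk var))))
    (hB.add (.const 2)) ?_
  intro γ s E _
  have h1 := size_ofList_append encEntry s [(E, OrderedCDCL.reduceClause (del γ) (forb γ) s E)]
  have h2 := hb γ (E, OrderedCDCL.reduceClause (del γ) (forb γ) s E)
  simp only [ofList, size] at h1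
  omega

theorem reduce (hd : PT e (fun γ => encSet (del γ))) (hf : PT e (fun γ => encSet (forb γ)))
    (hP : PT e (fun γ => ofList encSet (P γ))) :
    PT e (fun γ => ofList encSet (reduce (del γ) (forb γ) (P γ))) :=
  filterMap (reduceTable hn hd hf hP) (snd var)

theorem decided (hlow : PT e (fun γ => ofList encVar (low γ)))
    (hΔ : PT e (fun γ => ofList RawLine.encode (Δ γ))) :
    PT e (fun γ => encSet (decided (low γ) (Δ γ))) := by
  refine set hn ?_
  simp only [OrderedCDCL.decided, Finset.mem_filter, Finset.mem_univ, true_and, Bool.decide_eq_true]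
  exact and (not (contains hlow.wk (lit_fst var)))
    (and (isSome_findLift hn.wk hlow.wk (set_singleton hn.wk var) hΔ.wk)
      (isSome_findLift hn.wk hlow.wk (set_singleton hn.wk (negLit var)) hΔ.wk))

theorem isConsistent (hE : PT e (fun γ => encSet (E γ))) :
    PT e (fun γ => ofBool (isConsistent (E γ))) :=
  all (allLits hn) (or (not (mem hE.wk var)) (not (mem hE.wk (negLit var))))

theorem findResLifts (hlow : PT e (fun γ => ofList encVar (low γ)))
    (hX : PT e (fun γ => encSet (X γ))) (hF : PT e (fun γ => ofList encSet (F γ)))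
    (hΔ : PT e (fun γ => ofList RawLine.encode (Δ γ))) (hE : PT e (fun γ => encSet (E γ))) :
    PT e (fun γ => ofOption (ofProd encLit (ofProd encSet encSet))
      (findResLifts (low γ) (X γ) (F γ) (Δ γ) (E γ))) := by
  refine findSome hF (findSome hF.wk (findSome (allLits hn.wk.wk) (ite
    (ea := fun δ => ofOption (ofProd encLit (ofProd encSet encSet)))
    (and (isRes hn.wk.wk.wk var var.wk.wk var.wk hE.wk.wk.wk)
      (and (set_subset hn.wk.wk.wk var.wk.wk hX.wk.wk.wk)
        (and (set_subset hn.wk.wk.wk var.wk hX.wk.wk.wk)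
          (and (not (mem hE.wk.wk.wk var)) (not (mem hE.wk.wk.wk (negLit var)))))))
    (option_elim (findLift hn.wk.wk.wk hlow.wk.wk.wk var.wk.wk hΔ.wk.wk.wk) none
      (option_elim (findLift hn.wk.wk.wk.wk hlow.wk.wk.wk.wk var.wk.wk hΔ.wk.wk.wk.wk) none
        (some ?_))) none)))
  exact prod var.wk.wk (prod var.wk var)

theorem resolveLifts (hlow : PT e (fun γ => ofList encVar (low γ)))
    (hlow' : PT e (fun γ => ofList encVar (low' γ)))
    (hX : PT e (fun γ => encSet (X γ))) (hF : PT e (fun γ => ofList encSet (F γ)))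
    (hΔ : PT e (fun γ => ofList RawLine.encode (Δ γ))) (hE : PT e (fun γ => encSet (E γ))) :
    PT e (fun γ => ofList RawLine.encode
      (resolveLifts (low γ) (low' γ) (X γ) (F γ) (Δ γ) (E γ))) :=
  ite (ea := fun γ => ofList (RawLine.encode (n := N γ)))
    (and (set_subset hn hE hX) (isConsistent hn hE))
    (option_elim (findResLifts hn hlow hX hF hΔ hE) list_nil
      (resolutionLines hn.wk hlow'.wk hE.wk (fst var) (fst (snd var)) (snd (snd var)))) list_nil

theorem removals (hlow : PT e (fun γ => ofList encVar (low γ)))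
    (hlow' : PT e (fun γ => ofList encVar (low' γ))) (hy : PT e (fun γ => encVar (y γ)))
    (hX : PT e (fun γ => encSet (X γ))) :
    PT e (fun γ => ofList encOp (removals (low γ) (low' γ) (y γ) (X γ))) :=
  list_cons (prod hlow (lit hy false)) (map (filter (allLits hn) (mem hX.wk var)) (prod hlow'.wk var))

theorem firstReduction (hlow : PT e (fun γ => ofList encVar (low γ)))
    (hy : PT e (fun γ => encVar (y γ))) (hP : PT e (fun γ => ofList encSet (P γ)))
    (hΔ : PT e (fun γ => ofList RawLine.encode (Δ γ))) :
    PT e (fun γ => ofList encSet (firstReduction (low γ) (y γ) (P γ) (Δ γ))) :=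
  have h := isSome_findLift hn hlow (set_singleton hn (lit hy true)) hΔ
  reduce hn (set_singleton hn (lit hy (not h))) (set_singleton hn (lit hy h)) hP

theorem removalStage (hv : PT e (fun γ => ofList encVar (vs γ)))
    (hlow : PT e (fun γ => ofList encVar (low γ))) (hlow' : PT e (fun γ => ofList encVar (low' γ)))
    (hy : PT e (fun γ => encVar (y γ))) (hP : PT e (fun γ => ofList encSet (P γ)))
    (hΔ : PT e (fun γ => ofList RawLine.encode (Δ γ))) :
    PT e (fun γ => ofList RawLine.encode
      (removalStage (vs γ) (low γ) (low' γ) (y γ) (P γ) (Δ γ))) :=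
  flatMap hP (option_elim (findLift hn.wk hlow.wk var hΔ.wk) list_nil
    (fst (removeAll hn.wk.wk hv.wk.wk hΔ.wk.wk
      (removals hn hlow hlow' hy (decided hn hlow' hΔ)).wk.wk var)))

theorem resolutionLines_bound (hlow : PT e (fun γ => ofList encVar (low γ))) :
    ∃ B, PolyB (fun γ => (e γ).size) B ∧ ∀ γ E l S T, (ofList RawLine.encode
      (OrderedCDCL.resolutionLines (low γ) E l S T)).size ≤ B γ := by
  have h := (resolutionLines (e := ctx (ctx (ctx (ctx e (fun γ => encSet (n := N γ)))
    (fun δ => encLit (n := N δ.1))) (fun δ => encSet (n := N δ.1.1)))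
    (fun δ => encSet (n := N δ.1.1.1)))
    hn.wk.wk.wk.wk hlow.wk.wk.wk.wk var.wk.wk.wk var.wk.wk var.wk var).polyB
  obtain ⟨B₁, h₁, k₁⟩ := h.of_ctx (small_encSet hn.wk.wk.wk)
  obtain ⟨B₂, h₂, k₂⟩ := h₁.of_ctx (small_encSet hn.wk.wk)
  obtain ⟨B₃, h₃, k₃⟩ := h₂.of_ctx (small_encLit hn.wk)
  obtain ⟨B₄, h₄, k₄⟩ := h₃.of_ctx (small_encSet hn)
  exact ⟨B₄, h₄, fun γ E l S T => (k₁ ⟨⟨⟨γ, E⟩, l⟩, S⟩ T).trans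
    ((k₂ ⟨⟨γ, E⟩, l⟩ S).trans ((k₃ ⟨γ, E⟩ l).trans (k₄ γ E)))⟩

theorem resolutionStage (hlow : PT e (fun γ => ofList encVar (low γ)))
    (hlow' : PT e (fun γ => ofList encVar (low' γ)))
    (hX : PT e (fun γ => encSet (X γ))) (hF : PT e (fun γ => ofList encSet (F γ)))
    (hP : PT e (fun γ => ofList encSet (P γ)))
    (hΔ : PT e (fun γ => ofList RawLine.encode (Δ γ))) :
    PT e (fun γ => ofList RawLine.encode
      (resolutionStage (low γ) (low' γ) (X γ) (F γ) (P γ) (Δ γ))) := by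
  obtain ⟨B, hB, hb⟩ := resolutionLines_bound hn hlow'
  refine foldl_add (es := fun γ => ofList (RawLine.encode (n := N γ))) hP hΔ
    (append var.wk (resolveLifts hn.wk.wk hlow.wk.wk hlow'.wk.wk hX.wk.wk hF.wk.wk var.wk var))
    (hB.add (.const 1)) ?_
  intro γ s E _
  have h1 := size_ofList_append RawLine.encode s
    (OrderedCDCL.resolveLifts (low γ) (low' γ) (X γ) (F γ) s E)
  have h2 : (ofList RawLine.encode (OrderedCDCL.resolveLifts (low γ) (low' γ) (X γ) (F γ) s E)).size
      ≤ B γ + 1 := by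
    unfold OrderedCDCL.resolveLifts
    split
    · cases OrderedCDCL.findResLifts (low γ) (X γ) (F γ) s E with
      | none => simp [ofList, size]
      | some r => exact (hb γ _ _ _ _).trans (Nat.le_succ _)
    · simp [ofList, size]
  omega

theorem level {s : ∀ γ, List (Finset (Lit (N γ))) × List (RawLine (N γ))}
    (hv : PT e (fun γ => ofList encVar (vs γ)))
    (hlow : PT e (fun γ => ofList encVar (low γ))) (hy : PT e (fun γ => encVar (y γ)))
    (hs : PT e (fun γ => ofProd (ofList encSet) (ofList RawLine.encode) (s γ))) :
    PT e (fun γ => ofProd (ofList encSet) (ofList RawLine.encode)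
      (level (vs γ) (low γ) (y γ) (s γ))) :=
  have hP : PT e (fun γ => ofList encSet (s γ).1) := fst hs
  have hΔ : PT e (fun γ => ofList RawLine.encode (s γ).2) := snd hs
  have hlow' : PT e (fun γ => ofList encVar (low γ ++ [y γ])) := append hlow (singleton hy)
  have hX := decided hn hlow' hΔ
  have hF := firstReduction hn hlow hy hP hΔ
  prod (append (filter (reduce hn hX (set_empty hn) hF) (not (set_eq var (set_empty hn.wk))))
      (singleton (set_empty hn)))
    (resolutionStage hn hlow hlow' hX hF hF (append hΔ (removalStage hn hv hlow hlow' hy hP hΔ)))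

end Algorithm
end PT
open SExp

/-! ### Size bounds for derivations and levels -/

section Sizes
variable {n : ℕ} {π : Equiv.Perm (Fin n)} {τ : CNF n} {Δ : List (RawLine n)}

theorem Assignment.size_encode_le (x : Assignment n) : x.encode.size ≤ 2 * n + 9 := by
  have h1 := size_encVar_le x.var
  have h2 := size_ofBool_le x.val
  have h3 : x.ann.encode.size ≤ 3 := by
    generalize x.ann = a
    cases a <;> simp [Ann.encode, ofBool, size]
  rw [encVar] at h1
  simp only [Assignment.encode, size]
  omega

theorem Line.size_encode_le (L : Line n) : L.encode.size ≤ n * (2 * n + 10) + n * 8 + 6 := by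
  cases L with
  | clause C =>
    have h1 := size_encSet_le C.lits
    have h2 := size_ofBool_le false
    change (SExp.cons (ofBool false) (encSet C.lits)).size ≤ _
    simp only [size]
    omega
  | trail t =>
    have h1 : (ofList Assignment.encode t.list).size ≤ t.list.length * (2 * n + 10) + 1 :=
      size_ofList_le Assignment.encode fun x _ => x.size_encode_le
    have h2 := size_ofBool_le true
    have h3 : t.list.length ≤ n := by
      have := t.nodup.length_le_card
      simpa using this
    have h4 := Nat.mul_le_mul_right (2 * n + 10) h3
    change (SExp.cons (ofBool true) (ofList Assignment.encode t.list)).size ≤ _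
    simp only [size]
    omega

/-- The variables of a genuine trail are distinct, so each line has size polynomial in `n`. Bounding
the number of lines therefore bounds the size of the derivation. -/
theorem Good.size_le (h : Good π τ Δ) :
    (ofList RawLine.encode Δ).size ≤ Δ.length * (n * (2 * n + 10) + n * 8 + 6 + 1) + 1 := by
  obtain ⟨L, rfl, -⟩ := h
  rw [ofList_map, List.length_map]
  exact size_ofList_le _ fun x _ => by rw [encode_toRaw]; exact x.size_encode_le

theorem size_ofList_encSet_le (P : List (Finset (Lit n))) :
    (ofList encSet P).size ≤ P.length * (n * 8 + 1 + 1) + 1 :=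
  size_ofList_le _ fun S _ => size_encSet_le S

theorem levelsOf_prefix {l vs : List (Fin n)} (h : l <+: vs) : levelsOf l <+: levelsOf vs := by
  obtain ⟨m, rfl⟩ := h
  induction m using List.reverseRecOn with
  | nil => simp
  | append_singleton m v ih =>
    rw [← List.append_assoc, levelsOf_concat]
    exact ih.trans (List.prefix_append _ _)

/-- Turns an initial part of the iteration over the levels into the iteration for a prefix of `vs`,
where the bounds on lengths apply. -/
theorem exists_of_prefix_levelsOf {vs : List (Fin n)} {ks : List (List (Fin n) × Fin n)}
    (h : ks <+: levelsOf vs) : ∃ l, l <+: vs ∧ ks = levelsOf l := by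
  have hlen := h.length_le
  rw [length_levelsOf] at hlen
  refine ⟨vs.take ks.length, List.take_prefix _ _, ?_⟩
  have h1 := levelsOf_prefix (List.take_prefix ks.length vs)
  have h2 : (levelsOf (vs.take ks.length)).length = ks.length := by
    rw [length_levelsOf, List.length_take]
    omega
  exact (List.prefix_of_prefix_length_le h h1 h2.ge).eq_of_length h2.symm

end Sizes

/-! ### Polynomial time for the iterated passes -/

namespace PT
set_option linter.unusedVariables false
variable {Γ : Type} {e : Γ → SExp} {N : Γ → ℕ}

theorem zipIdx {α : Γ → Type} {ea : ∀ γ, α γ → SExp} {l : ∀ γ, List (α γ)}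
    (hl : PT e (fun γ => ofList (ea γ) (l γ))) :
    PT e (fun γ => ofList (ofProd (ea γ) ofNat) (l γ).zipIdx) := by
  have key : ∀ γ (m : List (α γ)), m.foldl (fun (s : ℕ × List (α γ × ℕ)) x =>
      (s.1 + 1, s.2 ++ [(x, s.1)])) (0, []) = (m.length, m.zipIdx) := by
    intro γ m
    induction m using List.reverseRecOn with
    | nil => rfl
    | append_singleton m x ih => rw [List.foldl_concat, ih]; simp [List.zipIdx_append]
  have h := foldl (l := l) (es := fun γ => ofProd ofNat (ofList (ofProd (ea γ) ofNat)))
    (s := fun _ => (0, [])) (step := fun γ s x => (s.1 + 1, s.2 ++ [(x, s.1)]))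
    (B := fun γ => (2 * (ofList (ea γ) (l γ)).size + 1) + ((ofList (ea γ) (l γ)).size *
      ((ofList (ea γ) (l γ)).size + (2 * (ofList (ea γ) (l γ)).size + 1) + 1 + 1) + 1) + 1) hl
    (const (.cons .nil .nil)) ?_ ?_ ?_
  · simp only [key] at h
    exact snd (ea := fun _ => ofNat) h
  · have h1 : PT (ctx (ctx e (fun γ => ofProd ofNat (ofList (ofProd (ea γ) ofNat))))
        (fun δ => ea δ.1)) (fun δ => ofNat δ.1.2.1) :=
      fst (ea := fun _ => ofNat) var.wk
    have h2 : PT (ctx (ctx e (fun γ => ofProd ofNat (ofList (ofProd (ea γ) ofNat))))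
        (fun δ => ea δ.1)) (fun δ => ofNat (δ.1.2.1 + 1)) := cons nil h1
    have h3 : PT (ctx (ctx e (fun γ => ofProd ofNat (ofList (ofProd (ea γ) ofNat))))
        (fun δ => ea δ.1)) (fun δ => ofList (ofProd (ea δ.1.1) ofNat) δ.1.2.2) :=
      snd (ea := fun _ => ofNat) var.wk
    have h4 : PT (ctx (ctx e (fun γ => ofProd ofNat (ofList (ofProd (ea γ) ofNat))))
        (fun δ => ea δ.1)) (fun δ => ofProd (ea δ.1.1) ofNat (δ.2, δ.1.2.1)) := cons var h1
    exact cons h2 (append h3 (singleton h4))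
  · have h1 := hl.polyB
    have h2 := ((PolyB.mul (.const 2) h1).add (.const 1))
    exact (h2.add ((h1.mul (((h1.add h2).add (.const 1)).add (.const 1))).add (.const 1))).add
      (.const 1)
  · intro γ l₁ l₂ h
    rw [key]
    have h1 := length_le_size_ofList (ea γ) (l γ)
    have h2 : l₁.length ≤ (l γ).length := by rw [h, List.length_append]; omega
    have h3 := size_ofNat l₁.length
    have h4 : (ofList (ofProd (ea γ) ofNat) l₁.zipIdx).size ≤ l₁.zipIdx.length *
        (((ofList (ea γ) (l γ)).size + (2 * (ofList (ea γ) (l γ)).size + 1) + 1) + 1) + 1 := by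
      refine size_ofList_le _ fun p hp => ?_
      obtain ⟨x, i⟩ := p
      have h5 := List.mem_zipIdx hp
      have h6 : x ∈ l γ := by
        rw [h, h5.2.2]
        exact List.mem_append_left _ (List.getElem_mem _)
      have h7 := size_le_size_ofList (ea γ) h6
      have h8 := size_ofNat i
      simp only [ofProd, size]
      omega
    have h9 := h4.trans (Nat.add_le_add_right (Nat.mul_le_mul_right _
      (show l₁.zipIdx.length ≤ (ofList (ea γ) (l γ)).size by rw [List.length_zipIdx]; omega)) 1)
    simp only [ofProd, size] at h9 ⊢
    omega

theorem levelsOf {vs : ∀ γ, List (Fin (N γ))} (hv : PT e (fun γ => ofList encVar (vs γ))) :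
    PT e (fun γ => ofList (ofProd (ofList encVar) encVar) (levelsOf (vs γ))) := by
  let es : ∀ γ, List (Fin (N γ)) × List (List (Fin (N γ)) × Fin (N γ)) → SExp := fun γ =>
    ofProd (ofList encVar) (ofList (ofProd (ofList encVar) encVar))
  have h := foldl (l := vs) (es := es)
    (s := fun _ => ([], [])) (step := fun γ s v => (s.1 ++ [v], s.2 ++ [(s.1, v)]))
    (B := fun γ => (ofList encVar (vs γ)).size + ((ofList encVar (vs γ)).size *
      (((ofList encVar (vs γ)).size + (ofList encVar (vs γ)).size + 1) + 1) + 1) + 1) hv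
    (const (.cons .nil .nil)) ?_ ?_ ?_
  · simp only [levelsOf_fold] at h
    exact tail h
  · have h0 : PT (ctx (ctx e es) (fun δ => encVar (n := N δ.1))) (fun δ => es δ.1.1 δ.1.2) :=
      var.wk
    have h1 : PT (ctx (ctx e es) (fun δ => encVar (n := N δ.1)))
        (fun δ => ofList encVar δ.1.2.1) := head h0
    have h2 : PT (ctx (ctx e es) (fun δ => encVar (n := N δ.1)))
        (fun δ => ofList (ofProd (ofList encVar) encVar) δ.1.2.2) := tail h0
    have h3 : PT (ctx (ctx e es) (fun δ => encVar (n := N δ.1))) (fun δ => encVar δ.2) := var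
    have h4 : PT (ctx (ctx e es) (fun δ => encVar (n := N δ.1)))
        (fun δ => ofProd (ofList encVar) encVar (δ.1.2.1, δ.2)) := cons h1 h3
    exact cons (append h1 (singleton h3)) (append h2 (singleton h4))
  · have h1 := hv.polyB
    exact (h1.add ((h1.mul (((h1.add h1).add (.const 1)).add (.const 1))).add (.const 1))).add
      (.const 1)
  · intro γ l₁ l₂ h
    rw [levelsOf_fold]
    have hs : ∀ l : List (Fin (N γ)), l <+: vs γ →
        (ofList encVar l).size ≤ (ofList encVar (vs γ)).size := by
      rintro l ⟨m, hm⟩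
      have h1 := size_ofList_append encVar l m
      have h2 := (ofList encVar m).one_le_size
      rw [hm] at h1
      omega
    have h1 := hs l₁ ⟨l₂, h.symm⟩
    have h2 := length_le_size_ofList encVar (vs γ)
    have h3 : l₁.length ≤ (vs γ).length := by rw [h, List.length_append]; omega
    have h4 : (ofList (ofProd (ofList encVar) encVar) (OrderedCDCL.levelsOf l₁)).size ≤
        (OrderedCDCL.levelsOf l₁).length *
          (((ofList encVar (vs γ)).size + (ofList encVar (vs γ)).size + 1) + 1) + 1 := by
      refine size_ofList_le _ fun p hp => ?_
      have h5 := isLevels_levelsOf (vs := vs γ) ⟨l₂, h.symm⟩ p hp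
      have h6 := hs p.1 ((List.prefix_append _ _).trans h5)
      have h7 := size_le_size_ofList encVar (h5.subset (show p.2 ∈ p.1 ++ [p.2] by simp))
      simp only [ofProd, size]
      omega
    have h9 := h4.trans (Nat.add_le_add_right (Nat.mul_le_mul_right _
      (show (OrderedCDCL.levelsOf l₁).length ≤ (ofList encVar (vs γ)).size by
        rw [length_levelsOf]; omega)) 1)
    simp only [es, ofProd, size] at h9 ⊢
    omega

theorem hypotheses (hn : PT e (fun γ => ofList encVar (List.finRange (N γ))))
    {P : ∀ γ, List (Finset (Lit (N γ)))} (hP : PT e (fun γ => ofList encSet (P γ))) :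
    PT e (fun γ => ofList RawLine.encode (hypotheses (P γ))) := by
  have hf : PT (ctx (ctx e (fun γ => ofProd (ofList (encEntry (n := N γ)))
      (ofList (RawLine.encode (n := N γ))))) (fun δ => encSet (n := N δ.1)))
      (fun δ => ofList encEntry δ.1.2.1) := fst (eb := fun δ => ofList RawLine.encode) var.wk
  have hs : PT (ctx (ctx e (fun γ => ofProd (ofList (encEntry (n := N γ)))
      (ofList (RawLine.encode (n := N γ))))) (fun δ => encSet (n := N δ.1)))
      (fun δ => ofList RawLine.encode δ.1.2.2) := snd (ea := fun δ => ofList encEntry) var.wk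
  refine snd (ea := fun γ => ofList encEntry) (eb := fun γ => ofList RawLine.encode)
    (foldl_add (es := fun γ => ofProd (ofList (encEntry (n := N γ)))
      (ofList (RawLine.encode (n := N γ)))) hP (const (.cons .nil .nil)) ?_
      ((((polyB_n hn).mul (.const 8)).add (.const 5)).add
        (((polyB_n hn).mul (.const 8)).add (.const 10))) ?_)
  · refine prod (append hf (singleton (prod var none)))
      (ite (ea := fun δ => ofList RawLine.encode)
        (isSome (findRes hn.wk.wk hf var)) hs (append hs (singleton (clause var))))
  · intro γ s E _
    have h1 := size_ofList_append encEntry s.1 [(E, Option.none)]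
    have h2 := size_ofList_append RawLine.encode s.2 [RawLine.clause E]
    have h3 := size_encSet_le E
    simp only [ofList, size, encEntry, ofProd, ofOption, Option.toList, RawLine.encode, ofBool]
      at h1 h2 ⊢
    split <;> omega

theorem finish (hn : PT e (fun γ => ofList encVar (List.finRange (N γ))))
    {Δ : ∀ γ, List (RawLine (N γ))} (hΔ : PT e (fun γ => ofList RawLine.encode (Δ γ))) :
    PT e (fun γ => ofList RawLine.encode (finish (Δ γ))) :=
  flatMap (allLits hn) (option_elim (findLift hn.wk list_nil (set_singleton hn.wk var) hΔ.wk)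
    list_nil (option_elim (findLift hn.wk.wk list_nil (set_singleton hn.wk.wk (negLit var.wk))
      hΔ.wk.wk) list_nil (resolutionLines hn.wk.wk.wk list_nil (set_empty hn.wk.wk.wk) var.wk.wk
        var.wk var)))

theorem passes (hn : PT e (fun γ => ofList encVar (List.finRange (N γ)))) :
    PT e (fun γ => ofList encLit (passes (N γ))) :=
  flatMap (allLits hn) (flatMap (allLits hn.wk) (allLits hn.wk.wk))

/-- The passes, for a derivation of which all clauses are in `τ`. -/
theorem allPasses {π : ∀ γ, Equiv.Perm (Fin (N γ))} {τ : ∀ γ, CNF (N γ)}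
    {vs : ∀ γ, List (Fin (N γ))} {P : ∀ γ, List (Finset (Lit (N γ)))}
    (hn : PT e (fun γ => ofList encVar (List.finRange (N γ))))
    (hv : PT e (fun γ => ofList encVar (vs γ))) (hP : PT e (fun γ => ofList encSet (P γ)))
    (hvs : ∀ γ, Enumerates (π γ) (vs γ)) (hlen : ∀ γ, (vs γ).length = N γ)
    (hPτ : ∀ γ, ∀ E ∈ P γ, ∃ C ∈ τ γ, C.lits = E) :
    PT e (fun γ => ofList RawLine.encode
      (allPasses (vs γ) (OrderedCDCL.levelsOf (vs γ)) (P γ))) := by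
  have hgood : ∀ γ, Good (π γ) (τ γ) (OrderedCDCL.hypotheses (P γ)) := fun γ =>
    Good.hypotheses fun E hE => (Deriv.of_mem_hypotheses (ax := fun E => E ∈ P γ)
      ((deriv_hypotheses (P γ)).mono fun E hE _ => hE) hE |> hPτ γ E)
  have hlv : ∀ γ, IsLevels (vs γ) (OrderedCDCL.levelsOf (vs γ)) := fun γ =>
    isLevels_levelsOf List.prefix_rfl
  have hN := polyB_n hn
  have hK : PolyB (fun γ => (e γ).size) (fun γ => N γ * (2 * N γ + 10) + N γ * 8 + 6 + 1) :=
    (((hN.mul ((PolyB.mul (.const 2) hN).add (.const 10))).add (hN.mul (.const 8))).add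
      (.const 6)).add (.const 1)
  have hPl : PolyB (fun γ => (e γ).size) (fun γ => (P γ).length) :=
    hP.polyB.mono fun γ => by have := length_le_size_ofList encSet (P γ); omega
  have hpb : PolyB (fun γ => (e γ).size) (fun γ => passBound (N γ) (P γ).length) :=
    hN.mul ((hPl.add hN).mul (((((PolyB.mul (.const 2) hN).add (.const 1)).mul
      (hN.add (.const 2)))).add ((PolyB.mul (.const 3) hN).add (.const 4))))
  -- The accumulator ranges over valid derivations only. Then `Good.size_le` and the count of lines
  -- bound every intermediate result directly, instead of compounding one polynomial per pass.
  let es : ∀ γ, {Δ : List (RawLine (N γ)) // Good (π γ) (τ γ) Δ} → SExp := fun γ Δ =>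
    ofList RawLine.encode Δ.1
  have hpass : PT (ctx e es) (fun δ => ofList RawLine.encode
      (pass (vs δ.1) (OrderedCDCL.levelsOf (vs δ.1)) (P δ.1) δ.2.1)) := by
    have hΔ : PT (ctx e es) (fun δ => ofList RawLine.encode δ.2.1) := var
    have wkB : ∀ {f : Γ → ℕ}, PolyB (fun γ => (e γ).size) f →
        PolyB (fun δ : (Σ γ, {Δ : List (RawLine (N γ)) // Good (π γ) (τ γ) Δ}) =>
          (ctx e es δ).size) (fun δ => f δ.1) := by
      rintro f ⟨c, hc⟩
      refine ⟨c, fun δ => (hc δ.1).trans (Nat.pow_le_pow_left ?_ c)⟩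
      simp only [ctx, size]
      omega
    have hΔl : PolyB (fun δ => (ctx e es δ).size) (fun δ => δ.2.1.length) :=
      hΔ.polyB.mono fun δ => by
        have := length_le_size_ofList RawLine.encode δ.2.1
        omega
    refine snd (ea := fun δ : (Σ γ, {Δ : List (RawLine (N γ)) // Good (π γ) (τ γ) Δ}) =>
        ofList (encSet (n := N δ.1)))
      (eb := fun δ => ofList (RawLine.encode (n := N δ.1)))
      (foldl (es := fun δ : (Σ γ, {Δ : List (RawLine (N γ)) // Good (π γ) (τ γ) Δ}) =>
        ofProd (ofList (encSet (n := N δ.1))) (ofList (RawLine.encode (n := N δ.1))))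
        (levelsOf hv).wk (prod hP.wk hΔ)
        (B := fun δ => (((P δ.1).length + N δ.1) * (N δ.1 * 8 + 1 + 1) + 1) +
          ((δ.2.1.length + passBound (N δ.1) (P δ.1).length) *
            (N δ.1 * (2 * N δ.1 + 10) + N δ.1 * 8 + 6 + 1) + 1) + 1) ?_ ?_ ?_)
    · exact level hn.wk.wk.wk hv.wk.wk.wk (fst (eb := fun _ => encVar) var)
        (snd (ea := fun _ => ofList encVar) var) var.wk
    · exact ((wkB (((hPl.add hN).mul (((hN.mul (.const 8)).add (.const 1)).add (.const 1))).add
        (.const 1))).add (((hΔl.add (wkB hpb)).mul (wkB hK)).add (.const 1))).add (.const 1)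
    · intro δ l₁ l₂ h
      obtain ⟨l, hl, rfl⟩ := exists_of_prefix_levelsOf (vs := vs δ.1) ⟨l₂, h.symm⟩
      obtain ⟨h1, h2⟩ := length_foldl_level_le (P := P δ.1) (Δ := δ.2.1) (hlen δ.1) hl
      have h3 := (foldl_level_spec (hvs δ.1) (isLevels_levelsOf hl) δ.2.2 (P δ.1)).1.size_le
      have h4 : l.length ≤ N δ.1 := hl.length_le.trans (hlen δ.1).le
      have h5 := size_ofList_encSet_le ((OrderedCDCL.levelsOf l).foldl
        (fun s k => OrderedCDCL.level (vs δ.1) k.1 k.2 s) (P δ.1, δ.2.1)).1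
      have h6 := h5.trans (Nat.add_le_add_right (Nat.mul_le_mul_right _
        (h1.trans (Nat.add_le_add_left h4 _))) 1)
      have h7 := h3.trans (Nat.add_le_add_right (Nat.mul_le_mul_right _ (h2.trans
        (Nat.add_le_add_left (Nat.mul_le_mul_right _ h4) _))) 1)
      exact Nat.add_le_add_right (Nat.add_le_add h6 h7) 1
  have hfold : ∀ γ (ks : List (Lit (N γ))), (ks.foldl
      (fun (Δ : {Δ : List (RawLine (N γ)) // Good (π γ) (τ γ) Δ}) _ =>
        (⟨pass (vs γ) (OrderedCDCL.levelsOf (vs γ)) (P γ) Δ.1,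
          Δ.2.pass (hvs γ) (hlv γ) (P γ)⟩ : {Δ : List (RawLine (N γ)) // Good (π γ) (τ γ) Δ}))
      ⟨OrderedCDCL.hypotheses (P γ), hgood γ⟩).1 =
      ks.foldl (fun Δ _ => pass (vs γ) (OrderedCDCL.levelsOf (vs γ)) (P γ) Δ)
        (OrderedCDCL.hypotheses (P γ)) := by
    intro γ ks
    induction ks using List.reverseRecOn with
    | nil => rfl
    | append_singleton ks k ih =>
      rw [List.foldl_concat, List.foldl_concat]
      exact congrArg (pass (vs γ) (OrderedCDCL.levelsOf (vs γ)) (P γ)) ih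
  have := foldl (es := es) (s := fun γ => ⟨OrderedCDCL.hypotheses (P γ), hgood γ⟩)
    (step := fun γ Δ _ => ⟨pass (vs γ) (OrderedCDCL.levelsOf (vs γ)) (P γ) Δ.1,
      Δ.2.pass (hvs γ) (hlv γ) (P γ)⟩)
    (B := fun γ => ((P γ).length + 2 * N γ * (2 * N γ * (2 * N γ)) *
      passBound (N γ) (P γ).length) * (N γ * (2 * N γ + 10) + N γ * 8 + 6 + 1) + 1)
    (passes hn) (hypotheses hn hP) ?_ ?_ ?_
  · simp only [es, hfold] at this
    exact this
  · exact hpass.wk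
  · have h2N := PolyB.mul (.const 2) hN
    exact ((hPl.add ((h2N.mul (h2N.mul h2N)).mul hpb)).mul hK).add (.const 1)
  · intro γ l₁ l₂ h
    simp only [es, hfold]
    have h1 := length_foldl_pass_le (P := P γ) (Δ := OrderedCDCL.hypotheses (P γ)) (hlen γ) l₁
    have h2 := ((hgood γ).foldl_pass (hvs γ) (hlv γ) (P γ) l₁).size_le
    have h3 := length_hypotheses_le (P γ)
    have h4 : l₁.length ≤ 2 * N γ * (2 * N γ * (2 * N γ)) := by
      rw [← length_passes, h, List.length_append]
      omega
    refine h2.trans (Nat.add_le_add_right (Nat.mul_le_mul_right _ (h1.trans ?_)) 1)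
    exact Nat.add_le_add h3 (Nat.mul_le_mul_right _ h4)

end PT
open SExp

/-! ### The two simulations -/

section Order
variable {n : ℕ}

theorem zipIdx_map_finRange {α : Type} (f : Fin n → α) :
    ((List.finRange n).map f).zipIdx = (List.finRange n).map fun i => (f i, (i : ℕ)) := by
  refine List.ext_getElem (by simp) fun k h1 h2 => ?_
  simp

/-- Inverts the permutation by search: the variable of rank `r` is the unique position at which the
list of ranks has the entry `r`. -/
theorem flatMap_filter_zipIdx (π : Equiv.Perm (Fin n)) :
    ((List.finRange n).flatMap fun r => ((((List.finRange n).map π).zipIdx).filter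
      fun p => decide (p.1 = r)).map Prod.snd) =
      ((List.finRange n).map π.symm).map Fin.val := by
  rw [zipIdx_map_finRange, List.map_map, List.map_eq_flatMap (f := Fin.val ∘ π.symm)]
  congr 1
  funext r
  rw [List.filter_map, List.map_map]
  have h1 : ((fun p : Fin n × ℕ => decide (p.1 = r)) ∘ fun i : Fin n => (π i, (i : ℕ))) =
      fun i => decide (i = π.symm r) := by
    funext i
    simp [Equiv.eq_symm_apply]
  have h2 : (List.finRange n).filter (fun i => decide (i = π.symm r)) = [π.symm r] := by
    refine (List.filter_beq (π.symm r)).trans ?_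
    rw [List.count_eq_one_of_mem (List.nodup_finRange n) (List.mem_finRange _)]
    rfl
  rw [h1, h2]
  rfl

theorem encodeOrder_eq (π : Equiv.Perm (Fin n)) :
    encodeOrder π = ofList encVar ((List.finRange n).map π) := by
  rw [ofList_map]
  rfl

theorem ofList_encVar (l : List (Fin n)) :
    ofList encVar l = ofList ofNat (l.map Fin.val) := by
  rw [ofList_map]
  rfl

end Order

namespace PT
set_option linter.unusedVariables false
variable {Γ : Type} {e : Γ → SExp} {N : Γ → ℕ} {π : ∀ γ, Equiv.Perm (Fin (N γ))}

theorem order_zipIdx (h : PT e (fun γ => encodeOrder (π γ))) :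
    PT e (fun γ => ofList (ofProd encVar ofNat) ((List.finRange (N γ)).map (π γ)).zipIdx) := by
  simp only [encodeOrder_eq] at h
  exact zipIdx h

/-- The number of variables is given only implicitly, as the length of the encoded order; the
positions in that list are the variables. -/
theorem finRange (h : PT e (fun γ => encodeOrder (π γ))) :
    PT e (fun γ => ofList encVar (List.finRange (N γ))) := by
  have := map (ea := fun _ => ofProd encVar ofNat) (eb := fun _ => ofNat)
    (f := fun _ p => p.2) (order_zipIdx h) (snd (ea := fun _ => encVar) var)
  convert this using 2 with γ
  rw [ofList_encVar, zipIdx_map_finRange, List.map_map]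
  rfl

theorem enumeration (h : PT e (fun γ => encodeOrder (π γ))) :
    PT e (fun γ => ofList encVar ((List.finRange (N γ)).map (π γ).symm)) := by
  let e₁ : (Σ γ, Fin (N γ)) → SExp := ctx e (fun γ => encVar)
  let ep : ∀ δ : (Σ γ, Fin (N γ)), Fin (N δ.1) × ℕ → SExp := fun δ => ofProd encVar ofNat
  have hz : PT e₁ (fun δ => ofList (ep δ) ((List.finRange (N δ.1)).map (π δ.1)).zipIdx) :=
    (order_zipIdx h).wk
  have h1 : PT (ctx e₁ ep) (fun ε => encVar ε.2.1) := head var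
  have h2 : PT (ctx e₁ ep) (fun ε => ofNat ε.2.2) := tail var
  have h3 : PT (ctx e₁ ep) (fun ε => encVar ε.1.2) :=
    wk (f := fun δ : (Σ γ, Fin (N γ)) => encVar δ.2) var
  have := flatMap (eb := fun _ => ofNat) (f := fun γ r => ((((List.finRange (N γ)).map
      (π γ)).zipIdx).filter fun p => decide (p.1 = r)).map Prod.snd) (finRange h)
    (map (ea := ep) (eb := fun _ => ofNat) (f := fun _ => Prod.snd)
      (filter (p := fun δ p => decide (p.1 = δ.2)) hz (var_eq h1 h3)) h2)
  convert this using 2 with γ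
  rw [ofList_encVar, flatMap_filter_zipIdx]

end PT

/-! ### The conversions of refutations in the two directions -/

theorem deriv_of_isProof {n : ℕ} {τ : CNF n} {R : List (Clause n)} (h : IsProof (ResStep τ) R) :
    Deriv (fun E => ∃ C ∈ τ, C.lits = E) (R.map Clause.lits) := by
  induction R using List.reverseRecOn with
  | nil => exact .nil
  | append_singleton R C ih =>
    obtain ⟨h1, h2⟩ := isProof_concat.1 h
    rw [List.map_append]
    refine (ih h1).concat ?_
    cases h2 with
    | hyp _ hC => exact .inl ⟨C, hC, rfl⟩
    | resolve i a A B _ hA hB hR =>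
      exact .inr ⟨(i, a), A.lits, List.mem_map_of_mem hA, B.lits, List.mem_map_of_mem hB,
        isRes_iff.2 hR⟩

theorem length_map_symm_finRange {n : ℕ} (π : Equiv.Perm (Fin n)) :
    ((List.finRange n).map π.symm).length = n := by simp

/-- The translation of a resolution refutation. -/
def translateRefutation {n : ℕ} (π : Equiv.Perm (Fin n)) (R : List (Clause n)) :
    List (RawLine n) :=
  translate ((List.finRange n).map π.symm) (levelsOf ((List.finRange n).map π.symm))
    (R.map Clause.lits)

theorem pt_translateRefutation :
    PT (Γ := Σ n : ℕ, Equiv.Perm (Fin n) × List (Clause n))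
      (fun γ => .cons (encodeOrder γ.2.1) (ofList Clause.encode γ.2.2))
      (fun γ => ofList RawLine.encode (translateRefutation γ.2.1 γ.2.2)) := by
  have hπ : PT (Γ := Σ n : ℕ, Equiv.Perm (Fin n) × List (Clause n))
      (fun γ => .cons (encodeOrder γ.2.1) (ofList Clause.encode γ.2.2))
      (fun γ => encodeOrder γ.2.1) := .head .id
  have hP : PT (Γ := Σ n : ℕ, Equiv.Perm (Fin n) × List (Clause n))
      (fun γ => .cons (encodeOrder γ.2.1) (ofList Clause.encode γ.2.2))
      (fun γ => ofList encSet (γ.2.2.map Clause.lits)) := by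
    simp only [ofList_map]
    exact .tail .id
  -- Any CNF that contains the axioms serves for the size bounds. The set of all lines of the
  -- refutation is chosen, since the refuted CNF is not in the context.
  have h := PT.allPasses (τ := fun γ : (Σ n : ℕ, Equiv.Perm (Fin n) × List (Clause n)) =>
    {C | C ∈ γ.2.2}) (PT.finRange hπ) (PT.enumeration hπ) hP
    (fun γ => enumerates_map_symm γ.2.1) (fun γ => length_map_symm_finRange γ.2.1)
    (fun γ E hE => List.mem_map.1 hE)
  exact PT.append h (PT.finish (PT.finRange hπ) h)

/-- The clause of a line. -/
def Line.asClause {n : ℕ} : Line n → Option (Clause n)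
  | .clause C => some C
  | .trail _ => none

theorem pt_filterMap_asClause :
    PT (Γ := Σ n : ℕ, Equiv.Perm (Fin n) × List (Line n))
      (fun γ => .cons (encodeOrder γ.2.1) (ofList Line.encode γ.2.2))
      (fun γ => ofList Clause.encode (γ.2.2.filterMap Line.asClause)) := by
  refine PT.filterMap (α := fun γ : (Σ n : ℕ, Equiv.Perm (Fin n) × List (Line n)) => Line γ.1)
    (β := fun γ => Clause γ.1) (ea := fun _ => Line.encode)
    (f := fun _ => Line.asClause) (.tail .id) ?_
  have hv : PT (ctx (Γ := Σ n : ℕ, Equiv.Perm (Fin n) × List (Line n))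
      (α := fun γ => Line γ.1)
      (fun γ => .cons (encodeOrder γ.2.1) (ofList Line.encode γ.2.2)) (fun _ => Line.encode))
      (fun δ => δ.2.toRaw.encode) := by
    simp only [encode_toRaw]
    exact .var
  have := PT.asClause hv
  convert this using 2 with δ
  obtain ⟨γ, C | t⟩ := δ <;> rfl

/-- The trail in a learning step only restricts which resolvents may be inferred, so without the
trails the clauses remain a resolution proof. -/
theorem isProof_filterMap_asClause {n : ℕ} {π : Equiv.Perm (Fin n)} {τ : CNF n} {R : List (Line n)}
    (h : IsProof (PZeroStep π τ) R) : IsProof (ResStep τ) (R.filterMap Line.asClause) := by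
  have mem : ∀ {R : List (Line n)} {C : Clause n}, Line.clause C ∈ R →
      C ∈ {C | C ∈ R.filterMap Line.asClause} := fun h => List.mem_filterMap.2 ⟨_, h, rfl⟩
  induction R using List.reverseRecOn with
  | nil => exact fun k hk => absurd hk (by simp)
  | append_singleton R L ih =>
    obtain ⟨h1, h2⟩ := isProof_concat.1 h
    rw [List.filterMap_append]
    cases L with
    | trail t => exact (List.append_nil _).symm ▸ ih h1
    | clause C =>
      refine isProof_concat.2 ⟨ih h1, ?_⟩
      cases h2 with
      | hyp _ hC => exact .hyp C hC
      | learning A B _ t i a hA hB _ hR _ _ => exact .resolve i a A B C (mem hA) (mem hB) hR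

open Polynomial in
theorem pZero_simulates_resolution : PSimulates pZero resolution := by
  obtain ⟨c, T, hrun, k, hT⟩ := pt_translateRefutation
  -- The first summand bounds the running time. The rest is the bound of `length_translate_le`, with
  -- `n` and the number of lines both replaced by their sum `X`.
  refine ⟨c, (X + 2) ^ k + (X + 2 * X * (2 * X * (2 * X)) * (X * ((X + X) *
    ((2 * X + 1) * (X + 2) + (3 * X + 4)))) + 2 * X * (2 * X + 3)), ?_⟩
  rintro n π τ R ⟨hR, hz⟩
  have hd := deriv_of_isProof hR
  have hv := enumerates_map_symm π
  obtain ⟨L, hL, hproof⟩ := Good.translate (τ := τ) hv (isLevels_levelsOf List.prefix_rfl)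
    (P := R.map Clause.lits) fun E hE => hd.of_mem_hypotheses hE
  refine ⟨L, T ⟨n, π, R⟩, ?_, ?_, ⟨hproof, ?_⟩, ?_⟩
  · have := hrun ⟨n, π, R⟩
    change Run c _ (ofList RawLine.encode (translate _ _ _)) _ at this
    rw [← hL, ofList_map] at this
    simpa only [encode_toRaw] using this
  · refine (hT ⟨n, π, R⟩).trans ?_
    simp only [eval_add, eval_pow, eval_X, eval_ofNat]
    exact Nat.le_add_right _ _
  · have h0 := zero_mem_translate hv (P := R.map Clause.lits) (by
      intro G hG
      obtain ⟨C, -, rfl⟩ := List.mem_map.1 hG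
      exact C.consistent') (List.mem_map.2 ⟨_, hz, rfl⟩)
    rw [← hL] at h0
    obtain ⟨l, hl, hl'⟩ := List.mem_map.1 h0
    rwa [← Line.toRaw_injective (a₁ := l) (a₂ := .clause (Clause.zero n)) hl']
  · have h1 := length_translate_le (P := R.map Clause.lits) (length_map_symm_finRange π)
    rw [← hL, List.length_map, List.length_map] at h1
    simp only [eval_add, eval_mul, eval_pow, eval_X, eval_ofNat, eval_one]
    refine h1.trans (le_trans ?_ (Nat.le_add_left _ _))
    rw [passBound]
    generalize hm : R.length = m
    have h2 : n ≤ n + m := Nat.le_add_right _ _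
    have h3 : m ≤ n + m := Nat.le_add_left _ _
    generalize n + m = x at h2 h3
    gcongr

open Polynomial in
theorem resolution_simulates_pZero : PSimulates resolution pZero := by
  obtain ⟨c, T, hrun, k, hT⟩ := pt_filterMap_asClause
  refine ⟨c, (X + 2) ^ k + X, ?_⟩
  rintro n π τ R ⟨hR, hz⟩
  refine ⟨R.filterMap Line.asClause, T ⟨n, π, R⟩, hrun ⟨n, π, R⟩, ?_,
    ⟨isProof_filterMap_asClause hR, List.mem_filterMap.2 ⟨_, hz, rfl⟩⟩, ?_⟩
  · refine (hT ⟨n, π, R⟩).trans ?_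
    simp only [eval_add, eval_pow, eval_X, eval_ofNat]
    exact Nat.le_add_right _ _
  · have := List.length_filterMap_le Line.asClause R
    simp only [eval_add, eval_pow, eval_X]
    omega

end OrderedCDCL

theorem theorem2p5 :
    OrderedCDCL.PolynomiallyEquivalent OrderedCDCL.pZero OrderedCDCL.resolution :=
  ⟨OrderedCDCL.pZero_simulates_resolution, OrderedCDCL.resolution_simulates_pZero⟩
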